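/- Let $\mathsf k$ be a complex Hilbert space, let $\mathcal F$ be the Boson Fock space over $L^2(\mathbb R_+;\mathsf k)$ and, for an interval $A$, let $\mathcal F_A$ be the Boson Fock space over $L^2(A;\mathsf k)$; write $\varepsilon(f)$ for the exponential vector of $f$, and identify $\mathcal F$ with $\mathcal F_{[0,t)}\otimes\mathcal F_{[t,\infty)}$ through $\varepsilon(f)\leftrightarrow\varepsilon(f|_{[0,t)})\otimes\varepsilon(f|_{[t,\infty)})$. For $t\in\mathbb R_+$ let $\theta_t$ be the right shift by $t$ on $L^2(\mathbb R_+;\mathsf k)$ and let $\Gamma_t$ be its second quantisation, $\Gamma_t\varepsilon(f)=\varepsilon(\theta_tf)$. A *finite quantum stop time* is a spectral measure $S$ on the Borel subsets of $[0,\infty]$, with values in the orthogonal projections on $\mathcal F$, such that $S(\{0\})=0=S(\{\infty\})$ and $S([0,t])\in B(\mathcal F_{[0,t)})\otimes I_{\mathcal F_{[t,\infty)}}$ for all $t\in(0,\infty)$. Let $S$ be a finite quantum stop time, let $f\in L^2(\mathbb R_+;\mathsf k)$, let $t\in[0,\infty]$ and put $J=[0,t]\cap\mathbb R_+$. A map $F:J\to\mathcal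 F$ is *future adapted* if $F(s)=\varepsilon(0|_{[0,s)})\otimes F_s$ with $F_s\in\mathcal F_{[s,\infty)}$ for all $s\in J\setminus\{0\}$; by convention $F(\infty)=\varepsilon(0)$ and $\varepsilon(f|_{[0,\infty)})\otimes F_\infty=\varepsilon(f)$. If $F$ is continuous, bounded and future adapted then $$\int_{[0,t]}S(\mathrm ds)\,\varepsilon(f|_{[0,s)})\otimes F_s:=\lim_\pi\sum_{j}S\bigl((\pi_{j-1},\pi_j]\bigr)\,\varepsilon(f|_{[0,\pi_j)})\otimes F_{\pi_j},$$ the limit being taken over the finite partitions $\pi$ of $[0,t]$, ordered by refinement. If $F$ is Borel measurable (with separable range), bounded and future adapted then the integrals $\int_{[0,r]}S(\mathrm ds)\,\varepsilon(f|_{[0,s)})\otimes F_s$ for $0\le r\le t$ are the vectors determined by $$\Bigl\langle\int_{[0,r]}S(\mathrm ds)\,\varepsilon(f|_{[0,s)})\otimes F_s,\int_{[0,r]}S(\mathrm ds)\,\varepsilon(g|_{[0,s)})\otimes G_s\Bigr\rangle=\int_{[0,r]}\langle F(s),G(s)\rangle\,S^{f,g}(\mathrm ds)$$ for all $g\in L^2(\mathbb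 R_+;\mathsf k)$ and all continuous, bounded, future-adapted $G$, where $S^{f,g}(\mathrm ds)=\exp\bigl(-\int_s^\infty\langle f(v),g(v)\rangle\,\mathrm dv\bigr)\langle\varepsilon(f),S(\mathrm ds)\varepsilon(g)\rangle$, together with $$S([0,q])\int_{[0,r]}S(\mathrm ds)\,\varepsilon(f|_{[0,s)})\otimes F_s=\int_{[0,q\wedge r]}S(\mathrm ds)\,\varepsilon(f|_{[0,s)})\otimes F_s\qquad\text{for all }q\in(0,\infty].$$ For a finite quantum stop time $S$ and $t\in(0,\infty]$ let $E_{S,t}$ be the bounded operator on $\mathcal F$ with $E_{S,t}\varepsilon(f)=\int_{[0,t]}S(\mathrm ds)\,\varepsilon(f|_{[0,s)})\otimes\varepsilon(0|_{[s,\infty)})$ for all $f$, and let $E_S=E_{S,\infty}$; let $\Gamma_S$ be the isometry with $\Gamma_Sx=\int_{[0,\infty]}S(\mathrm ds)\,\varepsilon(0|_{[0,s)})\otimes\Gamma_sx$ for all $x\in\mathcal F$, where $\Gamma_s$ is regarded as having range in $\varepsilon(0|_{[0,s)})\otimes\mathcal F_{[s,\infty)}\cong\mathcal F_{[s,\infty)}$;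 and let $j_S:\operatorname{im}E_S\otimes\operatorname{im}\Gamma_S\to\mathcal F$ be the isometric isomorphism with $$j_S(E_{S,t}\varepsilon(f)\otimes\Gamma_Sx)=\int_{[0,t]}S(\mathrm ds)\,\varepsilon(f|_{[0,s)})\otimes\Gamma_sx\qquad\text{for all }t\in(0,\infty],\ f\text{ and }x.$$ For finite quantum stop times $S$ and $T$, let $S\otimes T$ be the spectral measure on the Borel subsets of $[0,\infty]^2$ with $(S\otimes T)(A\times B)=j_S\bigl(S(A)\otimes\Gamma_ST(B)\Gamma_S^*\bigr)j_S^*$ for all Borel $A,B\subseteq[0,\infty]$, and let the *convolution* of $S$ and $T$ be $(S\star T)(C)=(S\otimes T)(\{(s,t):s+t\in C\})$ for all Borel $C\subseteq[0,\infty]$. **Theorem.** Let $S$ and $T$ be finite quantum stop times. Then $$(S\star T)([0,u])\,\varepsilon(f)=\int_{[0,u]}S(\mathrm ds)\,\varepsilon(f|_{[0,s)})\otimes\Gamma_sT([0,u-s])\Gamma_s^*\varepsilon(f)$$ for all $u\in[0,\infty]$ and $f\in L^2(\mathbb R_+;\mathsf k)$. Moreover, $S\star T$ is a finite quantum stop time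 such that $$E_{S\star T}\,\varepsilon(f)=\int_{[0,\infty]}S(\mathrm ds)\,\varepsilon(f|_{[0,s)})\otimes\Gamma_sE_T\Gamma_s^*\varepsilon(f)$$ and $$j_{S\star T}\bigl(E_{S\star T}\varepsilon(f)\otimes\Gamma_{S\star T}y\bigr)=\int_{[0,\infty]}S(\mathrm ds)\,\varepsilon(f|_{[0,s)})\otimes\Gamma_s\int_{[0,\infty]}T(\mathrm dt)\,\varepsilon\bigl(f(\cdot+s)|_{[0,t)}\bigr)\otimes\Gamma_ty$$ for all $f\in L^2(\mathbb R_+;\mathsf k)$ and $y\in\mathcal F$; in particular, all of these integrals exist. -/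

import Mathlib

open MeasureTheory Filter Topology Set
open scoped ENNReal NNReal TensorProduct InnerProductSpace

noncomputable section

namespace StopTime

universe u

/-! ### Hilbert-space tensor products and Boson Fock space -/

/-- The Hilbert-space tensor product: the completion of the algebraic tensor product. -/
abbrev HilbertTensor (E F : Type*) [NormedAddCommGroup E] [InnerProductSpace ℂ E]
    [NormedAddCommGroup F] [InnerProductSpace ℂ F] : Type _ :=
  UniformSpace.Completion (E ⊗[ℂ] F)

/-- The elementary tensor `x ⊗ y` in the Hilbert-space tensor product. -/
def elem {E F : Type*} [NormedAddCommGroup E] [InnerProductSpace ℂ E]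
    [NormedAddCommGroup F] [InnerProductSpace ℂ F] (x : E) (y : F) : HilbertTensor E F :=
  ((x ⊗ₜ[ℂ] y : E ⊗[ℂ] F) : UniformSpace.Completion (E ⊗[ℂ] F))

/-- A bundled complex Hilbert space (used only to define tensor powers by recursion). -/
structure HilbertBundle : Type (u + 1) where
  carrier : Type u
  [normed : NormedAddCommGroup carrier]
  [inner : InnerProductSpace ℂ carrier]
  [complete : CompleteSpace carrier]

attribute [instance] HilbertBundle.normed HilbertBundle.inner HilbertBundle.complete

section Fock

variable (H : Type u) [NormedAddCommGroup H] [InnerProductSpace ℂ H]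

/-- The `n`-fold Hilbert-space tensor power of `H`; the zeroth power is one dimensional. -/
def tensorPow : ℕ → HilbertBundle.{u}
  | 0 => ⟨EuclideanSpace ℂ PUnit.{u + 1}⟩
  | n + 1 => ⟨HilbertTensor H (tensorPow n).carrier⟩

variable {H} in
/-- The vector `v ⊗ ⋯ ⊗ v` (`n` factors). -/
def power (v : H) : (n : ℕ) → (tensorPow H n).carrier
  | 0 => (EuclideanSpace.single PUnit.unit 1 : EuclideanSpace ℂ PUnit.{u + 1})
  | n + 1 => elem v (power v n)

/-- The full Fock space over `H`: the Hilbert-space direct sum of the tensor powers. -/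
abbrev FullFock : Type u := lp (fun n => (tensorPow H n).carrier) 2

/-- The `n`-fold symmetric tensor power: the closed linear span of the vectors `v ⊗ ⋯ ⊗ v`. -/
def symPow (n : ℕ) : Submodule ℂ (tensorPow H n).carrier :=
  (Submodule.span ℂ (range fun v : H => power v n)).topologicalClosure

/-- Boson Fock space as a subspace of full Fock space. -/
def bosonFock : Submodule ℂ (FullFock H) where
  carrier := {x | ∀ n, x n ∈ symPow H n}
  add_mem' hx hy n := (symPow H n).add_mem (hx n) (hy n)
  zero_mem' n := (symPow H n).zero_mem
  smul_mem' c _ hx n := (symPow H n).smul_mem c (hx n)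

/-- Boson (symmetric) Fock space over `H`. -/
abbrev Fock : Type u := bosonFock H

theorem isClosed_bosonFock : IsClosed (bosonFock H : Set (FullFock H)) := by
  have h : (bosonFock H : Set (FullFock H)) =
      ⋂ n, (fun x : FullFock H => x n) ⁻¹' (symPow H n : Set (tensorPow H n).carrier) := by
    ext x
    simp only [mem_iInter]
    rfl
  rw [h]
  refine isClosed_iInter fun n => IsClosed.preimage ?_ ?_
  · exact (lp.evalCLM ℂ (fun n => (tensorPow H n).carrier) 2 n).continuous
  · exact Submodule.isClosed_topologicalClosure _

instance : CompleteSpace (Fock H) := (isClosed_bosonFock H).completeSpace_coe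

variable {H}

theorem norm_power (v : H) (n : ℕ) : ‖power v n‖ = ‖v‖ ^ n := by
  induction n with
  | zero => exact (PiLp.norm_single 2 (fun _ : PUnit.{u + 1} => ℂ) PUnit.unit 1).trans (by simp)
  | succ n ih =>
    have h : ‖power v (n + 1)‖ = ‖v ⊗ₜ[ℂ] power v n‖ := UniformSpace.Completion.norm_coe _
    rw [h, TensorProduct.norm_tmul, ih, pow_succ']

theorem memℓp_expVec (v : H) :
    Memℓp (fun n => ((Real.sqrt n.factorial : ℂ)⁻¹) • power v n) 2 := by
  refine memℓp_gen ?_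
  refine (Real.summable_pow_div_factorial (‖v‖ ^ 2)).congr fun n => ?_
  have h2 : (2 : ℝ≥0∞).toReal = ((2 : ℕ) : ℝ) := by simp
  rw [h2, Real.rpow_natCast, norm_smul, norm_power, mul_pow, norm_inv, Complex.norm_real,
    Real.norm_eq_abs, abs_of_nonneg (Real.sqrt_nonneg _), inv_pow,
    Real.sq_sqrt (Nat.cast_nonneg _)]
  rw [← pow_mul, ← pow_mul, mul_comm 2 n, div_eq_inv_mul]

/-- The exponential vector `ε(v)`, with `n`th component `(n!)^(-1/2) v ⊗ ⋯ ⊗ v`. -/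
def expVec (v : H) : Fock H :=
  ⟨⟨fun n => ((Real.sqrt n.factorial : ℂ)⁻¹) • power v n, memℓp_expVec v⟩, fun n =>
    (symPow H n).smul_mem _ (Submodule.le_topologicalClosure _
      (Submodule.subset_span ⟨v, rfl⟩))⟩

open Classical in
/-- Second quantisation: the bounded operator on Fock space which maps `ε(v)` to `ε(A v)`
for every `v`. -/
def secondQuant (A : H → H) : Fock H →L[ℂ] Fock H :=
  if h : ∃ B : Fock H →L[ℂ] Fock H, ∀ v, B (expVec v) = expVec (A v) then h.choose else 0

end Fock

/-! ### The Fock spaces over intervals, shifts and the tensor decomposition -/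

section Spaces

variable (k : Type u) [NormedAddCommGroup k] [InnerProductSpace ℂ k]

/-- The Hilbert space `L²(A; k)`. -/
abbrev L2 (A : Set ℝ) : Type u := Lp k 2 ((volume : Measure ℝ).restrict A)

/-- The space `L²(ℝ₊; k)`. -/
abbrev L2Half : Type u := L2 k (Ici 0)

/-- The ambient Boson Fock space, over `L²(ℝ₊; k)`. -/
abbrev FockHalf : Type u := Fock (L2Half k)

/-- The Fock space over `L²([0, t); k)`. -/
abbrev FockBefore (t : ℝ≥0) : Type u := Fock (L2 k (Ico 0 (t : ℝ)))

/-- The Fock space over `L²([t, ∞); k)`. -/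
abbrev FockAfter (t : ℝ≥0) : Type u := Fock (L2 k (Ici (t : ℝ)))

variable {k}

/-- The restriction of `f ∈ L²(ℝ₊; k)` to the set `A ⊆ ℝ₊`. -/
def restr {A : Set ℝ} (hA : A ⊆ Ici 0) (f : L2Half k) : L2 k A :=
  ((Lp.memLp f).mono_measure (Measure.restrict_mono hA le_rfl)).toLp f

/-- The restriction `f|_{[0, t)}`. -/
def before (t : ℝ≥0) (f : L2Half k) : L2 k (Ico 0 (t : ℝ)) := restr Ico_subset_Ici_self f

/-- The restriction `f|_{[t, ∞)}`. -/
def after (t : ℝ≥0) (f : L2Half k) : L2 k (Ici (t : ℝ)) := restr (Ici_subset_Ici.2 t.2) f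

theorem memLp_shift (t : ℝ≥0) (f : L2Half k) :
    MemLp ((Ici (t : ℝ)).indicator fun s => f (s - t)) 2
      ((volume : Measure ℝ).restrict (Ici 0)) := by
  rw [memLp_indicator_iff_restrict measurableSet_Ici, Measure.restrict_restrict measurableSet_Ici,
    inter_eq_left.2 (Ici_subset_Ici.2 (NNReal.coe_nonneg t))]
  have h := (measurePreserving_sub_right (volume : Measure ℝ) (t : ℝ)).restrict_preimage
    (measurableSet_Ici (a := (0 : ℝ)))
  have h' : (fun s : ℝ => s - t) ⁻¹' Ici 0 = Ici (t : ℝ) := by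
    ext s; simp
  rw [h'] at h
  exact (Lp.memLp f).comp_measurePreserving h

theorem memLp_shiftAdj (t : ℝ≥0) (f : L2Half k) :
    MemLp (fun s => f (s + t)) 2 ((volume : Measure ℝ).restrict (Ici 0)) := by
  have h := (measurePreserving_add_right (volume : Measure ℝ) (t : ℝ)).restrict_preimage
    (measurableSet_Ici (a := (t : ℝ)))
  have h' : (fun s : ℝ => s + t) ⁻¹' Ici (t : ℝ) = Ici (0 : ℝ) := by
    ext s; simp
  rw [h'] at h
  exact ((Lp.memLp f).mono_measure
    (Measure.restrict_mono (Ici_subset_Ici.2 t.2) le_rfl)).comp_measurePreserving h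

/-- The isometric right shift `θ_t` on `L²(ℝ₊; k)`. -/
def shift (t : ℝ≥0) (f : L2Half k) : L2Half k := (memLp_shift t f).toLp _

/-- The function `f(· + t)`, for `f ∈ L²(ℝ₊; k)`. -/
def shiftAdj (t : ℝ≥0) (f : L2Half k) : L2Half k := (memLp_shiftAdj t f).toLp _

variable (k) in
/-- The second quantisation `Γ_t` of the right shift. -/
def Gam (t : ℝ≥0) : FockHalf k →L[ℂ] FockHalf k := secondQuant (shift t)

open Classical in
variable (k) in
/-- The unitary from the tensor product of the Fock spaces over `[0, t)` and `[t, ∞)` onto the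
ambient Fock space which maps `ε(f|_{[0, t)}) ⊗ ε(f|_{[t, ∞)})` to `ε(f)` for every `f`. -/
def split (t : ℝ≥0) : HilbertTensor (FockBefore k t) (FockAfter k t) →L[ℂ] FockHalf k :=
  if h : ∃ U : HilbertTensor (FockBefore k t) (FockAfter k t) ≃ₗᵢ[ℂ] FockHalf k,
      ∀ f : L2Half k, U (elem (expVec (before t f)) (expVec (after t f))) = expVec f
  then (h.choose.toContinuousLinearEquiv : _ →L[ℂ] _) else 0

end Spaces

/-! ### Spectral measures and quantum stop times -/

/-- A spectral measure on `X` with values in the orthogonal projections on `E`. The values at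
sets which are not measurable are irrelevant. -/
structure IsSpectralMeasure {X : Type*} [MeasurableSpace X] {E : Type*} [NormedAddCommGroup E]
    [InnerProductSpace ℂ E] [CompleteSpace E] (S : Set X → (E →L[ℂ] E)) : Prop where
  proj : ∀ A, MeasurableSet A → IsStarProjection (S A)
  measure : ∀ x y : E, ∃ μ : ComplexMeasure X, ∀ A, MeasurableSet A → μ A = ⟪x, S A y⟫_ℂ
  univ : S univ = 1

section Stop

variable {k : Type u} [NormedAddCommGroup k] [InnerProductSpace ℂ k]

/-- A quantum stop time: an identity-adapted spectral measure on the Borel sets of `[0, ∞]`. -/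
structure IsQuantumStopTime (S : Set ℝ≥0∞ → (FockHalf k →L[ℂ] FockHalf k)) : Prop where
  spectral : IsSpectralMeasure S
  zero : ∃ c : ℂ, S {0} = c • (1 : FockHalf k →L[ℂ] FockHalf k)
  adapted : ∀ t : ℝ≥0, 0 < t → ∃ Y : FockBefore k t →L[ℂ] FockBefore k t,
    ∀ x y, S (Iic (t : ℝ≥0∞)) (split k t (elem x y)) = split k t (elem (Y x) y)

/-- A finite quantum stop time, with the standing requirement that there is no mass at `0`. -/
structure IsFiniteQuantumStopTime (S : Set ℝ≥0∞ → (FockHalf k →L[ℂ] FockHalf k)) : Prop where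
  isStopTime : IsQuantumStopTime S
  zero : S {0} = 0
  top : S {⊤} = 0

variable (S T : Set ℝ≥0∞ → (FockHalf k →L[ℂ] FockHalf k))

open Classical in
/-- The complex measure `A ↦ ⟪x, S(A) y⟫`. -/
def coeffMeasure (x y : FockHalf k) : ComplexMeasure ℝ≥0∞ :=
  if h : ∃ μ : ComplexMeasure ℝ≥0∞, ∀ A, MeasurableSet A → μ A = ⟪x, S A y⟫_ℂ
  then h.choose else 0

/-- The measure `S^{f,g}` on `[0, ∞]`, with density `exp(-∫_s^∞ ⟪f(r), g(r)⟫ dr)` with respect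
to `⟪ε(f), S(ds) ε(g)⟫`. -/
def stopMeasure (f g : L2Half k) : ComplexMeasure ℝ≥0∞ :=
  (coeffMeasure S (expVec f) (expVec g)).withDensity
    (fun s => Complex.exp (-∫ r in {r : ℝ | 0 ≤ r ∧ s ≤ ENNReal.ofReal r}, ⟪f r, g r⟫_ℂ))
    (ContinuousLinearMap.mul ℝ ℂ)

/-! ### Stop-time integrals

A function on `J`, the set of finite `s` with `s ≤ t`, is represented by a function on `ℝ≥0`, of
which only the values on `J` are used; here `t` is finite and `J = [0, t]` or `t = ∞` and
`J = ℝ₊`. -/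

/-- Future adaptedness on `J`: `F(s) = ε(0|_{[0,s)}) ⊗ F_s` for all non-zero `s ∈ J`. -/
def FutureAdapted (t : ℝ≥0∞) (F : ℝ≥0 → FockHalf k) : Prop :=
  ∀ s : ℝ≥0, 0 < s → (s : ℝ≥0∞) ≤ t → ∃ z : FockAfter k s, F s = split k s (elem (expVec 0) z)

/-- Boundedness on `J`. -/
def BoundedUpTo (t : ℝ≥0∞) (F : ℝ≥0 → FockHalf k) : Prop :=
  ∃ C : ℝ, ∀ s : ℝ≥0, (s : ℝ≥0∞) ≤ t → ‖F s‖ ≤ C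

open Classical in
/-- The vector `x_s` such that `x = ε(0|_{[0,s)}) ⊗ x_s`. -/
def futurePart (s : ℝ≥0) (x : FockHalf k) : FockAfter k s :=
  if h : ∃ z : FockAfter k s, x = split k s (elem (expVec 0) z) then h.choose else 0

open Classical in
/-- The vector `ε(f|_{[0,s)}) ⊗ F_s`, which is `ε(f)` if `s = ∞`. -/
def stopTerm (f : L2Half k) (F : ℝ≥0 → FockHalf k) (s : ℝ≥0∞) : FockHalf k :=
  if s = ⊤ then expVec f
  else split k s.toNNReal (elem (expVec (before s.toNNReal f))
    (futurePart s.toNNReal (F s.toNNReal)))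

/-- Finite partitions of `[0, t]`, given by their sets of points and ordered by refinement. -/
abbrev Partition (t : ℝ≥0∞) : Type :=
  {P : Finset ℝ≥0∞ // 0 ∈ P ∧ t ∈ P ∧ ∀ p ∈ P, p ≤ t}

open Classical in
/-- The Riemann sum `∑ S((π_{j-1}, π_j]) ε(f|_{[0,π_j)}) ⊗ F_{π_j}`. The sum is over the non-zero
points `p` of the partition, and the point before `p` is the largest point less than `p`. -/
def riemannSum (f : L2Half k) (F : ℝ≥0 → FockHalf k) (P : Finset ℝ≥0∞) : FockHalf k :=
  ∑ p ∈ P with 0 < p, S (Ioc ((P.filter (· < p)).sup id) p) (stopTerm f F p)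

/-- The vector `v` is the limit, as the partition of `[0, t]` is refined, of the Riemann sums for
`∫_{[0,t]} S(ds) ε(f|_{[0,s)}) ⊗ F_s`. This is the definition of the integral if `F` is continuous,
bounded and future adapted. -/
def HasRiemannStopIntegral (t : ℝ≥0∞) (f : L2Half k) (F : ℝ≥0 → FockHalf k)
    (v : FockHalf k) : Prop :=
  Tendsto (fun P : Partition t => riemannSum S f F P.1) atTop (𝓝 v)

open Classical in
/-- The extension of `F` to `[0, ∞]` by `F(∞) = ε(0)`. -/
def extTop (F : ℝ≥0 → FockHalf k) (s : ℝ≥0∞) : FockHalf k :=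
  if s = ⊤ then expVec 0 else F s.toNNReal

/-- The vector `v` is `∫_{[0,t]} S(ds) ε(f|_{[0,s)}) ⊗ F_s`, where `F` is measurable, bounded and
future adapted. The integrals `I r` over `[0, r]`, for `r ≤ t`, are characterised by their inner
products with the integrals of continuous functions,
`⟪∫_{[0,r]} S(ds) ε(f|_{[0,s)}) ⊗ F_s, ∫_{[0,r]} S(ds) ε(g|_{[0,s)}) ⊗ G_s⟫`
`= ∫_{[0,r]} ⟪F(s), G(s)⟫ S^{f,g}(ds)`,
together with the identity
`S([0,q]) ∫_{[0,r]} S(ds) ε(f|_{[0,s)}) ⊗ F_s = ∫_{[0, min q r]} S(ds) ε(f|_{[0,s)}) ⊗ F_s`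
for `q > 0`. -/
def IsStopIntegral (t : ℝ≥0∞) (f : L2Half k) (F : ℝ≥0 → FockHalf k) (v : FockHalf k) : Prop :=
  StronglyMeasurable (fun s : {s : ℝ≥0 // (s : ℝ≥0∞) ≤ t} => F s) ∧
  BoundedUpTo t F ∧ FutureAdapted t F ∧
  ∃ I : ℝ≥0∞ → FockHalf k, I t = v ∧
    (∀ r ≤ t, ∀ (g : L2Half k) (G : ℝ≥0 → FockHalf k) (w : FockHalf k),
      ContinuousOn G {s : ℝ≥0 | (s : ℝ≥0∞) ≤ r} → BoundedUpTo r G → FutureAdapted r G →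
      HasRiemannStopIntegral S r g G w →
      ⟪I r, w⟫_ℂ = ((stopMeasure S f g).restrict (Iic r)).integral
        (fun s => ⟪extTop F s, extTop G s⟫_ℂ) (ContinuousLinearMap.mul ℝ ℂ)) ∧
    (∀ q r, 0 < q → r ≤ t → S (Iic q) (I r) = I (min q r))

/-! ### Time projections, stopped shifts, the strong Markov isomorphism and convolution -/

open Classical in
/-- The time projection `E_{S,t}`, with
`E_{S,t} ε(f) = ∫_{[0,t]} S(ds) ε(f|_{[0,s)}) ⊗ ε(0|_{[s,∞)})` for all `f`. -/
def timeProjUpTo (t : ℝ≥0∞) : FockHalf k →L[ℂ] FockHalf k :=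
  if h : ∃ E : FockHalf k →L[ℂ] FockHalf k, ∀ f : L2Half k,
    HasRiemannStopIntegral S t f (fun _ => expVec 0) (E (expVec f)) then h.choose else 0

/-- The time projection `E_S`. -/
def timeProj : FockHalf k →L[ℂ] FockHalf k := timeProjUpTo S ⊤

open Classical in
/-- The isometry `Γ_S`, with `Γ_S x = ∫_{[0,∞]} S(ds) Γ_s x` for all `x`. -/
def stopShift : FockHalf k →L[ℂ] FockHalf k :=
  if h : ∃ B : FockHalf k →L[ℂ] FockHalf k, ∀ x : FockHalf k,
    HasRiemannStopIntegral S ⊤ 0 (fun s => Gam k s x) (B x) then h.choose else 0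

/-- The pre-`S` space, the range of `E_S`. -/
abbrev preSpace : Submodule ℂ (FockHalf k) := (timeProj S : FockHalf k →ₗ[ℂ] FockHalf k).range

/-- The post-`S` space, the range of `Γ_S`. -/
abbrev postSpace : Submodule ℂ (FockHalf k) := (stopShift S : FockHalf k →ₗ[ℂ] FockHalf k).range

/-- `E_S x` as an element of the pre-`S` space. -/
def toPre (x : FockHalf k) : preSpace S := ⟨timeProj S x, x, rfl⟩

/-- `Γ_S x` as an element of the post-`S` space. -/
def toPost (x : FockHalf k) : postSpace S := ⟨stopShift S x, x, rfl⟩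

open Classical in
/-- The isometric isomorphism `j_S` from the tensor product of the pre-`S` and post-`S` spaces onto
the ambient Fock space, with
`j_S(E_{S,t} ε(f) ⊗ Γ_S x) = ∫_{[0,t]} S(ds) ε(f|_{[0,s)}) ⊗ Γ_s x`
for all `t ∈ (0, ∞]`, `f` and `x`. -/
def jIso : HilbertTensor (preSpace S) (postSpace S) →L[ℂ] FockHalf k :=
  if h : ∃ j : HilbertTensor (preSpace S) (postSpace S) ≃ₗᵢ[ℂ] FockHalf k,
      ∀ (t : ℝ≥0∞) (f : L2Half k) (x : FockHalf k) (a : preSpace S), 0 < t →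
        (a : FockHalf k) = timeProjUpTo S t (expVec f) →
        HasRiemannStopIntegral S t f (fun s => Gam k s x) (j (elem a (toPost S x)))
  then (h.choose.toContinuousLinearEquiv : _ →L[ℂ] _) else 0

/-- The spectral measure `R` on `[0, ∞]²` is `S ⊗ T`, that is,
`R(A × B) j_S = j_S (S(A) ⊗ Γ_S T(B) Γ_S^*)` for all Borel sets `A` and `B`. -/
def IsStopTensor (R : Set (ℝ≥0∞ × ℝ≥0∞) → (FockHalf k →L[ℂ] FockHalf k)) : Prop :=
  IsSpectralMeasure R ∧
  ∀ A B : Set ℝ≥0∞, MeasurableSet A → MeasurableSet B →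
    ∀ (a a' : preSpace S) (b : postSpace S), (a' : FockHalf k) = S A a →
      R (A ×ˢ B) (jIso S (elem a b)) =
        jIso S (elem a' (toPost S (T B (ContinuousLinearMap.adjoint (stopShift S) b))))

open Classical in
/-- The spectral measure `S ⊗ T` on the Borel sets of `[0, ∞]²`. -/
def stopTensor : Set (ℝ≥0∞ × ℝ≥0∞) → (FockHalf k →L[ℂ] FockHalf k) :=
  if h : ∃ R, IsStopTensor S T R then h.choose else 0

/-- The convolution `S ⋆ T`. -/
def conv (C : Set ℝ≥0∞) : FockHalf k →L[ℂ] FockHalf k :=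
  stopTensor S T {p | p.1 + p.2 ∈ C}

end Stop

end StopTime

end

set_option linter.unusedSectionVars false

noncomputable section

namespace StopTime

/-! ### Total families in inner product spaces -/

section Total

variable {ι κ E F G : Type*} [NormedAddCommGroup E] [InnerProductSpace ℂ E]
  [NormedAddCommGroup F] [InnerProductSpace ℂ F] [NormedAddCommGroup G] [InnerProductSpace ℂ G]

/-! Write `f_s` for `f(· + s)`. The proof treats Fock space as if it were a direct integral over the
time `s` at which `S` stops, without constructing one. A bounded measurable function `x` on `[0, ∞]`
stands for the vector `∫ S(ds) ε(f|_{[0,s)}) ⊗ Γ_s x(s)`, which is pinned down by its pairings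
`⟪S(A) ε(g), v⟫ = ∫_A ⟪ε(g_s), x(s)⟫ S^{g,f}(ds)`. The exponential vector `ε(f)` is represented by
`s ↦ ε(f_s)`, because the density in `S^{g,f}` cancels `⟪ε(g_s), ε(f_s)⟫` (`inner_expVec_eq_cint`).

Adaptedness of `S` enters through `stopMeasure_local`: on subsets of `[0, p]` the measure `S^{g,f}`
sees only `f|_{[0,p)}`. Hence each term of a Riemann sum is represented over the same `f`
(`strong_slide`), the representing step functions converge pointwise, and dominated convergence
against `S^{f,f}` makes the sums converge (`exists_tendsto_rsum`). Approximation by simple functions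
then gives the integral `sint S f x` for every bounded measurable `x`. Three facts make it usable:
`⟪sint S g y, sint S f x⟫ = ∫ ⟪y, x⟫ dS^{g,f}`, `S(A)` multiplies `x` by the indicator of `A`, and
these vectors are total.

In this picture `E_S ε(f)`, `Γ_S x` and `j_S(E_S ε(f) ⊗ Γ_S x)` are the integrals of the constants
`ε(0)` (over `f`), `x` (over `0`) and `x` (over `f`). So `(S ⊗ T)(M)` must act fibrewise, `x(s) ↦
T(M_s) x(s)` with `M_s` the section of `M`. `sectionProj` constructs this operator, and
`stopTensor_eq` identifies it with `S ⊗ T` since the two agree on rectangles. Therefore `(S ⋆ T)(C)`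
acts by `T({t | s + t ∈ C})` (`conv_sint`). Applied to `ε(f)` with `C = [0, u]` this is the first
formula. With `C = {0}` and `C = {∞}` it gives finiteness, and with `C = [0, p]` the matrix elements
are integrals over `[0, p]` in which both measure and integrand are local, which is adaptedness
(`conv_adapted_inner`).

The remaining two formulas come from the disintegration of `(S ⋆ T)^{g,f}` into the measures
`T^{g_s,f_s}`, translated by `s` and integrated against `S^{g,f}(ds)` (`cint_stopMeasure_conv`). It
yields `sint (S ⋆ T) f y = sint S f (s ↦ sint T f_s y)` for constant `y` (`sint_conv_const`); `y =
ε(0)` gives `E_{S⋆T}`, and arbitrary `y` gives `j_{S⋆T}`. -/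

/-- The linear span of the family is dense. -/
def Total (a : ι → E) : Prop := Dense (Submodule.span ℂ (range a) : Set E)

theorem Total.denseRange {a : ι → E} (ha : Total a) :
    DenseRange (Finsupp.linearCombination ℂ a) := by
  have h : range (Finsupp.linearCombination ℂ a) = (Submodule.span ℂ (range a) : Set E) := by
    rw [← Finsupp.range_linearCombination]; rfl
  rw [DenseRange, h]; exact ha

theorem inner_linearCombination (a : ι → E) (b : κ → E) (c : ι →₀ ℂ) (d : κ →₀ ℂ) :
    ⟪Finsupp.linearCombination ℂ a c, Finsupp.linearCombination ℂ b d⟫_ℂ =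
      ∑ i ∈ c.support, ∑ j ∈ d.support, starRingEnd ℂ (c i) * (d j * ⟪a i, b j⟫_ℂ) := by
  simp only [Finsupp.linearCombination_apply, Finsupp.sum, sum_inner, inner_sum, inner_smul_left,
    inner_smul_right]
  simp_rw [Finset.mul_sum]
  rw [Finset.sum_comm]
  exact Finset.sum_congr rfl fun i _ => Finset.sum_congr rfl fun j _ => by ring

/-- The bound does double duty: it makes the assignment on combinations well defined and lets it
extend by continuity. -/
theorem exists_clm_of_bound [CompleteSpace F] {a : ι → E} (ha : Total a) (b : ι → F) (C : ℝ)
    (h : ∀ c : ι →₀ ℂ,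
      ‖Finsupp.linearCombination ℂ b c‖ ≤ C * ‖Finsupp.linearCombination ℂ a c‖) :
    ∃ K : E →L[ℂ] F, (∀ i, K (a i) = b i) ∧ ∀ x, ‖K x‖ ≤ C * ‖x‖ := by
  refine ⟨(Finsupp.linearCombination ℂ b).extendOfNorm (Finsupp.linearCombination ℂ a),
    fun i => ?_, LinearMap.norm_extendOfNorm_apply_le ha.denseRange C h⟩
  have := LinearMap.extendOfNorm_eq (f := Finsupp.linearCombination ℂ b) ha.denseRange ⟨C, h⟩
    (Finsupp.single i 1)
  simpa using this

theorem norm_linearCombination_of_gram {a : ι → E} {b : ι → F}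
    (h : ∀ i j, ⟪b i, b j⟫_ℂ = ⟪a i, a j⟫_ℂ) (c : ι →₀ ℂ) :
    ‖Finsupp.linearCombination ℂ b c‖ = ‖Finsupp.linearCombination ℂ a c‖ := by
  have : ⟪Finsupp.linearCombination ℂ b c, Finsupp.linearCombination ℂ b c⟫_ℂ =
      ⟪Finsupp.linearCombination ℂ a c, Finsupp.linearCombination ℂ a c⟫_ℂ := by
    rw [inner_linearCombination, inner_linearCombination]
    simp only [h]
  rw [@norm_eq_sqrt_re_inner ℂ, @norm_eq_sqrt_re_inner ℂ E, this]

theorem clm_eq_of_total {a : ι → E} (ha : Total a) {K L : E →L[ℂ] F}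
    (h : ∀ i, K (a i) = L (a i)) : K = L := by
  refine ContinuousLinearMap.ext_on ha ?_
  rintro _ ⟨i, rfl⟩
  exact h i

theorem eq_of_total_inner {a : ι → E} (ha : Total a) {x y : E}
    (h : ∀ i, ⟪a i, x⟫_ℂ = ⟪a i, y⟫_ℂ) : x = y := by
  have h1 : ∀ z ∈ Submodule.span ℂ (range a), ⟪z, x⟫_ℂ = ⟪z, y⟫_ℂ := by
    intro z hz
    induction hz using Submodule.span_induction with
    | mem z hz => obtain ⟨i, rfl⟩ := hz; exact h i
    | zero => simp
    | add z w _ _ hz hw => rw [inner_add_left, inner_add_left, hz, hw]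
    | smul c z _ hz => rw [inner_smul_left, inner_smul_left, hz]
  have h2 : (fun z => ⟪z, x⟫_ℂ) = fun z => ⟪z, y⟫_ℂ :=
    Continuous.ext_on ha (by fun_prop) (by fun_prop) h1
  exact ext_inner_left ℂ fun z => congrFun h2 z

theorem Total.induction {a : ι → E} (ha : Total a) {P : E → Prop} (mem : ∀ i, P (a i))
    (zero : P 0) (add : ∀ x y, P x → P y → P (x + y)) (smul : ∀ (c : ℂ) x, P x → P (c • x))
    (lim : ∀ (x : ℕ → E) (y : E), (∀ n, P (x n)) → Tendsto x atTop (𝓝 y) → P y) (y : E) :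
    P y := by
  have h1 : ∀ z ∈ Submodule.span ℂ (range a), P z := by
    intro z hz
    induction hz using Submodule.span_induction with
    | mem z hz => obtain ⟨i, rfl⟩ := hz; exact mem i
    | zero => exact zero
    | add z w _ _ hz hw => exact add _ _ hz hw
    | smul c z _ hz => exact smul _ _ hz
  obtain ⟨x, hx, hy⟩ := mem_closure_iff_seq_limit.1 (ha y)
  exact lim x y (fun n => h1 _ (hx n)) hy

theorem inner_eq_of_total {a : ι → E} (ha : Total a) {K : E →L[ℂ] F} {L : E →L[ℂ] G}
    (h : ∀ i j, ⟪K (a i), K (a j)⟫_ℂ = ⟪L (a i), L (a j)⟫_ℂ) (x y : E) :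
    ⟪K x, K y⟫_ℂ = ⟪L x, L y⟫_ℂ := by
  have h1 : ∀ i y, ⟪K (a i), K y⟫_ℂ = ⟪L (a i), L y⟫_ℂ := by
    intro i
    refine ha.induction (h i) (by simp) (fun x y hx hy => ?_) (fun c x hx => ?_)
      fun x y hx hy => ?_
    · simp only [map_add, inner_add_right, hx, hy]
    · simp only [map_smul, inner_smul_right, hx]
    · refine tendsto_nhds_unique (((by fun_prop : Continuous fun y => ⟪K (a i), K y⟫_ℂ).tendsto
        y).comp hy) ((((by fun_prop : Continuous fun y => ⟪L (a i), L y⟫_ℂ).tendsto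
        y).comp hy).congr fun n => (hx n).symm)
  revert x
  refine ha.induction (fun i => h1 i y) (by simp) (fun x z hx hz => ?_) (fun c x hx => ?_)
    fun x z hx hz => ?_
  · simp only [map_add, inner_add_left, hx, hz]
  · simp only [map_smul, inner_smul_left, hx]
  · refine tendsto_nhds_unique (((by fun_prop : Continuous fun x => ⟪K x, K y⟫_ℂ).tendsto
        z).comp hz) ((((by fun_prop : Continuous fun x => ⟪L x, L y⟫_ℂ).tendsto
        z).comp hz).congr fun n => (hx n).symm)

/-- The norm of a linear combination is a function of the Gram matrix alone. Most operators below
are produced in this way. -/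
theorem exists_isometry_of_gram [CompleteSpace F] {a : ι → E} (ha : Total a) {b : ι → F}
    (h : ∀ i j, ⟪b i, b j⟫_ℂ = ⟪a i, a j⟫_ℂ) : ∃ U : E →ₗᵢ[ℂ] F, ∀ i, U (a i) = b i := by
  obtain ⟨K, hK, -⟩ := exists_clm_of_bound ha b 1 fun c => by
    rw [norm_linearCombination_of_gram h, one_mul]
  have h1 : ∀ x y, ⟪K x, K y⟫_ℂ = ⟪ContinuousLinearMap.id ℂ E x, ContinuousLinearMap.id ℂ E y⟫_ℂ :=
    inner_eq_of_total ha fun i j => by simp [hK, h]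
  exact ⟨LinearMap.isometryOfInner (K : E →ₗ[ℂ] F) h1, hK⟩

theorem exists_unitary_of_gram [CompleteSpace E] [CompleteSpace F] {a : ι → E} (ha : Total a)
    {b : ι → F} (hb : Total b) (h : ∀ i j, ⟪b i, b j⟫_ℂ = ⟪a i, a j⟫_ℂ) :
    ∃ U : E ≃ₗᵢ[ℂ] F, ∀ i, U (a i) = b i := by
  obtain ⟨U, hU⟩ := exists_isometry_of_gram ha h
  -- The range of an isometry of a complete space is closed, and here it contains a dense span.
  have hs : Function.Surjective U := by
    have hc : IsClosed (range U) := U.isometry.isClosedEmbedding.isClosed_range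
    have hd : Dense (range U) := by
      refine hb.mono ?_
      have : Submodule.span ℂ (range b) ≤ LinearMap.range U.toLinearMap := by
        rw [Submodule.span_le]
        rintro _ ⟨i, rfl⟩
        exact ⟨a i, hU i⟩
      exact this
    have := hd.closure_eq
    rw [hc.closure_eq] at this
    exact range_eq_univ.1 this
  exact ⟨LinearIsometryEquiv.ofSurjective U hs, hU⟩

theorem Total.of_closure {a : ι → E} {b : κ → E} (ha : Total a)
    (h : ∀ i, a i ∈ closure (Submodule.span ℂ (range b) : Set E)) : Total b := by
  have h1 : Submodule.span ℂ (range a) ≤ (Submodule.span ℂ (range b)).topologicalClosure := by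
    rw [Submodule.span_le]
    rintro _ ⟨i, rfl⟩
    exact h i
  have h2 : Dense ((Submodule.span ℂ (range b)).topologicalClosure : Set E) := ha.mono h1
  rw [Submodule.topologicalClosure_coe] at h2
  exact dense_closure.1 h2

theorem Total.image {a : ι → E} (ha : Total a) (K : E →L[ℂ] F) (hK : DenseRange K) :
    Total fun i => K (a i) := by
  have : (Submodule.span ℂ (range fun i => K (a i)) : Set F) =
      K '' (Submodule.span ℂ (range a) : Set E) := by
    have h := Submodule.map_span (K : E →ₗ[ℂ] F) (range a)
    have h2 := congrArg (fun p : Submodule ℂ F => (p : Set F)) h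
    simp only [Submodule.map_coe, ContinuousLinearMap.coe_coe] at h2
    rw [h2, ← range_comp]; rfl
  rw [Total, this]
  exact hK.dense_image K.continuous ha

/-! ### Elementary tensors -/

theorem inner_elem (x x' : E) (y y' : F) :
    ⟪elem x y, elem x' y'⟫_ℂ = ⟪x, x'⟫_ℂ * ⟪y, y'⟫_ℂ := by
  simp only [elem]
  rw [UniformSpace.Completion.inner_coe, TensorProduct.inner_tmul]

theorem norm_elem (x : E) (y : F) : ‖elem x y‖ = ‖x‖ * ‖y‖ := by
  simp only [elem]
  rw [UniformSpace.Completion.norm_coe, TensorProduct.norm_tmul]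

variable (E F) in
/-- The elementary tensor as a bounded bilinear map. -/
def elemL : E →L[ℂ] F →L[ℂ] HilbertTensor E F :=
  LinearMap.mkContinuous₂ (LinearMap.mk₂ ℂ elem
    (fun x x' y => by simp only [elem, TensorProduct.add_tmul, UniformSpace.Completion.coe_add])
    (fun c x y => by
      simp only [elem, ← TensorProduct.smul_tmul', UniformSpace.Completion.coe_smul])
    (fun x y y' => by simp only [elem, TensorProduct.tmul_add, UniformSpace.Completion.coe_add])
    (fun c x y => by simp only [elem, TensorProduct.tmul_smul, UniformSpace.Completion.coe_smul]))
    1 fun x y => ((norm_elem x y).trans (by rw [one_mul])).le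

@[simp] theorem elemL_apply (x : E) (y : F) : elemL E F x y = elem x y := rfl

/-- A closed subspace containing the given tensors absorbs arbitrary vectors in one leg and then in
the other, hence the algebraic tensor product, which is dense. -/
theorem total_elem {a : ι → E} {b : κ → F} (ha : Total a) (hb : Total b) :
    Total fun p : ι × κ => elem (a p.1) (b p.2) := by
  set V := (Submodule.span ℂ (range fun p : ι × κ => elem (a p.1) (b p.2))).topologicalClosure
    with hV
  have hc : IsClosed (V : Set (HilbertTensor E F)) := Submodule.isClosed_topologicalClosure _
  have h1 : ∀ x y, elem x y ∈ V := by
    intro x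
    have h2 : ∀ j, elem x (b j) ∈ V := by
      intro j
      revert x
      refine ha.induction (fun i => ?_) ?_ (fun x y hx hy => ?_) (fun c x hx => ?_)
        fun x y hx hy => ?_
      · exact Submodule.le_topologicalClosure _ (Submodule.subset_span ⟨(i, j), rfl⟩)
      · rw [← elemL_apply]; simp
      · rw [← elemL_apply, map_add]; exact V.add_mem hx hy
      · rw [← elemL_apply, map_smul]; exact V.smul_mem c hx
      · exact hc.mem_of_tendsto ((((elemL E F).flip (b j)).continuous.tendsto y).comp hy)
          (Eventually.of_forall hx)
    refine hb.induction h2 ?_ (fun x y hx hy => ?_) (fun c x hx => ?_) fun y z hy hz => ?_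
    · rw [← elemL_apply, map_zero]; exact V.zero_mem
    · rw [← elemL_apply, map_add]; exact V.add_mem hx hy
    · rw [← elemL_apply, map_smul]; exact V.smul_mem c hx
    · exact hc.mem_of_tendsto (((elemL E F x).continuous.tendsto z).comp hz)
          (Eventually.of_forall hy)
  have h2 : ∀ t : E ⊗[ℂ] F, (t : HilbertTensor E F) ∈ V := by
    intro t
    induction t using TensorProduct.induction_on with
    | zero => rw [UniformSpace.Completion.coe_zero]; exact V.zero_mem
    | tmul x y => exact h1 x y
    | add x y hx hy => rw [UniformSpace.Completion.coe_add]; exact V.add_mem hx hy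
  intro z
  have h3 : z ∈ V := UniformSpace.Completion.induction_on z hc h2
  exact h3

end Total

/-! ### Exponential vectors -/

section ExpVec

variable {H : Type u} [NormedAddCommGroup H] [InnerProductSpace ℂ H]

instance instInnerFock : Inner ℂ (Fock H) := InnerProductSpace.toInner

theorem inner_power (v w : H) (n : ℕ) : ⟪power v n, power w n⟫_ℂ = ⟪v, w⟫_ℂ ^ n := by
  induction n with
  | zero =>
    refine (EuclideanSpace.inner_single_left (𝕜 := ℂ) PUnit.unit (1 : ℂ)
      (EuclideanSpace.single PUnit.unit 1)).trans ?_
    simp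
  | succ n ih => rw [pow_succ', ← ih]; exact inner_elem v w (power v n) (power w n)

theorem power_smul (c : ℂ) (v : H) (n : ℕ) : power (c • v) n = c ^ n • power v n := by
  induction n with
  | zero => rw [pow_zero, one_smul]; rfl
  | succ n ih =>
    have h : elem (c • v) (c ^ n • power v n) = (c * c ^ n) • elem v (power v n) := by
      rw [← elemL_apply, map_smul, map_smul, _root_.smul_apply, smul_smul, mul_comm]
      rfl
    rw [pow_succ']
    exact (congrArg (elem (c • v)) ih).trans h

theorem expVec_coe (v : H) (n : ℕ) :
    (expVec v : FullFock H) n = ((Real.sqrt n.factorial : ℂ)⁻¹) • power v n := rfl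

theorem inner_expVec (v w : H) : ⟪expVec v, expVec w⟫_ℂ = Complex.exp ⟪v, w⟫_ℂ := by
  have h1 : ⟪expVec v, expVec w⟫_ℂ = ⟪(expVec v : FullFock H), (expVec w : FullFock H)⟫_ℂ := rfl
  have h2 := lp.hasSum_inner (𝕜 := ℂ) (expVec v : FullFock H) (expVec w : FullFock H)
  rw [h1]
  refine h2.unique ?_
  have h3 := NormedSpace.expSeries_div_hasSum_exp (𝔸 := ℂ) ⟪v, w⟫_ℂ
  rw [← Complex.exp_eq_exp_ℂ] at h3
  refine h3.congr_fun fun n => ?_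
  rw [expVec_coe, expVec_coe, inner_smul_left, inner_smul_right, inner_power, map_inv₀,
    Complex.conj_ofReal, ← mul_assoc, ← mul_inv, ← Complex.ofReal_mul,
    Real.mul_self_sqrt (Nat.cast_nonneg _), Complex.ofReal_natCast, div_eq_inv_mul]

/-- The zero function has a unique power series. -/
theorem eq_zero_of_forall_hasSum_pow {c : ℕ → ℂ} (h : ∀ z : ℂ, HasSum (fun n => z ^ n * c n) 0)
    (n : ℕ) : c n = 0 := by
  have h1 : HasFPowerSeriesAt (fun _ : ℂ => (0 : ℂ)) (FormalMultilinearSeries.ofScalars ℂ c) 0 := by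
    rw [hasFPowerSeriesAt_iff]
    refine Eventually.of_forall fun z => ?_
    simpa [FormalMultilinearSeries.coeff_ofScalars] using h z
  have h2 := h1.eq_zero
  have h3 : (FormalMultilinearSeries.ofScalars ℂ c : FormalMultilinearSeries ℂ ℂ ℂ).coeff n = 0 := by
    rw [h2]; simp [FormalMultilinearSeries.coeff]
  simpa [FormalMultilinearSeries.coeff_ofScalars] using h3

/-- If `x` is orthogonal to all exponential vectors, then `⟪x, ε(z v)⟫` is a power series in `z`
that vanishes identically. Its coefficients are multiples of `⟪x_n, v ⊗ ⋯ ⊗ v⟫`, and the powers span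
the symmetric tensors. -/
theorem total_expVec : Total (expVec : H → Fock H) := by
  rw [Total, Submodule.dense_iff_topologicalClosure_eq_top,
    Submodule.topologicalClosure_eq_top_iff, Submodule.eq_bot_iff]
  intro x hx
  rw [Submodule.mem_orthogonal'] at hx
  have h1 : ∀ (v : H) (n : ℕ), ⟪(x : FullFock H) n, power v n⟫_ℂ = 0 := by
    intro v n
    have h2 : ∀ z : ℂ, HasSum (fun n => z ^ n *
        (((Real.sqrt n.factorial : ℂ)⁻¹) * ⟪(x : FullFock H) n, power v n⟫_ℂ)) 0 := by
      intro z
      have h3 := lp.hasSum_inner (𝕜 := ℂ) (x : FullFock H) (expVec (z • v) : FullFock H)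
      have h4 : ⟪(x : FullFock H), (expVec (z • v) : FullFock H)⟫_ℂ = 0 :=
        hx _ (Submodule.subset_span ⟨z • v, rfl⟩)
      rw [h4] at h3
      refine h3.congr_fun fun n => ?_
      rw [expVec_coe, power_smul, inner_smul_right, inner_smul_right]
      ring
    have h3 := eq_zero_of_forall_hasSum_pow h2 n
    refine (mul_eq_zero.1 h3).resolve_left (inv_ne_zero ?_)
    rw [Ne, Complex.ofReal_eq_zero, Real.sqrt_eq_zero (Nat.cast_nonneg _)]
    exact_mod_cast Nat.factorial_ne_zero n
  have h2 : ∀ n, (x : FullFock H) n = 0 := by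
    intro n
    have h3 : (x : FullFock H) n ∈ symPow H n := x.2 n
    have h4 : symPow H n ≤ ((Submodule.span ℂ {(x : FullFock H) n})ᗮ : Submodule ℂ _) := by
      refine Submodule.topologicalClosure_minimal _ ?_ (Submodule.isClosed_orthogonal _)
      rw [Submodule.span_le]
      rintro _ ⟨v, rfl⟩
      exact Submodule.mem_orthogonal_singleton_iff_inner_right.2 (h1 v n)
    exact inner_self_eq_zero.1 (Submodule.mem_orthogonal_singleton_iff_inner_right.1 (h4 h3))
  refine Subtype.ext (lp.ext (funext h2))

theorem norm_sq_of_inner_eq_exp {E F : Type*} [NormedAddCommGroup E] [InnerProductSpace ℂ E]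
    [NormedAddCommGroup F] [InnerProductSpace ℂ F] {x : E} {v : F}
    (h : ⟪x, x⟫_ℂ = Complex.exp ⟪v, v⟫_ℂ) : ‖x‖ ^ 2 = Real.exp (‖v‖ ^ 2) := by
  rw [inner_self_eq_norm_sq_to_K, inner_self_eq_norm_sq_to_K] at h
  have h' : ((‖x‖ ^ 2 : ℝ) : ℂ) = ((Real.exp (‖v‖ ^ 2) : ℝ) : ℂ) := by
    push_cast; exact h
  exact_mod_cast h'

theorem norm_expVec_sq (v : H) : ‖expVec v‖ ^ 2 = Real.exp (‖v‖ ^ 2) :=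
  norm_sq_of_inner_eq_exp (inner_expVec v v)

theorem norm_expVec_mono {v w : H} (h : ‖v‖ ≤ ‖w‖) : ‖expVec v‖ ≤ ‖expVec w‖ := by
  refine le_of_sq_le_sq ?_ (norm_nonneg _)
  rw [norm_expVec_sq, norm_expVec_sq]
  gcongr

theorem norm_expVec_zero : ‖(expVec (0 : H) : Fock H)‖ = 1 := by
  have h := norm_expVec_sq (0 : H)
  rw [norm_zero, zero_pow two_ne_zero, Real.exp_zero] at h
  exact (pow_eq_one_iff_of_nonneg (norm_nonneg _) two_ne_zero).1 h

theorem continuous_of_inner {X E : Type*} [TopologicalSpace X] [NormedAddCommGroup E]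
    [InnerProductSpace ℂ E] {a : X → E} (h : Continuous fun p : X × X => ⟪a p.1, a p.2⟫_ℂ) :
    Continuous a := by
  rw [continuous_iff_continuousAt]
  intro x
  rw [ContinuousAt, tendsto_iff_norm_sub_tendsto_zero]
  have h1 : ∀ y, ‖a y - a x‖ ^ 2 =
      (⟪a y, a y⟫_ℂ - ⟪a y, a x⟫_ℂ - ⟪a x, a y⟫_ℂ + ⟪a x, a x⟫_ℂ).re := by
    intro y
    rw [← @inner_self_eq_norm_sq ℂ, inner_sub_sub_self]; rfl
  have h2 : Continuous fun y => ‖a y - a x‖ ^ 2 := by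
    simp_rw [h1]
    have e1 : Continuous fun y => ⟪a y, a y⟫_ℂ := h.comp (by fun_prop : Continuous fun y => (y, y))
    have e2 : Continuous fun y => ⟪a y, a x⟫_ℂ := h.comp (by fun_prop : Continuous fun y => (y, x))
    have e3 : Continuous fun y => ⟪a x, a y⟫_ℂ := h.comp (by fun_prop : Continuous fun y => (x, y))
    fun_prop
  have h3 := (h2.sqrt).tendsto x
  simpa using h3

theorem continuous_expVec : Continuous (expVec : H → Fock H) := by
  refine continuous_of_inner ?_
  simp_rw [inner_expVec]
  fun_prop

/-- Preserving inner products preserves the Gram matrix `exp ⟪v, w⟫`, so the operator required by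
the definition exists. -/
theorem secondQuant_expVec {A : H → H} (hA : ∀ v w, ⟪A v, A w⟫_ℂ = ⟪v, w⟫_ℂ) (v : H) :
    secondQuant A (expVec v) = expVec (A v) := by
  obtain ⟨U, hU⟩ := exists_isometry_of_gram (F := Fock H) total_expVec
    (b := fun v => expVec (A v)) fun v w => by rw [inner_expVec, inner_expVec, hA]
  have h : ∃ B : Fock H →L[ℂ] Fock H, ∀ v, B (expVec v) = expVec (A v) :=
    ⟨U.toContinuousLinearMap, hU⟩
  rw [secondQuant, dif_pos h]
  exact h.choose_spec v

end ExpVec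

/-! ### Shifts and restrictions on `L²(ℝ₊; k)` -/

section Shifts

variable {k : Type u} [NormedAddCommGroup k] [InnerProductSpace ℂ k]

theorem measurePreserving_add_Ici (t : ℝ≥0) :
    MeasurePreserving (fun s : ℝ => s + t) ((volume : Measure ℝ).restrict (Ici 0))
      ((volume : Measure ℝ).restrict (Ici (t : ℝ))) := by
  have h := (measurePreserving_add_right (volume : Measure ℝ) (t : ℝ)).restrict_preimage
    (measurableSet_Ici (a := (t : ℝ)))
  have h' : (fun s : ℝ => s + t) ⁻¹' Ici (t : ℝ) = Ici (0 : ℝ) := by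
    ext s; simp
  rwa [h'] at h

theorem ae_restrict_Ici_of_ae (t : ℝ≥0) {p : ℝ → Prop}
    (h : ∀ᵐ x ∂(volume : Measure ℝ).restrict (Ici 0), p x) :
    ∀ᵐ x ∂(volume : Measure ℝ).restrict (Ici (t : ℝ)), p x :=
  ae_mono (Measure.restrict_mono (Ici_subset_Ici.2 t.2) le_rfl) h

theorem setIntegral_Ici_eq (t : ℝ≥0) (φ : ℝ → ℂ) :
    ∫ x in Ici (t : ℝ), φ x = ∫ x in Ici (0 : ℝ), φ (x + t) := by
  rw [(measurePreserving_add_Ici t).integral_comp (measurableEmbedding_addRight _)]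

theorem coeFn_shift (t : ℝ≥0) (f : L2Half k) :
    shift t f =ᵐ[(volume : Measure ℝ).restrict (Ici 0)]
      (Ici (t : ℝ)).indicator fun s => f (s - t) := MemLp.coeFn_toLp _

theorem coeFn_shiftAdj (t : ℝ≥0) (f : L2Half k) :
    shiftAdj t f =ᵐ[(volume : Measure ℝ).restrict (Ici 0)] fun s => f (s + t) :=
  MemLp.coeFn_toLp _

theorem coeFn_restr {A : Set ℝ} (hA : A ⊆ Ici 0) (f : L2Half k) :
    restr hA f =ᵐ[(volume : Measure ℝ).restrict A] f := MemLp.coeFn_toLp _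

theorem inner_L2 {A : Set ℝ} (f g : L2 k A) : ⟪f, g⟫_ℂ = ∫ x in A, ⟪f x, g x⟫_ℂ := rfl

theorem inner_restr {A : Set ℝ} (hA : A ⊆ Ici 0) (f g : L2Half k) :
    ⟪restr hA f, restr hA g⟫_ℂ = ∫ x in A, ⟪f x, g x⟫_ℂ := by
  rw [inner_L2]
  refine integral_congr_ae ?_
  filter_upwards [coeFn_restr hA f, coeFn_restr hA g] with x h1 h2
  rw [h1, h2]

theorem inner_shiftAdj_shiftAdj (t : ℝ≥0) (f g : L2Half k) :
    ⟪shiftAdj t f, shiftAdj t g⟫_ℂ = ∫ x in Ici (t : ℝ), ⟪f x, g x⟫_ℂ := by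
  rw [inner_L2, setIntegral_Ici_eq]
  refine integral_congr_ae ?_
  filter_upwards [coeFn_shiftAdj t f, coeFn_shiftAdj t g] with x h1 h2
  rw [h1, h2]

theorem inner_shift_left (t : ℝ≥0) (f g : L2Half k) :
    ⟪shift t f, g⟫_ℂ = ⟪f, shiftAdj t g⟫_ℂ := by
  rw [inner_L2, inner_L2]
  have h1 : ∫ x in Ici (0 : ℝ), ⟪shift t f x, g x⟫_ℂ =
      ∫ x in Ici (0 : ℝ), (Ici (t : ℝ)).indicator (fun x => ⟪f (x - t), g x⟫_ℂ) x := by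
    refine integral_congr_ae ?_
    filter_upwards [coeFn_shift t f] with x h1
    rw [h1]
    by_cases hx : x ∈ Ici (t : ℝ)
    · simp [indicator_of_mem hx]
    · simp [indicator_of_notMem hx]
  rw [h1, setIntegral_indicator measurableSet_Ici, inter_eq_right.2 (Ici_subset_Ici.2 (NNReal.coe_nonneg t)),
    setIntegral_Ici_eq]
  refine integral_congr_ae ?_
  filter_upwards [coeFn_shiftAdj t g] with x h1
  rw [h1, add_sub_cancel_right]

theorem shiftAdj_shift (t : ℝ≥0) (f : L2Half k) : shiftAdj t (shift t f) = f := by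
  refine Lp.ext ?_
  have h := (measurePreserving_add_Ici t).quasiMeasurePreserving.ae
    (ae_restrict_Ici_of_ae t (coeFn_shift t f))
  filter_upwards [coeFn_shiftAdj t (shift t f), h, ae_restrict_mem measurableSet_Ici]
    with x h1 h2 h3
  rw [h1, h2, indicator_of_mem, add_sub_cancel_right]
  simpa using h3

theorem shiftAdj_shiftAdj (s t : ℝ≥0) (f : L2Half k) :
    shiftAdj s (shiftAdj t f) = shiftAdj (s + t) f := by
  refine Lp.ext ?_
  have h := (measurePreserving_add_Ici s).quasiMeasurePreserving.ae
    (ae_restrict_Ici_of_ae s (coeFn_shiftAdj t f))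
  filter_upwards [coeFn_shiftAdj s (shiftAdj t f), h, coeFn_shiftAdj (s + t) f] with x h1 h2 h3
  rw [h1, h2, h3, NNReal.coe_add, add_assoc]

variable (k) in
/-- The right shift as a linear isometry. -/
def shiftL (t : ℝ≥0) : L2Half k →ₗᵢ[ℂ] L2Half k :=
  LinearMap.isometryOfInner
    { toFun := shift t
      -- Linearity is read off from the adjoint relation, which avoids almost-everywhere
      -- representatives.
      map_add' := fun f g => ext_inner_right ℂ fun h => by
        rw [inner_add_left, inner_shift_left, inner_shift_left, inner_shift_left, inner_add_left]
      map_smul' := fun c f => ext_inner_right ℂ fun h => by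
        rw [RingHom.id_apply, inner_smul_left, inner_shift_left, inner_shift_left,
          inner_smul_left] }
    fun f g => (inner_shift_left t f _).trans (by
      rw [LinearMap.coe_mk, AddHom.coe_mk, shiftAdj_shift])

theorem shiftL_apply (t : ℝ≥0) (f : L2Half k) : shiftL k t f = shift t f := rfl

theorem inner_shiftAdj_self (t : ℝ≥0) (f : L2Half k) :
    ⟪shift t (shiftAdj t f), f⟫_ℂ = ⟪shiftAdj t f, shiftAdj t f⟫_ℂ := inner_shift_left _ _ _

variable (k) in
/-- The left shift as a bounded operator. -/
def shiftAdjL (t : ℝ≥0) : L2Half k →L[ℂ] L2Half k :=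
  LinearMap.mkContinuous
    { toFun := shiftAdj t
      map_add' := fun f g => ext_inner_left ℂ fun h => by
        rw [inner_add_right, ← inner_shift_left, ← inner_shift_left, ← inner_shift_left,
          inner_add_right]
      map_smul' := fun c f => ext_inner_left ℂ fun h => by
        rw [RingHom.id_apply, inner_smul_right, ← inner_shift_left, ← inner_shift_left,
          inner_smul_right] } 1 fun f => by
    rw [one_mul, LinearMap.coe_mk, AddHom.coe_mk]
    -- The square of the norm is `⟪θ_t θ_t^* f, f⟫`, and `θ_t` is isometric.
    have h1 : ‖shiftAdj t f‖ * ‖shiftAdj t f‖ ≤ ‖shiftAdj t f‖ * ‖f‖ := by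
      rw [← @inner_self_eq_norm_mul_norm ℂ, ← inner_shiftAdj_self]
      refine (re_inner_le_norm _ _).trans ?_
      rw [← shiftL_apply, LinearIsometry.norm_map]
    by_contra h
    push Not at h
    nlinarith [norm_nonneg f, norm_nonneg (shiftAdj t f)]

theorem shiftAdjL_apply (t : ℝ≥0) (f : L2Half k) : shiftAdjL k t f = shiftAdj t f := rfl

theorem memLp_extend (f : L2Half k) :
    MemLp ((Ici (0 : ℝ)).indicator f) 2 (volume : Measure ℝ) :=
  (memLp_indicator_iff_restrict measurableSet_Ici).2 (Lp.memLp f)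

/-- Extended by zero to the whole line, `f` is moved by measure-preserving translations, which act
continuously on `L²`; restriction to the half-line is bounded. -/
theorem continuous_shiftAdj (f : L2Half k) : Continuous fun t : ℝ≥0 => shiftAdj t f := by
  have hm : ∀ t : ℝ≥0, MeasurePreserving
      ((⟨fun x : ℝ => x + t, by fun_prop⟩ : C(ℝ, ℝ))) volume volume := fun t =>
    measurePreserving_add_right volume (t : ℝ)
  have h1 : Continuous fun t : ℝ≥0 => Lp.compMeasurePreserving
      (⟨fun x : ℝ => x + t, by fun_prop⟩ : C(ℝ, ℝ)) (hm t) ((memLp_extend f).toLp _) := by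
    refine Continuous.compMeasurePreservingLp continuous_const ?_ hm (by simp)
    exact ContinuousMap.continuous_of_continuous_uncurry _ (by
      simp only [Function.uncurry_def, ContinuousMap.coe_mk]; fun_prop)
  have h2 := (LpToLpRestrictCLM ℝ k ℂ volume 2 (Ici 0)).continuous.comp h1
  refine h2.congr fun t => Lp.ext ?_
  have h3 := (LpToLpRestrictCLM_coeFn ℂ (Ici 0) (Lp.compMeasurePreserving
      (⟨fun x : ℝ => x + t, by fun_prop⟩ : C(ℝ, ℝ)) (hm t) ((memLp_extend f).toLp _)))
  have h4 := ae_restrict_of_ae (s := Ici (0 : ℝ))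
    (Lp.coeFn_compMeasurePreserving ((memLp_extend f).toLp _) (hm t))
  have h5 := ae_restrict_of_ae (s := Ici (0 : ℝ))
    ((hm t).quasiMeasurePreserving.ae (memLp_extend f).coeFn_toLp)
  filter_upwards [h3, h4, h5, coeFn_shiftAdj t f, ae_restrict_mem measurableSet_Ici]
    with x h3 h4 h5 h6 h7
  rw [Function.comp_apply, h3, h4, h6, Function.comp_apply, h5]
  rw [ContinuousMap.coe_mk, indicator_of_mem]
  exact add_nonneg h7 t.2

/-! ### Shifts by extended times -/

/-- The left shift by an extended time; it vanishes at `∞`. -/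
def sh (s : ℝ≥0∞) : L2Half k →L[ℂ] L2Half k := if s = ⊤ then 0 else shiftAdjL k s.toNNReal

/-- The right shift by an extended time; it vanishes at `∞`. -/
def fw (s : ℝ≥0∞) : L2Half k →L[ℂ] L2Half k :=
  if s = ⊤ then 0 else (shiftL k s.toNNReal).toContinuousLinearMap

theorem sh_top (f : L2Half k) : sh ⊤ f = 0 := by simp [sh]

theorem fw_top (f : L2Half k) : fw ⊤ f = 0 := by simp [fw]

theorem sh_coe (s : ℝ≥0) (f : L2Half k) : sh s f = shiftAdj s f := by
  simp [sh, shiftAdjL_apply]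

theorem fw_coe (s : ℝ≥0) (f : L2Half k) : fw s f = shift s f := by
  simp [fw, shiftL_apply]

/-- Setting both shifts to zero at `∞` keeps this relation and the semigroup laws valid on all of
`[0, ∞]`; what is lost there is that `sh s` inverts `fw s`. -/
theorem inner_fw_left (s : ℝ≥0∞) (f g : L2Half k) : ⟪fw s f, g⟫_ℂ = ⟪f, sh s g⟫_ℂ := by
  induction s with
  | top => simp [sh_top, fw_top]
  | coe s => rw [sh_coe, fw_coe, inner_shift_left]

theorem inner_fw_right (s : ℝ≥0∞) (f g : L2Half k) : ⟪f, fw s g⟫_ℂ = ⟪sh s f, g⟫_ℂ := by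
  rw [← inner_conj_symm, inner_fw_left, inner_conj_symm]

theorem sh_fw {s : ℝ≥0∞} (hs : s ≠ ⊤) (f : L2Half k) : sh s (fw s f) = f := by
  lift s to ℝ≥0 using hs
  rw [sh_coe, fw_coe, shiftAdj_shift]

theorem sh_sh (s t : ℝ≥0∞) (f : L2Half k) : sh s (sh t f) = sh (s + t) f := by
  induction s with
  | top => simp [sh_top]
  | coe s =>
    induction t with
    | top => simp [sh_top]
    | coe t => rw [sh_coe, sh_coe, shiftAdj_shiftAdj, ← ENNReal.coe_add, sh_coe]

theorem fw_fw (s t : ℝ≥0∞) (f : L2Half k) : fw s (fw t f) = fw (s + t) f :=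
  ext_inner_right ℂ fun g => by
    rw [inner_fw_left, inner_fw_left, inner_fw_left, sh_sh, add_comm]

theorem norm_sh_le (s : ℝ≥0∞) (f : L2Half k) : ‖sh s f‖ ≤ ‖f‖ := by
  induction s with
  | top => simp [sh_top]
  | coe s =>
    rw [sh_coe, ← shiftAdjL_apply]
    simpa using (shiftAdjL k s).le_of_opNorm_le (LinearMap.mkContinuous_norm_le _ zero_le_one _) f

theorem stronglyMeasurable_sh (f : L2Half k) : StronglyMeasurable fun s => sh s f := by
  have h : (fun s => sh s f) = fun s => if s ∈ ({⊤} : Set ℝ≥0∞) then 0 else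
      shiftAdj s.toNNReal f := by
    funext s
    by_cases h : s = ⊤
    · simp [h, sh_top]
    · rw [if_neg (by simpa using h), sh, if_neg h, shiftAdjL_apply]
  rw [h]
  exact StronglyMeasurable.ite (measurableSet_singleton _) stronglyMeasurable_const
    ((continuous_shiftAdj f).stronglyMeasurable.comp_measurable ENNReal.measurable_toNNReal)

/-! ### Cutting and concatenation -/

/-- `f` on `[0, s)` followed by zero. -/
def cut (s : ℝ≥0∞) (f : L2Half k) : L2Half k := f - fw s (sh s f)

/-- `f` on `[0, s)` followed by `h`. -/
def cat (f : L2Half k) (s : ℝ≥0∞) (h : L2Half k) : L2Half k := cut s f + fw s h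

theorem cut_top (f : L2Half k) : cut ⊤ f = f := by simp [cut, fw_top]

theorem cat_top (f h : L2Half k) : cat f ⊤ h = f := by simp [cat, fw_top, cut_top]

theorem cat_zero (f : L2Half k) (s : ℝ≥0∞) : cat f s 0 = cut s f := by simp [cat]

theorem sh_cut (s : ℝ≥0∞) (f : L2Half k) : sh s (cut s f) = 0 := by
  by_cases hs : s = ⊤
  · rw [hs, sh_top]
  · rw [cut, map_sub, sh_fw hs, sub_self]

theorem cut_cut (s : ℝ≥0∞) (f : L2Half k) : cut s (cut s f) = cut s f := by
  rw [cut, sh_cut, map_zero, sub_zero]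

theorem sh_cat {s : ℝ≥0∞} (hs : s ≠ ⊤) (f h : L2Half k) : sh s (cat f s h) = h := by
  rw [cat, map_add, sh_cut, sh_fw hs, zero_add]

theorem cut_cat (s : ℝ≥0∞) (f h : L2Half k) : cut s (cat f s h) = cut s f := by
  by_cases hs : s = ⊤
  · rw [hs, cat_top]
  · rw [cut, sh_cat hs, cat, add_sub_cancel_right]

/-- The map `f ↦ fw s (sh s f)` projects onto the functions living after `s`, and `cut s f` is the
orthogonal remainder since `sh s` kills it. -/
theorem inner_eq_cut_add_sh (s : ℝ≥0∞) (f g : L2Half k) :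
    ⟪f, g⟫_ℂ = ⟪cut s f, cut s g⟫_ℂ + ⟪sh s f, sh s g⟫_ℂ := by
  have h : ⟪cut s f, cut s g⟫_ℂ = ⟪f, cut s g⟫_ℂ := by
    rw [cut, inner_sub_left, inner_fw_left, sh_cut, inner_zero_right, sub_zero]
  rw [h, cut, inner_sub_right, inner_fw_right, sub_add_cancel]

theorem norm_cut_le (s : ℝ≥0∞) (f : L2Half k) : ‖cut s f‖ ≤ ‖f‖ := by
  have h := congrArg Complex.re (inner_eq_cut_add_sh s f f)
  rw [Complex.add_re] at h
  have e : ∀ f : L2Half k, (⟪f, f⟫_ℂ).re = ‖f‖ ^ 2 := fun f => inner_self_eq_norm_sq (𝕜 := ℂ) f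
  rw [e, e, e] at h
  refine le_of_sq_le_sq ?_ (norm_nonneg _)
  nlinarith [sq_nonneg ‖sh s f‖]

theorem sh_cat_of_le {s p : ℝ≥0∞} (hs : s ≠ ⊤) (hsp : s ≤ p) (f h : L2Half k) :
    sh s (cat f p h) = cat (sh s f) (p - s) h := by
  by_cases hp : p = ⊤
  · rw [hp, ENNReal.top_sub hs, cat_top, cat_top]
  · rw [cat, cut, cat, cut, map_add, map_sub]
    have e : p = s + (p - s) := (add_tsub_cancel_of_le hsp).symm
    have h1 : ∀ g : L2Half k, fw p g = fw s (fw (p - s) g) := fun g => by rw [fw_fw, ← e]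
    rw [h1, h1, sh_fw hs, sh_fw hs, sh_sh, tsub_add_cancel_of_le hsp]

theorem sh_cut_of_le {s p : ℝ≥0∞} (hs : s ≠ ⊤) (hsp : s ≤ p) (f : L2Half k) :
    sh s (cut p f) = cut (p - s) (sh s f) := by
  rw [← cat_zero, sh_cat_of_le hs hsp, cat_zero]

theorem cut_eq_of_le {s p : ℝ≥0∞} (hsp : s ≤ p) {f g : L2Half k} (h : cut p f = cut p g) :
    cut s f = cut s g := by
  by_cases hs : s = ⊤
  · have : p = ⊤ := top_le_iff.1 (hs ▸ hsp)
    rwa [hs, ← this]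
  have key : ∀ f : L2Half k, cut s (cut p f) = cut s f := by
    intro f
    by_cases hp : p = ⊤
    · rw [hp, cut_top]
    have e : p = s + (p - s) := (add_tsub_cancel_of_le hsp).symm
    have h1 : ∀ g : L2Half k, fw p g = fw s (fw (p - s) g) := fun g => by rw [fw_fw, ← e]
    rw [cut, cut, cut, map_sub, h1, sh_fw hs, map_sub]
    abel
  rw [← key f, h, key g]

/-- Both sides are `⟪f, g⟫` minus the integral over `[t, ∞)`. Matching inner products is what ties
restrictions, which live in other `L²` spaces, to cuts and shifts on the half-line. -/
theorem inner_before (t : ℝ≥0) (f g : L2Half k) :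
    ⟪before t f, before t g⟫_ℂ = ⟪cut t f, cut t g⟫_ℂ := by
  have h := inner_eq_cut_add_sh (t : ℝ≥0∞) f g
  rw [sh_coe, sh_coe, inner_shiftAdj_shiftAdj] at h
  rw [before, before, inner_restr, ← add_left_inj (∫ x in Ici (t : ℝ), ⟪f x, g x⟫_ℂ), ← h,
    inner_L2, ← setIntegral_union _ measurableSet_Ici, Ico_union_Ici_eq_Ici (NNReal.coe_nonneg t)]
  · exact (L2.integrable_inner (𝕜 := ℂ) f g).mono_measure
      (Measure.restrict_mono Ico_subset_Ici_self le_rfl)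
  · exact (L2.integrable_inner (𝕜 := ℂ) f g).mono_measure
      (Measure.restrict_mono (Ici_subset_Ici.2 t.2) le_rfl)
  · exact (Iio_disjoint_Ici le_rfl).mono_left Ico_subset_Iio_self

theorem inner_after (t : ℝ≥0) (f g : L2Half k) :
    ⟪after t f, after t g⟫_ℂ = ⟪sh t f, sh t g⟫_ℂ := by
  rw [after, after, inner_restr, sh_coe, sh_coe, inner_shiftAdj_shiftAdj]

theorem eq_of_inner_eq {E : Type*} [NormedAddCommGroup E] [InnerProductSpace ℂ E] {x y : E}
    (h1 : ⟪x, y⟫_ℂ = ⟪x, x⟫_ℂ) (h2 : ⟪y, x⟫_ℂ = ⟪x, x⟫_ℂ) (h3 : ⟪y, y⟫_ℂ = ⟪x, x⟫_ℂ) : x = y := by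
  rw [← sub_eq_zero, ← inner_self_eq_zero (𝕜 := ℂ), inner_sub_sub_self, h1, h2, h3]
  ring

theorem before_eq {t : ℝ≥0} {f g : L2Half k} (h : cut t f = cut t g) :
    before t f = before t g := by
  apply eq_of_inner_eq <;> simp only [inner_before, h]

theorem after_eq {t : ℝ≥0} {f g : L2Half k} (h : sh t f = sh t g) : after t f = after t g := by
  apply eq_of_inner_eq <;> simp only [inner_after, h]

theorem before_zero (t : ℝ≥0) : before t (0 : L2Half k) = 0 := by
  rw [← inner_self_eq_zero (𝕜 := ℂ), inner_before]; simp [cut]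

theorem after_zero (t : ℝ≥0) : after t (0 : L2Half k) = 0 := by
  rw [← inner_self_eq_zero (𝕜 := ℂ), inner_after]; simp

theorem exists_before_after (t : ℝ≥0) (a : L2 k (Ico 0 (t : ℝ))) (b : L2 k (Ici (t : ℝ))) :
    ∃ f : L2Half k, before t f = a ∧ after t f = b := by
  have ha : MemLp ((Ico 0 (t : ℝ)).indicator a) 2 (volume : Measure ℝ) :=
    (memLp_indicator_iff_restrict measurableSet_Ico).2 (Lp.memLp a)
  have hb : MemLp ((Ici (t : ℝ)).indicator b) 2 (volume : Measure ℝ) :=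
    (memLp_indicator_iff_restrict measurableSet_Ici).2 (Lp.memLp b)
  have hf := (ha.add hb).restrict (Ici 0)
  refine ⟨hf.toLp _, Lp.ext ?_, Lp.ext ?_⟩
  · filter_upwards [coeFn_restr Ico_subset_Ici_self (hf.toLp _), ae_restrict_mem measurableSet_Ico,
      ae_mono (Measure.restrict_mono Ico_subset_Ici_self le_rfl) hf.coeFn_toLp] with x h1 h2 h3
    rw [before, h1, h3, Pi.add_apply, indicator_of_mem h2, indicator_of_notMem, add_zero]
    simpa using h2.2
  · filter_upwards [coeFn_restr (Ici_subset_Ici.2 t.2) (hf.toLp _),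
      ae_restrict_mem measurableSet_Ici, ae_restrict_Ici_of_ae t hf.coeFn_toLp] with x h1 h2 h3
    refine h1.trans ?_
    rw [h3, Pi.add_apply, indicator_of_mem h2, indicator_of_notMem, zero_add]
    intro h
    exact absurd h.2 (not_lt.2 h2)

/-- This rewrites the exponent in the density of `stopMeasure` by shifts. -/
theorem tail_integral (s : ℝ≥0∞) (f g : L2Half k) :
    ∫ r in {r : ℝ | 0 ≤ r ∧ s ≤ ENNReal.ofReal r}, ⟪f r, g r⟫_ℂ = ⟪sh s f, sh s g⟫_ℂ := by
  induction s with
  | top => simp [sh_top]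
  | coe s =>
    rw [sh_coe, sh_coe, inner_shiftAdj_shiftAdj]
    congr 2
    ext r
    simp only [mem_ofPred_eq, mem_Ici]
    constructor
    · rintro ⟨h1, h2⟩
      rwa [← ENNReal.ofReal_coe_nnreal, ENNReal.ofReal_le_ofReal_iff h1] at h2
    · intro h
      refine ⟨s.2.trans h, ?_⟩
      rw [← ENNReal.ofReal_coe_nnreal]
      exact ENNReal.ofReal_le_ofReal h

theorem shiftAdj_zero (f : L2Half k) : shiftAdj 0 f = f := by
  refine Lp.ext ?_
  filter_upwards [coeFn_shiftAdj 0 f] with x h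
  rw [h, NNReal.coe_zero, add_zero]

/-- Weak convergence with constant norm is norm convergence. -/
theorem tendsto_of_inner {E ι : Type*} [NormedAddCommGroup E] [InnerProductSpace ℂ E]
    {l : Filter ι} {x : ι → E} {y : E} (h1 : Tendsto (fun i => ⟪x i, y⟫_ℂ) l (𝓝 ⟪y, y⟫_ℂ))
    (h2 : ∀ᶠ i in l, ⟪x i, x i⟫_ℂ = ⟪y, y⟫_ℂ) : Tendsto x l (𝓝 y) := by
  rw [tendsto_iff_norm_sub_tendsto_zero]
  have h3 : Tendsto (fun i => (⟪y, y⟫_ℂ - ⟪x i, y⟫_ℂ - starRingEnd ℂ ⟪x i, y⟫_ℂ + ⟪y, y⟫_ℂ).re) l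
      (𝓝 (⟪y, y⟫_ℂ - ⟪y, y⟫_ℂ - starRingEnd ℂ ⟪y, y⟫_ℂ + ⟪y, y⟫_ℂ).re) :=
    Complex.continuous_re.continuousAt.tendsto.comp
      (((tendsto_const_nhds.sub h1).sub (Complex.continuous_conj.continuousAt.tendsto.comp h1)).add
        tendsto_const_nhds)
  rw [inner_conj_symm, sub_self, zero_sub, neg_add_cancel, Complex.zero_re] at h3
  have h4 := h3.sqrt
  rw [Real.sqrt_zero] at h4
  refine h4.congr' ?_
  filter_upwards [h2] with i hi
  rw [inner_conj_symm, ← hi]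
  rw [@norm_eq_sqrt_re_inner ℂ, inner_sub_sub_self]
  simp only [hi]
  rfl

theorem tendsto_sh_nhds_zero (f : L2Half k) {ι : Type*} {l : Filter ι} {δ : ι → ℝ≥0∞}
    (hδ : Tendsto δ l (𝓝 0)) : Tendsto (fun i => sh (δ i) f) l (𝓝 f) := by
  have h2 : Tendsto (fun i => shiftAdj (δ i).toNNReal f) l (𝓝 f) := by
    have h3 := ((continuous_shiftAdj f).tendsto 0).comp
      ((ENNReal.tendsto_toNNReal ENNReal.zero_ne_top).comp hδ)
    rwa [shiftAdj_zero] at h3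
  refine h2.congr' ?_
  filter_upwards [hδ.eventually_ne ENNReal.zero_ne_top] with i hi
  rw [sh, if_neg hi, shiftAdjL_apply]

theorem tendsto_fw_nhds_zero (f : L2Half k) {ι : Type*} {l : Filter ι} {δ : ι → ℝ≥0∞}
    (hδ : Tendsto δ l (𝓝 0)) : Tendsto (fun i => fw (δ i) f) l (𝓝 f) := by
  refine tendsto_of_inner ?_ ?_
  · simp_rw [inner_fw_left]
    exact tendsto_const_nhds.inner (tendsto_sh_nhds_zero f hδ)
  · filter_upwards [hδ.eventually_ne ENNReal.zero_ne_top] with i hi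
    rw [inner_fw_left, sh_fw hi]

/-- By Pythagoras the piece of `f` on `[0, δ)` has squared norm `‖f‖² - ‖sh δ f‖²`, which tends to
zero, while `fw δ h → h`. -/
theorem tendsto_cat_nhds_zero (f h : L2Half k) {ι : Type*} {l : Filter ι} {δ : ι → ℝ≥0∞}
    (hδ : Tendsto δ l (𝓝 0)) : Tendsto (fun i => cat f (δ i) h) l (𝓝 h) := by
  have h1 : Tendsto (fun i => cut (δ i) f) l (𝓝 0) := by
    rw [tendsto_zero_iff_norm_tendsto_zero]
    have h2 : Tendsto (fun i => Real.sqrt (‖f‖ ^ 2 - ‖sh (δ i) f‖ ^ 2)) l (𝓝 0) := by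
      have := (tendsto_const_nhds (x := ‖f‖ ^ 2)).sub ((tendsto_sh_nhds_zero f hδ).norm.pow 2)
      rw [sub_self] at this
      simpa using this.sqrt
    refine h2.congr fun i => ?_
    have h := congrArg Complex.re (inner_eq_cut_add_sh (δ i) f f)
    rw [Complex.add_re] at h
    have e : ∀ f : L2Half k, (⟪f, f⟫_ℂ).re = ‖f‖ ^ 2 := fun f => inner_self_eq_norm_sq (𝕜 := ℂ) f
    rw [e, e, e] at h
    rw [h, add_sub_cancel_right, Real.sqrt_sq (norm_nonneg _)]
  simpa [cat] using h1.add (tendsto_fw_nhds_zero h hδ)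

end Shifts

/-! ### Second quantised shifts and the tensor decomposition -/

section Split

/-- An `ε/3` argument: a uniform bound on the operators carries convergence from a total family to
every vector. -/
theorem Total.tendsto {ι κ E F : Type*} [NormedAddCommGroup E] [InnerProductSpace ℂ E]
    [NormedAddCommGroup F] [InnerProductSpace ℂ F] {a : ι → E} (ha : Total a) {l : Filter κ}
    {K : κ → E →L[ℂ] F} {L : E →L[ℂ] F} {C : ℝ} (hK : ∀ i y, ‖K i y‖ ≤ C * ‖y‖)
    (h : ∀ j, Tendsto (fun i => K i (a j)) l (𝓝 (L (a j)))) (y : E) :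
    Tendsto (fun i => K i y) l (𝓝 (L y)) := by
  refine ha.induction (P := fun y => Tendsto (fun i => K i y) l (𝓝 (L y))) h
    (by simpa using tendsto_const_nhds)
    (fun x y hx hy => ?_) (fun c x hx => ?_) (fun x y hx hy => ?_) y
  · simpa using hx.add hy
  · simpa using hx.const_smul c
  · rw [Metric.tendsto_nhds]
    intro ε hε
    have h1 : Tendsto (fun n => C * ‖x n - y‖) atTop (𝓝 0) := by
      simpa using (tendsto_iff_norm_sub_tendsto_zero.1 hy).const_mul C
    have h2 : Tendsto (fun n => ‖L (x n) - L y‖) atTop (𝓝 0) :=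
      tendsto_iff_norm_sub_tendsto_zero.1 ((L.continuous.tendsto y).comp hy)
    obtain ⟨n, hn1, hn2⟩ := ((h1.eventually_lt_const (by positivity : 0 < ε / 3)).and
      (h2.eventually_lt_const (by positivity : 0 < ε / 3))).exists
    filter_upwards [Metric.tendsto_nhds.1 (hx n) (ε / 3) (by positivity)] with i hi
    rw [dist_eq_norm] at hi ⊢
    have e : K i y - L y = (K i (x n) - L (x n)) - K i (x n - y) + (L (x n) - L y) := by
      rw [map_sub]; abel
    rw [e]
    have h4 := norm_add_le ((K i (x n) - L (x n)) - K i (x n - y)) (L (x n) - L y)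
    have h5 := norm_sub_le (K i (x n) - L (x n)) (K i (x n - y))
    have h6 := hK i (x n - y)
    linarith

variable {k : Type u} [NormedAddCommGroup k] [InnerProductSpace ℂ k]

theorem Gam_expVec (s : ℝ≥0) (f : L2Half k) : Gam k s (expVec f) = expVec (shift s f) :=
  secondQuant_expVec (fun f g => by rw [inner_shift_left, shiftAdj_shift]) f

theorem inner_Gam (s : ℝ≥0) (x y : FockHalf k) : ⟪Gam k s x, Gam k s y⟫_ℂ = ⟪x, y⟫_ℂ := by
  refine inner_eq_of_total (L := ContinuousLinearMap.id ℂ _) total_expVec (fun f g => ?_) x y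
  rw [Gam_expVec, Gam_expVec, inner_expVec, inner_shift_left, shiftAdj_shift, ← inner_expVec]
  rfl

theorem adjoint_Gam_Gam (s : ℝ≥0) (x : FockHalf k) :
    ContinuousLinearMap.adjoint (Gam k s) (Gam k s x) = x :=
  ext_inner_left ℂ fun y => by rw [ContinuousLinearMap.adjoint_inner_right, inner_Gam]

theorem adjoint_Gam_expVec (s : ℝ≥0) (f : L2Half k) :
    ContinuousLinearMap.adjoint (Gam k s) (expVec f) = expVec (shiftAdj s f) :=
  eq_of_total_inner total_expVec fun g => by
    rw [ContinuousLinearMap.adjoint_inner_right, Gam_expVec, inner_expVec, inner_expVec,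
      inner_shift_left]

theorem norm_Gam (s : ℝ≥0) (x : FockHalf k) : ‖Gam k s x‖ = ‖x‖ := by
  rw [@norm_eq_sqrt_re_inner ℂ, @norm_eq_sqrt_re_inner ℂ, inner_Gam]

theorem norm_adjoint_Gam_le (s : ℝ≥0) (x : FockHalf k) :
    ‖ContinuousLinearMap.adjoint (Gam k s) x‖ ≤ ‖x‖ := by
  refine (ContinuousLinearMap.le_opNorm _ x).trans ?_
  rw [LinearIsometryEquiv.norm_map]
  have : ‖Gam k s‖ ≤ 1 := ContinuousLinearMap.opNorm_le_bound _ zero_le_one fun x => by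
    rw [norm_Gam, one_mul]
  nlinarith [norm_nonneg x]

theorem continuous_adjoint_Gam (y : FockHalf k) :
    Continuous fun s => ContinuousLinearMap.adjoint (Gam k s) y := by
  rw [continuous_iff_continuousAt]
  intro s
  refine total_expVec.tendsto (C := 1) (fun i y => ?_) (fun f => ?_) y
  · rw [one_mul]; exact norm_adjoint_Gam_le _ _
  · simp_rw [adjoint_Gam_expVec]
    exact ((continuous_expVec.comp (continuous_shiftAdj f)).tendsto s)

theorem continuous_Gam (y : FockHalf k) : Continuous fun s => Gam k s y := by
  rw [continuous_iff_continuousAt]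
  intro s
  refine tendsto_of_inner ?_ (Eventually.of_forall fun t => ?_)
  · simp_rw [← ContinuousLinearMap.adjoint_inner_right]
    exact tendsto_const_nhds.inner ((continuous_adjoint_Gam _).tendsto s)
  · rw [inner_Gam, inner_Gam]

theorem total_before_after (t : ℝ≥0) :
    Total fun f : L2Half k => elem (expVec (before t f)) (expVec (after t f)) := by
  have h := total_elem (total_expVec (H := L2 k (Ico 0 (t : ℝ))))
    (total_expVec (H := L2 k (Ici (t : ℝ))))
  refine h.of_closure fun p => subset_closure (Submodule.subset_span ?_)
  obtain ⟨f, h1, h2⟩ := exists_before_after t p.1 p.2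
  exact ⟨f, by simp only [h1, h2]⟩

/-- The Gram matrices agree because `exp` turns the orthogonal sum `⟪f, g⟫ = ⟪before⟫ + ⟪after⟫`
into a product. -/
theorem exists_split (t : ℝ≥0) :
    ∃ U : HilbertTensor (FockBefore k t) (FockAfter k t) ≃ₗᵢ[ℂ] FockHalf k,
      (∀ x, split k t x = U x) ∧
      ∀ f : L2Half k, U (elem (expVec (before t f)) (expVec (after t f))) = expVec f := by
  have h : ∃ U : HilbertTensor (FockBefore k t) (FockAfter k t) ≃ₗᵢ[ℂ] FockHalf k,
      ∀ f : L2Half k, U (elem (expVec (before t f)) (expVec (after t f))) = expVec f :=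
    exists_unitary_of_gram (total_before_after t) total_expVec fun f g => by
      rw [inner_elem, inner_expVec, inner_expVec, inner_expVec, ← Complex.exp_add, inner_before,
        inner_after, ← inner_eq_cut_add_sh]
  refine ⟨h.choose, fun x => ?_, h.choose_spec⟩
  rw [split, dif_pos h]; rfl

theorem split_elem (t : ℝ≥0) (f : L2Half k) :
    split k t (elem (expVec (before t f)) (expVec (after t f))) = expVec f := by
  obtain ⟨U, h1, h2⟩ := exists_split (k := k) t
  rw [h1, h2]

theorem inner_split (t : ℝ≥0) (x y : HilbertTensor (FockBefore k t) (FockAfter k t)) :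
    ⟪split k t x, split k t y⟫_ℂ = ⟪x, y⟫_ℂ := by
  refine inner_eq_of_total (L := ContinuousLinearMap.id ℂ _) (total_before_after (k := k) t)
    (fun f g => ?_) x y
  rw [split_elem, split_elem, ContinuousLinearMap.id_apply, ContinuousLinearMap.id_apply,
    inner_elem, inner_expVec, inner_expVec, inner_expVec, ← Complex.exp_add, inner_before,
    inner_after, ← inner_eq_cut_add_sh]

theorem split_injective (t : ℝ≥0) : Function.Injective (split k t) := by
  obtain ⟨U, h1, h2⟩ := exists_split (k := k) t
  intro x y h
  rw [h1, h1] at h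
  exact U.injective h

theorem norm_split (t : ℝ≥0) (x : HilbertTensor (FockBefore k t) (FockAfter k t)) :
    ‖split k t x‖ = ‖x‖ := by
  rw [@norm_eq_sqrt_re_inner ℂ, @norm_eq_sqrt_re_inner ℂ, inner_split]

theorem total_after (t : ℝ≥0) :
    Total fun h : L2Half k => expVec (after t (shift t h)) := by
  refine (total_expVec (H := L2 k (Ici (t : ℝ)))).of_closure fun b =>
    subset_closure (Submodule.subset_span ?_)
  obtain ⟨f, -, h2⟩ := exists_before_after t 0 b
  refine ⟨shiftAdj t f, ?_⟩
  rw [← h2]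
  refine congrArg expVec (after_eq ?_)
  rw [← sh_coe, ← fw_coe, sh_fw ENNReal.coe_ne_top]

theorem exists_postIso (t : ℝ≥0) : ∃ V : FockHalf k ≃ₗᵢ[ℂ] FockAfter k t,
    ∀ h, V (expVec h) = expVec (after t (shift t h)) :=
  exists_unitary_of_gram total_expVec (total_after t) fun f g => by
    rw [inner_expVec, inner_expVec, inner_after, ← fw_coe, ← fw_coe, sh_fw ENNReal.coe_ne_top,
      sh_fw ENNReal.coe_ne_top]

/-- The second quantised shift as a unitary from the ambient Fock space onto the Fock space
over `[t, ∞)`. -/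
def postIso (t : ℝ≥0) : FockHalf k ≃ₗᵢ[ℂ] FockAfter k t := (exists_postIso t).choose

theorem postIso_expVec (t : ℝ≥0) (h : L2Half k) :
    postIso t (expVec h) = expVec (after t (shift t h)) := (exists_postIso t).choose_spec h

/-- `y ↦ ε(f|_{[0,p)}) ⊗ Γ_p y` as a bounded operator, for finite `p`. -/
def glue (f : L2Half k) (p : ℝ≥0) : FockHalf k →L[ℂ] FockHalf k :=
  (split k p).comp ((elemL _ _ (expVec (before p f))).comp
    (postIso (k := k) p).toLinearIsometry.toContinuousLinearMap)

theorem glue_apply (f : L2Half k) (p : ℝ≥0) (y : FockHalf k) :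
    glue f p y = split k p (elem (expVec (before p f)) (postIso p y)) := rfl

theorem glue_expVec (f : L2Half k) (p : ℝ≥0) (h : L2Half k) :
    glue f p (expVec h) = expVec (cat f p h) := by
  have e1 : before p f = before p (cat f p h) := before_eq (cut_cat _ _ _).symm
  have e2 : after p (shift p h) = after p (cat f p h) := after_eq (by
    rw [← fw_coe, sh_fw ENNReal.coe_ne_top, sh_cat ENNReal.coe_ne_top])
  rw [glue_apply, postIso_expVec, e1, e2, split_elem]

theorem glue_zero (p : ℝ≥0) (y : FockHalf k) : glue 0 p y = Gam k p y := by
  have : glue (0 : L2Half k) p = Gam k p := by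
    refine clm_eq_of_total total_expVec fun h => ?_
    rw [glue_expVec, Gam_expVec, cat, cut, map_zero, map_zero, sub_zero, zero_add, fw_coe]
  rw [this]

theorem Gam_eq_split (p : ℝ≥0) (y : FockHalf k) :
    Gam k p y = split k p (elem (expVec 0) (postIso p y)) := by
  rw [← glue_zero, glue_apply, before_zero]

theorem norm_glue_le (f : L2Half k) (p : ℝ≥0) (y : FockHalf k) :
    ‖glue f p y‖ ≤ ‖expVec f‖ * ‖y‖ := by
  rw [glue_apply, norm_split, norm_elem, LinearIsometryEquiv.norm_map]
  gcongr
  have h1 : ‖expVec (before p f)‖ = ‖expVec (cut p f)‖ := by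
    rw [@norm_eq_sqrt_re_inner ℂ, @norm_eq_sqrt_re_inner ℂ, inner_expVec, inner_expVec,
      inner_before]
  rw [h1]
  exact norm_expVec_mono (norm_cut_le _ _)

theorem elem_expVec_zero_injective {p : ℝ≥0} {z z' : FockAfter k p}
    (h : elem (expVec (0 : L2 k (Ico 0 (p : ℝ)))) z = elem (expVec 0) z') : z = z' := by
  have h1 : elemL (FockBefore k p) (FockAfter k p) (expVec 0) (z - z') = 0 := by
    rw [map_sub, elemL_apply, elemL_apply, h, sub_self]
  rw [elemL_apply] at h1
  have h2 := norm_elem (expVec (0 : L2 k (Ico 0 (p : ℝ)))) (z - z')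
  rw [h1, norm_zero, norm_expVec_zero, one_mul] at h2
  exact sub_eq_zero.1 (norm_eq_zero.1 h2.symm)

/-- Tensoring with the unit vector `ε(0)` is isometric, so the chosen future part is the only one.
-/
theorem futurePart_Gam (p : ℝ≥0) (y : FockHalf k) : futurePart p (Gam k p y) = postIso p y := by
  have h : ∃ z : FockAfter k p, Gam k p y = split k p (elem (expVec 0) z) :=
    ⟨_, Gam_eq_split p y⟩
  rw [futurePart, dif_pos h]
  have h1 := (Gam_eq_split p y).symm.trans h.choose_spec
  exact (elem_expVec_zero_injective (split_injective _ h1)).symm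

/-- The vector `ε(f|_{[0,p)}) ⊗ Γ_p y`, which is `ε(f)` if `p = ∞`. -/
def glueTop (f : L2Half k) (p : ℝ≥0∞) (y : FockHalf k) : FockHalf k :=
  if p = ⊤ then expVec f else glue f p.toNNReal y

theorem glueTop_top (f : L2Half k) (y : FockHalf k) : glueTop f ⊤ y = expVec f := if_pos rfl

theorem glueTop_coe (f : L2Half k) (p : ℝ≥0) (y : FockHalf k) : glueTop f p y = glue f p y := by
  rw [glueTop, if_neg ENNReal.coe_ne_top, ENNReal.toNNReal_coe]

theorem glueTop_expVec (f : L2Half k) (p : ℝ≥0∞) (h : L2Half k) :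
    glueTop f p (expVec h) = expVec (cat f p h) := by
  induction p with
  | top => rw [glueTop_top, cat_top]
  | coe p => rw [glueTop_coe, glue_expVec]

theorem norm_glueTop_le (f : L2Half k) (p : ℝ≥0∞) (y : FockHalf k) :
    ‖glueTop f p y‖ ≤ ‖expVec f‖ * max 1 ‖y‖ := by
  induction p with
  | top => rw [glueTop_top]; exact le_mul_of_one_le_right (norm_nonneg _) (le_max_left _ _)
  | coe p =>
    rw [glueTop_coe]
    refine (norm_glue_le f p y).trans ?_
    gcongr
    exact le_max_right _ _

theorem stopTerm_eq_glueTop {f : L2Half k} {F : ℝ≥0 → FockHalf k} {p : ℝ≥0∞} {y : FockHalf k}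
    (h : p ≠ ⊤ → F p.toNNReal = Gam k p.toNNReal y) : stopTerm f F p = glueTop f p y := by
  by_cases hp : p = ⊤
  · rw [stopTerm, glueTop, if_pos hp, if_pos hp]
  · rw [stopTerm, glueTop, if_neg hp, if_neg hp, h hp, futurePart_Gam, glue_apply]

/-- Since `postIso p` is onto, the vectors `ε(0) ⊗ z` form exactly the range of `Γ_p`.
Future-adapted functions can therefore be traded for functions `y` with `F = Γ y`. -/
theorem exists_futurePart_iff (p : ℝ≥0) (x : FockHalf k) :
    (∃ z : FockAfter k p, x = split k p (elem (expVec 0) z)) ↔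
      x = Gam k p (ContinuousLinearMap.adjoint (Gam k p) x) := by
  constructor
  · rintro ⟨z, rfl⟩
    have h : split k p (elem (expVec 0) z) = Gam k p ((postIso p).symm z) := by
      rw [Gam_eq_split, LinearIsometryEquiv.apply_symm_apply]
    rw [h, adjoint_Gam_Gam]
  · intro h
    exact ⟨_, h.trans (Gam_eq_split _ _)⟩

/-- Here `δ` will be the distance from `s` to the next partition point; this limit drives the
convergence of Riemann sums. -/
theorem tendsto_glueTop (f : L2Half k) {ι : Type*} {l : Filter ι} {δ : ι → ℝ≥0∞}
    {y : ι → FockHalf k} {z : FockHalf k} (hδ : Tendsto δ l (𝓝 0)) (hy : Tendsto y l (𝓝 z)) :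
    Tendsto (fun i => glueTop f (δ i) (y i)) l (𝓝 z) := by
  have h1 : Tendsto (fun i => glue f (δ i).toNNReal z) l (𝓝 z) := by
    refine total_expVec.tendsto (L := ContinuousLinearMap.id ℂ _)
      (fun i y => norm_glue_le f _ y) (fun h => ?_) z
    simp_rw [glue_expVec]
    refine (continuous_expVec.tendsto _).comp (tendsto_cat_nhds_zero f h ?_)
    refine hδ.congr' ?_
    filter_upwards [hδ.eventually_ne ENNReal.zero_ne_top] with i hi
    rw [ENNReal.coe_toNNReal hi]
  have h2 : Tendsto (fun i => glue f (δ i).toNNReal (y i - z)) l (𝓝 0) := by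
    refine squeeze_zero_norm (fun i => norm_glue_le f _ _) ?_
    simpa using (tendsto_iff_norm_sub_tendsto_zero.1 hy).const_mul ‖expVec f‖
  have h3 := h2.add h1
  rw [zero_add] at h3
  refine h3.congr' ?_
  filter_upwards [hδ.eventually_ne ENNReal.zero_ne_top] with i hi
  rw [glueTop, if_neg hi, map_sub, sub_add_cancel]

end Split

/-! ### Integration of bounded functions against complex measures -/

section Integration

variable {X E F : Type*} [MeasurableSpace X] [NormedAddCommGroup E] [InnerProductSpace ℂ E]
  [NormedAddCommGroup F] [InnerProductSpace ℂ F]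

/-- Bounded and strongly measurable. -/
def BddMeas (φ : X → E) : Prop := StronglyMeasurable φ ∧ ∃ C, ∀ s, ‖φ s‖ ≤ C

namespace BddMeas

variable {φ ψ : X → E}

theorem const (x : E) : BddMeas fun _ : X => x := ⟨stronglyMeasurable_const, _, fun _ => le_rfl⟩

theorem add (h : BddMeas φ) (h' : BddMeas ψ) : BddMeas fun s => φ s + ψ s := by
  obtain ⟨h1, C, hC⟩ := h
  obtain ⟨h2, D, hD⟩ := h'
  exact ⟨h1.add h2, C + D, fun s => (norm_add_le _ _).trans (add_le_add (hC s) (hD s))⟩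

theorem sub (h : BddMeas φ) (h' : BddMeas ψ) : BddMeas fun s => φ s - ψ s := by
  obtain ⟨h1, C, hC⟩ := h
  obtain ⟨h2, D, hD⟩ := h'
  exact ⟨h1.sub h2, C + D, fun s => (norm_sub_le _ _).trans (add_le_add (hC s) (hD s))⟩

theorem clm (h : BddMeas φ) (K : E →L[ℂ] F) : BddMeas fun s => K (φ s) := by
  obtain ⟨h1, C, hC⟩ := h
  exact ⟨K.continuous.comp_stronglyMeasurable h1, ‖K‖ * C, fun s =>
    (K.le_opNorm _).trans (by gcongr; exact hC s)⟩

theorem smul (h : BddMeas φ) (c : ℂ) : BddMeas fun s => c • φ s :=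
  h.clm (c • ContinuousLinearMap.id ℂ E)

theorem inner (h : BddMeas φ) (h' : BddMeas ψ) : BddMeas fun s => ⟪φ s, ψ s⟫_ℂ := by
  obtain ⟨h1, C, hC⟩ := h
  obtain ⟨h2, D, hD⟩ := h'
  exact ⟨h1.inner h2, C * D, fun s => (norm_inner_le_norm _ _).trans
    (mul_le_mul (hC s) (hD s) (norm_nonneg _) ((norm_nonneg _).trans (hC s)))⟩

theorem mul {φ ψ : X → ℂ} (h : BddMeas φ) (h' : BddMeas ψ) : BddMeas fun s => φ s * ψ s := by
  obtain ⟨h1, C, hC⟩ := h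
  obtain ⟨h2, D, hD⟩ := h'
  exact ⟨h1.mul h2, C * D, fun s => (norm_mul_le _ _).trans
    (mul_le_mul (hC s) (hD s) (norm_nonneg _) ((norm_nonneg _).trans (hC s)))⟩

theorem conj {φ : X → ℂ} (h : BddMeas φ) : BddMeas fun s => starRingEnd ℂ (φ s) := by
  obtain ⟨h1, C, hC⟩ := h
  exact ⟨Complex.continuous_conj.comp_stronglyMeasurable h1, C, fun s => by
    rw [RCLike.norm_conj]; exact hC s⟩

theorem indicator (h : BddMeas φ) {A : Set X} (hA : MeasurableSet A) :
    BddMeas (A.indicator φ) := by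
  obtain ⟨h1, C, hC⟩ := h
  exact ⟨h1.indicator hA, C, fun s => (norm_indicator_le_norm_self _ _).trans (hC s)⟩

theorem of_tendsto {φ : ℕ → X → E} {ψ : X → E} {C : ℝ} (hm : ∀ n, StronglyMeasurable (φ n))
    (hC : ∀ n s, ‖φ n s‖ ≤ C) (h : ∀ s, Tendsto (fun n => φ n s) atTop (𝓝 (ψ s))) :
    BddMeas ψ :=
  ⟨stronglyMeasurable_of_tendsto atTop hm (tendsto_pi_nhds.2 h), C, fun s =>
    le_of_tendsto (h s).norm (Eventually.of_forall fun n => hC n s)⟩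

/-- The approximating simple functions share one bound, so the limit clause can always be met by
dominated convergence. -/
theorem induction {P : (X → E) → Prop}
    (ind : ∀ (c : E) (A : Set X), MeasurableSet A → P (A.indicator fun _ => c))
    (add : ∀ φ ψ, BddMeas φ → BddMeas ψ → P φ → P ψ → P fun s => φ s + ψ s)
    (lim : ∀ (φ : ℕ → X → E) (ψ : X → E) (C : ℝ), (∀ n, BddMeas (φ n)) → (∀ n s, ‖φ n s‖ ≤ C) →
      (∀ s, Tendsto (fun n => φ n s) atTop (𝓝 (ψ s))) → (∀ n, P (φ n)) → P ψ)
    {φ : X → E} (h : BddMeas φ) : P φ := by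
  have hs : ∀ f : SimpleFunc X E, P f ∧ BddMeas (f : X → E) := by
    intro f
    induction f using SimpleFunc.induction with
    | const c hA =>
      rw [SimpleFunc.coe_piecewise]
      simp only [SimpleFunc.coe_const, Function.const_zero, piecewise_eq_indicator]
      exact ⟨ind c _ hA, (BddMeas.const c).indicator hA⟩
    | add _ hf hg => exact ⟨add _ _ hf.2 hg.2 hf.1 hg.1, hf.2.add hg.2⟩
  obtain ⟨h1, C, hC⟩ := h
  have hC' : ∀ s, ‖φ s‖ ≤ max C 0 := fun s => (hC s).trans (le_max_left _ _)
  let := InnerProductSpace.toNormedSpace (𝕜 := ℂ) (E := E)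
  let : NormedSpace ℝ E := NormedSpace.restrictScalars ℝ ℂ E
  exact lim (fun n => h1.approxBounded (max C 0) n) φ (max C 0) (fun n => (hs _).2)
    (fun n s => StronglyMeasurable.norm_approxBounded_le h1 (le_max_right _ _) n s)
    (fun s => StronglyMeasurable.tendsto_approxBounded_of_norm_le h1 (hC' s)) fun n => (hs _).1

end BddMeas

/-- The variation is dominated by the sum of the total variations of the real and imaginary parts.
-/
theorem isFiniteMeasure_variation (m : ComplexMeasure X) : IsFiniteMeasure m.variation := by
  have h : m.variation ≤ (ComplexMeasure.re m).totalVariation +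
      (ComplexMeasure.im m).totalVariation := by
    refine VectorMeasure.variation_le_of_forall_enorm_le fun A hA => ?_
    have h1 := SignedMeasure.enorm_le_totalVariation (ComplexMeasure.re m) A
    have h2 := SignedMeasure.enorm_le_totalVariation (ComplexMeasure.im m) A
    rw [Measure.add_apply]
    refine le_trans ?_ (add_le_add h1 h2)
    rw [ComplexMeasure.re_apply, ComplexMeasure.im_apply]
    rw [← ofReal_norm, ← ofReal_norm, ← ofReal_norm, ← ENNReal.ofReal_add (norm_nonneg _)
      (norm_nonneg _)]
    exact ENNReal.ofReal_le_ofReal (Complex.norm_le_abs_re_add_abs_im _)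
  exact isFiniteMeasure_of_le _ h

instance (m : VectorMeasure X ℂ) : IsFiniteMeasure m.variation := isFiniteMeasure_variation m

/-- The integral over `A` of a complex function against a complex measure. -/
def cint (m : ComplexMeasure X) (A : Set X) (φ : X → ℂ) : ℂ :=
  (m.restrict A).integral φ (ContinuousLinearMap.mul ℝ ℂ)

variable {m m' : ComplexMeasure X} {A B N : Set X} {φ ψ : X → ℂ}

theorem BddMeas.integrable (h : BddMeas φ) (m : ComplexMeasure X) : m.Integrable φ := by
  obtain ⟨h1, C, hC⟩ := h
  exact Integrable.of_bound h1.aestronglyMeasurable C (Eventually.of_forall hC)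

theorem cint_add (hφ : BddMeas φ) (hψ : BddMeas ψ) :
    cint m A (fun s => φ s + ψ s) = cint m A φ + cint m A ψ :=
  VectorMeasure.integral_fun_add (hφ.integrable _) (hψ.integrable _)

theorem cint_indicator (hA : MeasurableSet A) (hB : MeasurableSet B) :
    cint m A (B.indicator φ) = cint m (A ∩ B) φ :=
  VectorMeasure.setIntegral_indicator hA hB

theorem cint_const (c : ℂ) : cint m A (fun _ => c) = c * m A :=
  VectorMeasure.setIntegral_const c

theorem cint_congr (hN : MeasurableSet N)
    (h0 : ∀ B ⊆ N, MeasurableSet B → m B = 0) (h : ∀ s ∈ A, s ∉ N → φ s = ψ s) :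
    cint m A φ = cint m A ψ := by
  refine VectorMeasure.setIntegral_congr_ae ?_
  have h1 : m.variation N = 0 := (VectorMeasure.variation_apply_eq_zero hN).2 fun B h1 h2 => h0 B h1 h2
  have h2 : ∀ᵐ s ∂m.variation, s ∉ N := measure_eq_zero_iff_ae_notMem.1 h1
  filter_upwards [h2] with s hs hsA
  exact h s hsA hs

theorem cint_congr_fun (h : ∀ s ∈ A, φ s = ψ s) : cint m A φ = cint m A ψ :=
  VectorMeasure.setIntegral_congr_fun h

theorem cint_tendsto (hA : MeasurableSet A) (hN : MeasurableSet N)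
    (h0 : ∀ B ⊆ N, MeasurableSet B → m B = 0) {φ : ℕ → X → ℂ} {C : ℝ}
    (hm : ∀ n, StronglyMeasurable (φ n)) (hC : ∀ n s, s ∈ A → s ∉ N → ‖φ n s‖ ≤ C)
    (h : ∀ s ∈ A, s ∉ N → Tendsto (fun n => φ n s) atTop (𝓝 (ψ s))) :
    Tendsto (fun n => cint m A (φ n)) atTop (𝓝 (cint m A ψ)) := by
  have h1 : m.variation N = 0 := (VectorMeasure.variation_apply_eq_zero hN).2 fun B h1 h2 => h0 B h1 h2
  have h2 : ∀ᵐ s ∂(m.restrict A).variation, s ∈ A ∧ s ∉ N := by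
    rw [VectorMeasure.variation_restrict hA]
    filter_upwards [ae_restrict_mem hA, ae_restrict_of_ae (measure_eq_zero_iff_ae_notMem.1 h1)]
      with s h3 h4 using ⟨h3, h4⟩
  refine VectorMeasure.tendsto_integral_filter_of_norm_le_const
    (Eventually.of_forall fun n => (hm n).aestronglyMeasurable)
    ⟨C, Eventually.of_forall fun n => ?_⟩ ?_
  · filter_upwards [h2] with s hs using hC n s hs.1 hs.2
  · filter_upwards [h2] with s hs using h s hs.1 hs.2

theorem cint_tendsto' (hA : MeasurableSet A) {φ : ℕ → X → ℂ} {C : ℝ}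
    (hm : ∀ n, StronglyMeasurable (φ n)) (hC : ∀ n s, ‖φ n s‖ ≤ C)
    (h : ∀ s, Tendsto (fun n => φ n s) atTop (𝓝 (ψ s))) :
    Tendsto (fun n => cint m A (φ n)) atTop (𝓝 (cint m A ψ)) :=
  cint_tendsto hA MeasurableSet.empty
    (fun B hB _ => by rw [subset_empty_iff.1 hB, VectorMeasure.empty]) hm (fun n s _ _ => hC n s)
    fun s _ _ => h s

theorem cint_measure_congr (hA : MeasurableSet A) (h : ∀ B ⊆ A, MeasurableSet B → m B = m' B) :
    cint m A φ = cint m' A φ := by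
  have : m.restrict A = m'.restrict A := by
    ext B hB
    rw [VectorMeasure.restrict_apply _ hA hB, VectorMeasure.restrict_apply _ hA hB]
    exact h _ inter_subset_right (hB.inter hA)
  rw [cint, cint, this]

/-- One induction serves for scalar multiples, conjugation, proportional measures and densities. The
maps `c` and `d s` are only required to be additive, so that conjugation is admitted. -/
theorem cint_map_eq (hA : MeasurableSet A) {c : ℂ → ℂ} {d : X → ℂ → ℂ} (hc : Continuous c)
    (hc_add : ∀ z w, c (z + w) = c z + c w) (hd : ∀ s, Continuous (d s))
    (hd_add : ∀ s z w, d s (z + w) = d s z + d s w)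
    (hdm : ∀ φ : X → ℂ, BddMeas φ → BddMeas fun s => d s (φ s))
    (hdC : ∃ D : ℝ, ∀ s z, ‖d s z‖ ≤ D * ‖z‖)
    (h : ∀ (z : ℂ) (B : Set X), B ⊆ A → MeasurableSet B →
      c (z * m B) = cint m' B (fun s => d s z))
    (hφ : BddMeas φ) : c (cint m A φ) = cint m' A (fun s => d s (φ s)) := by
  have hd0 : ∀ s, d s 0 = 0 := fun s => by have := hd_add s 0 0; simpa using this
  obtain ⟨D, hD⟩ := hdC
  refine hφ.induction (P := fun φ => c (cint m A φ) = cint m' A (fun s => d s (φ s)))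
    (fun z B hB => ?_) (fun φ ψ hφ hψ h1 h2 => ?_) fun φ ψ C hφ hC hl h1 => ?_
  · have e : (fun s => d s (B.indicator (fun _ => z) s)) = B.indicator fun s => d s z := by
      funext s
      by_cases hs : s ∈ B <;> simp [hs, hd0]
    rw [cint_indicator hA hB, cint_const, e, cint_indicator hA hB]
    exact h z _ inter_subset_left (hA.inter hB)
  · simp_rw [hd_add]
    rw [cint_add hφ hψ, cint_add (hdm _ hφ) (hdm _ hψ), hc_add, h1, h2]
  · have h2 := (hc.tendsto _).comp (cint_tendsto' (m := m) hA (fun n => (hφ n).1) hC hl)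
    have h3 : Tendsto (fun n => cint m' A (fun s => d s (φ n s))) atTop
        (𝓝 (cint m' A fun s => d s (ψ s))) := by
      refine cint_tendsto' (C := |D| * C) hA (fun n => (hdm _ (hφ n)).1) (fun n s => ?_)
        fun s => ((hd s).tendsto _).comp (hl s)
      refine (hD s _).trans ?_
      exact mul_le_mul (le_abs_self D) (hC n s) (norm_nonneg _) (abs_nonneg _)
    exact tendsto_nhds_unique h2 (h3.congr fun n => (h1 n).symm)

theorem cint_const_mul (hA : MeasurableSet A) (c : ℂ) (hφ : BddMeas φ) :
    cint m A (fun s => c * φ s) = c * cint m A φ :=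
  (cint_map_eq (c := fun z => c * z) (d := fun _ z => c * z) hA (by fun_prop)
    (fun z w => mul_add _ _ _) (fun _ => by fun_prop) (fun _ z w => mul_add _ _ _)
    (fun φ hφ => hφ.smul c) ⟨‖c‖, fun s z => norm_mul_le _ _⟩
    (fun z B _ _ => by rw [cint_const, mul_assoc]) hφ).symm

theorem cint_conj (hA : MeasurableSet A)
    (h : ∀ B ⊆ A, MeasurableSet B → m' B = starRingEnd ℂ (m B)) (hφ : BddMeas φ) :
    starRingEnd ℂ (cint m A φ) = cint m' A (fun s => starRingEnd ℂ (φ s)) :=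
  cint_map_eq (c := starRingEnd ℂ) (d := fun _ => starRingEnd ℂ) hA Complex.continuous_conj
    (map_add _) (fun _ => Complex.continuous_conj) (fun _ => map_add _) (fun φ hφ => hφ.conj)
    ⟨1, fun s z => by rw [RCLike.norm_conj, one_mul]⟩
    (fun z B hB hBm => by rw [cint_const, map_mul, h B hB hBm]) hφ

theorem cint_smul_measure (hA : MeasurableSet A) {c c' : ℂ}
    (h : ∀ B ⊆ A, MeasurableSet B → c * m B = c' * m' B) (hφ : BddMeas φ) :
    c * cint m A φ = c' * cint m' A φ := by
  rw [← cint_const_mul hA c' hφ]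
  exact cint_map_eq (c := fun z => c * z) (d := fun _ z => c' * z) hA (by fun_prop)
    (fun z w => mul_add _ _ _) (fun _ => by fun_prop) (fun _ z w => mul_add _ _ _)
    (fun φ hφ => hφ.smul c') ⟨‖c'‖, fun s z => norm_mul_le _ _⟩
    (fun z B hB hBm => by rw [cint_const, mul_left_comm, h B hB hBm]; ring) hφ

theorem withDensity_apply_eq {ρ : X → ℂ} (hρ : BddMeas ρ) :
    m.withDensity ρ (ContinuousLinearMap.mul ℝ ℂ) A = cint m A ρ :=
  VectorMeasure.withDensity_apply (hρ.integrable m)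

theorem cint_withDensity (hA : MeasurableSet A) {ρ : X → ℂ} (hρ : BddMeas ρ) (hφ : BddMeas φ) :
    cint (m.withDensity ρ (ContinuousLinearMap.mul ℝ ℂ)) A φ = cint m A (fun s => ρ s * φ s) := by
  obtain ⟨C, hC⟩ := hρ.2
  exact cint_map_eq (c := fun z => z) (d := fun s z => ρ s * z) hA continuous_id
    (fun z w => rfl) (fun _ => by fun_prop) (fun _ z w => mul_add _ _ _)
    (fun φ hφ => hρ.mul hφ) ⟨C, fun s z => by rw [norm_mul]; gcongr; exact hC s⟩
    (fun z B hB hBm => by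
      rw [withDensity_apply_eq hρ, ← cint_const_mul hBm z hρ]
      exact cint_congr_fun fun s _ => mul_comm _ _) hφ

end Integration

/-! ### Spectral measures -/

section Spectral

variable {X E : Type*} [MeasurableSpace X] [NormedAddCommGroup E] [InnerProductSpace ℂ E]
  [CompleteSpace E] {S : Set X → (E →L[ℂ] E)} {A B : Set X}

namespace IsSpectralMeasure

theorem inner_left (hS : IsSpectralMeasure S) (hA : MeasurableSet A) (x y : E) :
    ⟪S A x, y⟫_ℂ = ⟪x, S A y⟫_ℂ :=
  (ContinuousLinearMap.isSelfAdjoint_iff_isSymmetric.1 (hS.proj A hA).isSelfAdjoint) x y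

theorem apply_apply (hS : IsSpectralMeasure S) (hA : MeasurableSet A) (x : E) :
    S A (S A x) = S A x := by
  have h := (hS.proj A hA).isIdempotentElem
  exact congrArg (fun K : E →L[ℂ] E => K x) h

theorem inner_apply_apply (hS : IsSpectralMeasure S) (hA : MeasurableSet A) (x y : E) :
    ⟪S A x, S A y⟫_ℂ = ⟪x, S A y⟫_ℂ := by
  rw [hS.inner_left hA, hS.apply_apply hA]

theorem norm_apply_le (hS : IsSpectralMeasure S) (hA : MeasurableSet A) (x : E) :
    ‖S A x‖ ≤ ‖x‖ := by
  have h : ‖S A x‖ * ‖S A x‖ ≤ ‖x‖ * ‖S A x‖ := by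
    rw [← @inner_self_eq_norm_mul_norm ℂ, hS.inner_apply_apply hA]
    exact re_inner_le_norm _ _
  by_contra h'
  push Not at h'
  nlinarith [norm_nonneg x]

theorem empty (hS : IsSpectralMeasure S) : S ∅ = 0 := by
  ext y
  refine ext_inner_left ℂ fun x => ?_
  obtain ⟨μ, hμ⟩ := hS.measure x y
  rw [← hμ _ MeasurableSet.empty, VectorMeasure.empty]
  simp

theorem union (hS : IsSpectralMeasure S) (hA : MeasurableSet A) (hB : MeasurableSet B)
    (h : Disjoint A B) : S (A ∪ B) = S A + S B := by
  ext y
  refine ext_inner_left ℂ fun x => ?_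
  obtain ⟨μ, hμ⟩ := hS.measure x y
  rw [← hμ _ (hA.union hB), VectorMeasure.of_union h hA hB, hμ _ hA, hμ _ hB, add_apply,
    inner_add_right]

theorem apply_disjoint (hS : IsSpectralMeasure S) (hA : MeasurableSet A) (hB : MeasurableSet B)
    (h : Disjoint A B) (x : E) : S A (S B x) = 0 := by
  have h1 : ∀ x, S A (S B x) + S B (S A x) = 0 := by
    intro x
    have h2 := hS.apply_apply (hA.union hB) x
    rw [hS.union hA hB h] at h2
    simp only [add_apply, map_add, hS.apply_apply hA, hS.apply_apply hB] at h2
    have h3 : S A x + S B (S A x) + (S A (S B x) + S B x) = S A x + S B x := h2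
    have h4 : S A (S B x) + S B (S A x) =
      (S A x + S B (S A x) + (S A (S B x) + S B x)) - (S A x + S B x) := by abel
    rw [h4, h3, sub_self]
  -- With `P = S A` and `Q = S B`, the relation `PQ + QP = 0` gives `PQ + QPQ = 0`; applying `Q`
  -- gives `2 QPQ = 0`, hence `PQ = 0`.
  have h2 := h1 (S B x)
  have h3 := congrArg (S B) h2
  rw [hS.apply_apply hB] at h2
  rw [map_add, map_zero, hS.apply_apply hB, hS.apply_apply hB, ← two_smul ℂ] at h3
  have h4 : S B (S A (S B x)) = 0 := (smul_eq_zero.1 h3).resolve_left two_ne_zero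
  rwa [h4, add_zero] at h2

theorem inter (hS : IsSpectralMeasure S) (hA : MeasurableSet A) (hB : MeasurableSet B) (x : E) :
    S A (S B x) = S (A ∩ B) x := by
  have h1 : S A = S (A ∩ B) + S (A \ B) := by
    rw [← hS.union (hA.inter hB) (hA.diff hB) (by
      rw [Set.disjoint_left]; rintro s hs hs'; exact hs'.2 hs.2), inter_union_sdiff]
  have h2 : S B = S (A ∩ B) + S (B \ A) := by
    rw [← hS.union (hA.inter hB) (hB.diff hA) (by
      rw [Set.disjoint_left]; rintro s hs hs'; exact hs'.2 hs.1), inter_comm, inter_union_sdiff]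
  rw [h2, add_apply, map_add, hS.apply_disjoint hA (hB.diff hA) disjoint_sdiff_right, add_zero, h1,
    add_apply, hS.apply_apply (hA.inter hB), hS.apply_disjoint (hA.diff hB) (hA.inter hB)
      (by rw [Set.disjoint_left]; rintro s hs hs'; exact hs.2 hs'.2), add_zero]

theorem apply_of_subset (hS : IsSpectralMeasure S) (hA : MeasurableSet A) (hB : MeasurableSet B)
    (h : A ⊆ B) (x : E) : S A (S B x) = S A x := by
  rw [hS.inter hA hB, inter_eq_left.2 h]

theorem compl (hS : IsSpectralMeasure S) (hA : MeasurableSet A) : S Aᶜ = 1 - S A := by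
  rw [eq_sub_iff_add_eq', ← hS.union hA hA.compl disjoint_compl_right, union_compl_self, hS.univ]

theorem eq_zero_of_subset (hS : IsSpectralMeasure S) (hA : MeasurableSet A) (hB : MeasurableSet B)
    (h : A ⊆ B) (hB0 : S B = 0) : S A = 0 := by
  ext x
  rw [← hS.apply_of_subset hA hB h, hB0]
  simp

theorem tendsto_iUnion (hS : IsSpectralMeasure S) {A : ℕ → Set X} (hA : ∀ n, MeasurableSet (A n))
    (hd : Pairwise (Function.onFun Disjoint A)) (x y : E) :
    HasSum (fun n => ⟪x, S (A n) y⟫_ℂ) ⟪x, S (⋃ n, A n) y⟫_ℂ := by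
  obtain ⟨μ, hμ⟩ := hS.measure x y
  have := μ.m_iUnion hA hd
  simpa only [hμ _ (hA _), hμ _ (MeasurableSet.iUnion hA)] using this

end IsSpectralMeasure

/-- The intervals `[0, t]` form a π-system that generates the Borel sets. -/
theorem coeff_ext {F : Type*} [NormedAddCommGroup F] [InnerProductSpace ℂ F] [CompleteSpace F]
    {S : Set ℝ≥0∞ → (E →L[ℂ] E)} {T : Set ℝ≥0∞ → (F →L[ℂ] F)} (hS : IsSpectralMeasure S)
    (hT : IsSpectralMeasure T) {x y : E} {z w : F} {c d : ℂ}
    (h : ∀ t, c * ⟪x, S (Iic t) y⟫_ℂ = d * ⟪z, T (Iic t) w⟫_ℂ) {A : Set ℝ≥0∞}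
    (hA : MeasurableSet A) : c * ⟪x, S A y⟫_ℂ = d * ⟪z, T A w⟫_ℂ := by
  obtain ⟨μ, hμ⟩ := hS.measure x y
  obtain ⟨ν, hν⟩ := hT.measure z w
  have h1 : c • μ = d • ν := by
    refine VectorMeasure.ext_of_generateFrom (range Iic) ?_
      (BorelSpace.measurable_eq.trans (borel_eq_generateFrom_Iic ℝ≥0∞)) isPiSystem_Iic ?_
    · rintro _ ⟨t, rfl⟩
      simpa [hμ _ measurableSet_Iic, hν _ measurableSet_Iic] using h t
    · have := h ⊤
      rw [Iic_top] at this
      simpa [hμ _ MeasurableSet.univ, hν _ MeasurableSet.univ] using this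
  have h2 := congrArg (fun m : ComplexMeasure ℝ≥0∞ => m A) h1
  simpa [hμ _ hA, hν _ hA] using h2

end Spectral

/-! ### The measures `S^{f,g}` of a finite quantum stop time -/

section StopMeasure

variable {k : Type u} [NormedAddCommGroup k] [InnerProductSpace ℂ k]
  {S : Set ℝ≥0∞ → (FockHalf k →L[ℂ] FockHalf k)} {A : Set ℝ≥0∞}

theorem IsFiniteQuantumStopTime.spectral (hS : IsFiniteQuantumStopTime S) : IsSpectralMeasure S :=
  hS.isStopTime.spectral

theorem coeffMeasure_apply (hS : IsSpectralMeasure S) (x y : FockHalf k) (hA : MeasurableSet A) :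
    coeffMeasure S x y A = ⟪x, S A y⟫_ℂ := by
  have h := hS.measure x y
  rw [coeffMeasure, dif_pos h]
  exact h.choose_spec A hA

theorem stronglyMeasurable_expVec_sh (f : L2Half k) :
    StronglyMeasurable fun s => expVec (sh s f) :=
  continuous_expVec.comp_stronglyMeasurable (stronglyMeasurable_sh f)

theorem norm_expVec_sh_le (s : ℝ≥0∞) (f : L2Half k) : ‖expVec (sh s f)‖ ≤ ‖expVec f‖ :=
  norm_expVec_mono (norm_sh_le s f)

theorem bddMeas_expVec_sh (f : L2Half k) : BddMeas fun s => expVec (sh s f) :=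
  ⟨stronglyMeasurable_expVec_sh f, _, fun s => norm_expVec_sh_le s f⟩

theorem bddMeas_density (g f : L2Half k) :
    BddMeas fun s => Complex.exp (-⟪sh s g, sh s f⟫_ℂ) := by
  refine ⟨Complex.continuous_exp.comp_stronglyMeasurable
    ((stronglyMeasurable_sh g).inner (stronglyMeasurable_sh f)).neg, Real.exp (‖g‖ * ‖f‖),
    fun s => ?_⟩
  rw [Complex.norm_exp]
  gcongr
  rw [Complex.neg_re]
  refine (neg_le_abs _).trans ((Complex.abs_re_le_norm _).trans ((norm_inner_le_norm _ _).trans ?_))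
  gcongr
  · exact norm_sh_le s g
  · exact norm_sh_le s f

theorem stopMeasure_eq (S : Set ℝ≥0∞ → (FockHalf k →L[ℂ] FockHalf k)) (g f : L2Half k) :
    stopMeasure S g f = (coeffMeasure S (expVec g) (expVec f)).withDensity
      (fun s => Complex.exp (-⟪sh s g, sh s f⟫_ℂ)) (ContinuousLinearMap.mul ℝ ℂ) := by
  simp_rw [stopMeasure, tail_integral]

theorem stopMeasure_apply (S : Set ℝ≥0∞ → (FockHalf k →L[ℂ] FockHalf k)) (g f : L2Half k) :
    stopMeasure S g f A = cint (coeffMeasure S (expVec g) (expVec f)) A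
      fun s => Complex.exp (-⟪sh s g, sh s f⟫_ℂ) := by
  rw [stopMeasure_eq, withDensity_apply_eq (bddMeas_density g f)]

/-- The density of `S^{g,f}` is the reciprocal of the integrand, so only `⟪ε(g), S(A) ε(f)⟫` is
left. -/
theorem inner_expVec_eq_cint (hS : IsSpectralMeasure S) (g f : L2Half k) (hA : MeasurableSet A) :
    ⟪S A (expVec g), expVec f⟫_ℂ =
      cint (stopMeasure S g f) A fun s => ⟪expVec (sh s g), expVec (sh s f)⟫_ℂ := by
  rw [stopMeasure_eq, cint_withDensity hA (bddMeas_density g f)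
    ((bddMeas_expVec_sh g).inner (bddMeas_expVec_sh f)), hS.inner_left hA,
    ← coeffMeasure_apply hS _ _ hA]
  have h : cint (coeffMeasure S (expVec g) (expVec f)) A (fun _ => 1) =
      coeffMeasure S (expVec g) (expVec f) A := by rw [cint_const, one_mul]
  rw [← h]
  refine cint_congr_fun fun s _ => ?_
  rw [inner_expVec, ← Complex.exp_add, neg_add_cancel, Complex.exp_zero]

theorem stopMeasure_conj (hS : IsSpectralMeasure S) (g f : L2Half k) (hA : MeasurableSet A) :
    stopMeasure S f g A = starRingEnd ℂ (stopMeasure S g f A) := by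
  rw [stopMeasure_apply, stopMeasure_apply, cint_conj (m' := coeffMeasure S (expVec f) (expVec g))
    hA _ (bddMeas_density g f)]
  · refine cint_congr_fun fun s _ => ?_
    rw [← Complex.exp_conj, map_neg, inner_conj_symm]
  · intro B _ hB
    rw [coeffMeasure_apply hS _ _ hB, coeffMeasure_apply hS _ _ hB, inner_conj_symm,
      hS.inner_left hB]

theorem stopMeasure_null (hS : IsFiniteQuantumStopTime S) (g f : L2Half k) (hA : A ⊆ {0, ⊤})
    (hAm : MeasurableSet A) : stopMeasure S g f A = 0 := by
  have h0 : S {0, ⊤} = 0 := by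
    rw [insert_eq, hS.spectral.union (measurableSet_singleton _) (measurableSet_singleton _)
      (by simp), hS.zero, hS.top, add_zero]
  rw [stopMeasure_apply, cint_measure_congr (m' := 0) hAm]
  · rw [← zero_mul (cint 0 A _), cint_smul_measure (m' := 0) (c' := 0) hAm (by simp)
      (bddMeas_density g f), zero_mul]
    have := cint_smul_measure (m := (0 : ComplexMeasure ℝ≥0∞)) (m' := 0) (c := 1) (c' := 0) hAm
      (by simp) (bddMeas_density g f)
    simpa using this
  · intro B hB hBm
    rw [coeffMeasure_apply hS.spectral _ _ hBm, hS.spectral.eq_zero_of_subset hBm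
      (MeasurableSet.insert (measurableSet_singleton _) _) (hB.trans hA) h0]
    simp

/-! ### Locality of the measures `S^{g,f}` -/

theorem adapted_inner (hS : IsFiniteQuantumStopTime S) {q : ℝ≥0∞} (g : L2Half k) {f f' : L2Half k}
    (h : cut q f = cut q f') :
    Complex.exp (-⟪sh q g, sh q f⟫_ℂ) * ⟪expVec g, S (Iic q) (expVec f)⟫_ℂ =
      Complex.exp (-⟪sh q g, sh q f'⟫_ℂ) * ⟪expVec g, S (Iic q) (expVec f')⟫_ℂ := by
  rcases eq_or_ne q ⊤ with rfl | hq
  · rw [cut_top, cut_top] at h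
    rw [h]
  rcases eq_or_ne q 0 with rfl | hq0
  · have : Iic (0 : ℝ≥0∞) = {0} := by ext s; simp
    rw [this, hS.zero]
    simp
  lift q to ℝ≥0 using hq
  obtain ⟨Y, hY⟩ := hS.isStopTime.adapted q (by
    rw [pos_iff_ne_zero]; exact fun h => hq0 (by rw [h]; rfl))
  -- After splitting at `q`, the future factor is `exp ⟪sh q g, sh q f⟫` and cancels; what remains
  -- involves only restrictions to `[0, q)`.
  have key : ∀ f : L2Half k, Complex.exp (-⟪sh q g, sh q f⟫_ℂ) *
      ⟪expVec g, S (Iic (q : ℝ≥0∞)) (expVec f)⟫_ℂ =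
      ⟪expVec (before q g), Y (expVec (before q f))⟫_ℂ := by
    intro f
    rw [← split_elem q f, hY, ← split_elem q g, inner_split, inner_elem, inner_expVec (after q g),
      inner_after, mul_left_comm, ← Complex.exp_add, neg_add_cancel, Complex.exp_zero, mul_one]
  rw [key, key, before_eq h]

/-- The difference is the contribution of `[q, p)` to the inner product. -/
theorem inner_sh_sub_eq {q p : ℝ≥0∞} (hqp : q ≤ p) (g : L2Half k) {f f' : L2Half k}
    (h : cut p f = cut p f') :
    ⟪sh q g, sh q f⟫_ℂ - ⟪sh p g, sh p f⟫_ℂ = ⟪sh q g, sh q f'⟫_ℂ - ⟪sh p g, sh p f'⟫_ℂ := by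
  rcases eq_or_ne q ⊤ with rfl | hq
  · rw [top_le_iff.1 hqp] at h ⊢
    simp [sh_top]
  have key : ∀ f : L2Half k, ⟪sh q g, sh q f⟫_ℂ - ⟪sh p g, sh p f⟫_ℂ =
      ⟪cut (p - q) (sh q g), sh q (cut p f)⟫_ℂ := by
    intro f
    rw [inner_eq_cut_add_sh (p - q) (sh q g), sh_sh, sh_sh, tsub_add_cancel_of_le hqp,
      add_sub_cancel_right, sh_cut_of_le hq hqp]
  rw [key, key, h]

theorem adapted_inner_of_subset (hS : IsFiniteQuantumStopTime S) {p : ℝ≥0∞} (g : L2Half k)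
    {f f' : L2Half k} (h : cut p f = cut p f') (hA : A ⊆ Iic p) (hAm : MeasurableSet A) :
    Complex.exp (-⟪sh p g, sh p f⟫_ℂ) * ⟪expVec g, S A (expVec f)⟫_ℂ =
      Complex.exp (-⟪sh p g, sh p f'⟫_ℂ) * ⟪expVec g, S A (expVec f')⟫_ℂ := by
  have h1 := coeff_ext hS.spectral hS.spectral (x := expVec g) (z := expVec g)
    (y := S (Iic p) (expVec f)) (w := S (Iic p) (expVec f')) (c := Complex.exp (-⟪sh p g, sh p f⟫_ℂ))
    (d := Complex.exp (-⟪sh p g, sh p f'⟫_ℂ)) (fun t => ?_) hAm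
  · rwa [hS.spectral.apply_of_subset hAm measurableSet_Iic hA,
      hS.spectral.apply_of_subset hAm measurableSet_Iic hA] at h1
  · rw [hS.spectral.inter measurableSet_Iic measurableSet_Iic,
      hS.spectral.inter measurableSet_Iic measurableSet_Iic, Iic_inter_Iic]
    have hq : t ⊓ p ≤ p := inf_le_right
    have h2 := adapted_inner hS g (cut_eq_of_le hq h)
    have h3 := inner_sh_sub_eq hq g h
    -- Adaptedness holds at time `t ⊓ p`; the passage from there to `p` costs a factor that sees
    -- only `f|_{[0,p)}`.
    have e : ∀ f : L2Half k, Complex.exp (-⟪sh p g, sh p f⟫_ℂ) =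
        Complex.exp (⟪sh (t ⊓ p) g, sh (t ⊓ p) f⟫_ℂ - ⟪sh p g, sh p f⟫_ℂ) *
          Complex.exp (-⟪sh (t ⊓ p) g, sh (t ⊓ p) f⟫_ℂ) := by
      intro f
      rw [← Complex.exp_add]; congr 1; ring
    rw [e f, e f', mul_assoc, mul_assoc, h2, h3]

/-- Normalised at `p`, the density becomes `exp(⟪sh p g, sh p f⟫ - ⟪sh s g, sh s f⟫)`, which for `s
≤ p` is local in `f`. The compensating factor is the one that makes the matrix elements of `S(B)`
local for `B ⊆ [0, p]`. -/
theorem stopMeasure_local (hS : IsFiniteQuantumStopTime S) {p : ℝ≥0∞} (g : L2Half k)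
    {f f' : L2Half k} (h : cut p f = cut p f') (hA : A ⊆ Iic p) (hAm : MeasurableSet A) :
    stopMeasure S g f A = stopMeasure S g f' A := by
  rw [stopMeasure_apply, stopMeasure_apply]
  have hb : ∀ f : L2Half k, BddMeas fun s => Complex.exp (⟪sh p g, sh p f⟫_ℂ) *
      Complex.exp (-⟪sh s g, sh s f⟫_ℂ) := fun f => (bddMeas_density g f).smul _
  have e : ∀ f : L2Half k, cint (coeffMeasure S (expVec g) (expVec f)) A
      (fun s => Complex.exp (-⟪sh s g, sh s f⟫_ℂ)) = Complex.exp (-⟪sh p g, sh p f⟫_ℂ) *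
      cint (coeffMeasure S (expVec g) (expVec f)) A (fun s => Complex.exp (⟪sh p g, sh p f⟫_ℂ) *
      Complex.exp (-⟪sh s g, sh s f⟫_ℂ)) := by
    intro f
    rw [← cint_const_mul hAm _ (hb f)]
    refine cint_congr_fun fun s _ => ?_
    rw [← mul_assoc, ← Complex.exp_add, neg_add_cancel, Complex.exp_zero, one_mul]
  rw [e f, e f']
  rw [cint_smul_measure (m' := coeffMeasure S (expVec g) (expVec f'))
    (c' := Complex.exp (-⟪sh p g, sh p f'⟫_ℂ)) hAm _ (hb f)]
  · congr 1
    refine cint_congr_fun fun s hs => ?_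
    rw [← Complex.exp_add, ← Complex.exp_add, ← sub_eq_add_neg, ← sub_eq_add_neg, ← neg_sub,
      inner_sh_sub_eq (hA hs) g h, neg_sub]
  · intro B hB hBm
    rw [coeffMeasure_apply hS.spectral _ _ hBm, coeffMeasure_apply hS.spectral _ _ hBm]
    exact adapted_inner_of_subset hS g h (hB.trans hA) hBm

end StopMeasure

/-! ### Vectors represented by functions on `[0, ∞]` -/

section Rep

variable {k : Type u} [NormedAddCommGroup k] [InnerProductSpace ℂ k]
  {S : Set ℝ≥0∞ → (FockHalf k →L[ℂ] FockHalf k)} {A : Set ℝ≥0∞}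
  {g f : L2Half k} {w v v' : FockHalf k} {y x x' : ℝ≥0∞ → FockHalf k}

/-- The identity `⟪S(A) w, v⟫ = ∫_A ⟪y(s), x(s)⟫ S^{g,f}(ds)` for all Borel sets `A`. -/
def Pair (S : Set ℝ≥0∞ → (FockHalf k →L[ℂ] FockHalf k)) (g : L2Half k) (w : FockHalf k)
    (y : ℝ≥0∞ → FockHalf k) (f : L2Half k) (v : FockHalf k) (x : ℝ≥0∞ → FockHalf k) : Prop :=
  ∀ A, MeasurableSet A → ⟪S A w, v⟫_ℂ = cint (stopMeasure S g f) A fun s => ⟪y s, x s⟫_ℂ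

/-- The bounded function `x` represents the vector `v`, tested against exponential vectors:
informally, `v = ∫ S(ds) ε(f|_{[0,s)}) ⊗ Γ_s x(s)`. -/
structure Rep (S : Set ℝ≥0∞ → (FockHalf k →L[ℂ] FockHalf k)) (f : L2Half k) (v : FockHalf k)
    (x : ℝ≥0∞ → FockHalf k) : Prop where
  bdd : BddMeas x
  pair : ∀ g, Pair S g (expVec g) (fun s => expVec (sh s g)) f v x

/-- The bounded function `y` represents the vector `w`, tested against all represented vectors. -/
structure Strong (S : Set ℝ≥0∞ → (FockHalf k →L[ℂ] FockHalf k)) (g : L2Half k) (w : FockHalf k)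
    (y : ℝ≥0∞ → FockHalf k) : Prop where
  bdd : BddMeas y
  pair : ∀ f v x, Rep S f v x → Pair S g w y f v x

theorem measurableSet_zero_top : MeasurableSet ({0, ⊤} : Set ℝ≥0∞) :=
  MeasurableSet.insert (measurableSet_singleton _) _

namespace Pair

theorem symm (hS : IsSpectralMeasure S) (hy : BddMeas y) (hx : BddMeas x)
    (h : Pair S g w y f v x) : Pair S f v x g w y := by
  intro A hA
  rw [hS.inner_left hA, ← inner_conj_symm (𝕜 := ℂ) (E := FockHalf k), h A hA,
    cint_conj (m' := stopMeasure S f g) hA (fun B _ hB => stopMeasure_conj hS g f hB)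
    (hy.inner hx)]
  exact cint_congr_fun fun s _ => inner_conj_symm (𝕜 := ℂ) (E := FockHalf k) _ _

theorem zero : Pair S g w y f 0 fun _ => 0 := by
  intro A _
  simp only [inner_zero_right]
  rw [cint_const, zero_mul]

theorem add (hy : BddMeas y) (hx : BddMeas x) (hx' : BddMeas x') (h : Pair S g w y f v x)
    (h' : Pair S g w y f v' x') : Pair S g w y f (v + v') fun s => x s + x' s := by
  intro A hA
  simp only [inner_add_right]
  rw [h A hA, h' A hA, cint_add (hy.inner hx) (hy.inner hx')]

theorem smul (hy : BddMeas y) (hx : BddMeas x) (c : ℂ) (h : Pair S g w y f v x) :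
    Pair S g w y f (c • v) fun s => c • x s := by
  intro A hA
  simp only [inner_smul_right (𝕜 := ℂ) (E := FockHalf k)]
  rw [h A hA, cint_const_mul hA _ (hy.inner hx)]

theorem apply (hS : IsSpectralMeasure S) {B : Set ℝ≥0∞} (hB : MeasurableSet B)
    (h : Pair S g w y f v x) : Pair S g w y f (S B v) (B.indicator x) := by
  intro A hA
  rw [← hS.inner_left hB, hS.inter hB hA, inter_comm, h _ (hA.inter hB), ← cint_indicator hA hB]
  refine cint_congr_fun fun s _ => ?_
  by_cases hs : s ∈ B
  · rw [indicator_of_mem hs, indicator_of_mem hs]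
  · rw [indicator_of_notMem hs, indicator_of_notMem hs, inner_zero_right]

theorem congr (hS : IsFiniteQuantumStopTime S) (hx : ∀ s, s ≠ 0 → s ≠ ⊤ → x s = x' s)
    (h : Pair S g w y f v x) : Pair S g w y f v x' := by
  intro A hA
  rw [h A hA]
  refine cint_congr measurableSet_zero_top
    (fun B hB hBm => stopMeasure_null hS g f hB hBm) fun s _ hs => ?_
  rw [hx s (fun h => hs (by simp [h])) (fun h => hs (by simp [h]))]

/-- As `x` vanishes beyond `p`, only the restriction of `S^{g,f}` to `[0, p]` is felt. -/
theorem local_right (hS : IsFiniteQuantumStopTime S) {p : ℝ≥0∞} {f' : L2Half k}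
    (hf : cut p f = cut p f') (hx : ∀ s, p < s → x s = 0) (h : Pair S g w y f v x) :
    Pair S g w y f' v x := by
  intro A hA
  have e : ∀ f : L2Half k, cint (stopMeasure S g f) A (fun s => ⟪y s, x s⟫_ℂ) =
      cint (stopMeasure S g f) (A ∩ Iic p) fun s => ⟪y s, x s⟫_ℂ := by
    intro f
    rw [← cint_indicator hA measurableSet_Iic]
    refine cint_congr_fun fun s _ => ?_
    by_cases hs : s ∈ Iic p
    · rw [indicator_of_mem hs]
    · rw [indicator_of_notMem hs, hx s (not_le.1 hs), inner_zero_right]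
  rw [h A hA, e, e]
  exact cint_measure_congr (hA.inter measurableSet_Iic) fun B hB hBm =>
    stopMeasure_local hS g hf (hB.trans inter_subset_right) hBm

theorem tendsto (hy : BddMeas y) {v : ℕ → FockHalf k} {x : ℕ → ℝ≥0∞ → FockHalf k} {C : ℝ}
    (hm : ∀ n, BddMeas (x n)) (hC : ∀ n s, ‖x n s‖ ≤ C)
    (hv : Tendsto v atTop (𝓝 v')) (hx : ∀ s, Tendsto (fun n => x n s) atTop (𝓝 (x' s)))
    (h : ∀ n, Pair S g w y f (v n) (x n)) : Pair S g w y f v' x' := by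
  intro A hA
  obtain ⟨D, hD⟩ := hy.2
  have h1 : Tendsto (fun n => ⟪S A w, v n⟫_ℂ) atTop (𝓝 ⟪S A w, v'⟫_ℂ) :=
    (tendsto_const_nhds (x := S A w)).inner hv
  refine tendsto_nhds_unique h1 ((cint_tendsto' (m := stopMeasure S g f) hA (C := D * C)
    (fun n => (hy.inner (hm n)).1) (fun n s => ?_)
    fun s => (tendsto_const_nhds (x := y s)).inner (hx s)).congr fun n => (h n A hA).symm)
  refine (norm_inner_le_norm (𝕜 := ℂ) (E := FockHalf k) _ _).trans ?_
  have h0 : 0 ≤ D := (norm_nonneg _).trans (hD s)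
  exact mul_le_mul (hD s) (hC n s) (norm_nonneg _) h0

end Pair

namespace Rep

theorem expVec (hS : IsSpectralMeasure S) (f : L2Half k) :
    Rep S f (expVec f) fun s => StopTime.expVec (sh s f) :=
  ⟨bddMeas_expVec_sh f, fun g _ hA => inner_expVec_eq_cint hS g f hA⟩

/-- With `A` the whole space, the pairings with a total family coincide. -/
theorem unique (hS : IsSpectralMeasure S) (h : Rep S f v x) (h' : Rep S f v' x) : v = v' := by
  refine eq_of_total_inner total_expVec fun g => ?_
  have h1 := h.pair g univ MeasurableSet.univ
  have h2 := h'.pair g univ MeasurableSet.univ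
  rw [hS.univ] at h1 h2
  exact h1.trans h2.symm

end Rep

namespace Strong

theorem expVec (g : L2Half k) : Strong S g (expVec g) fun s => StopTime.expVec (sh s g) :=
  ⟨bddMeas_expVec_sh g, fun _ _ _ h => h.pair g⟩

theorem symm (hS : IsSpectralMeasure S) (h : Strong S g w y) (h' : Rep S f v x) :
    Pair S f v x g w y := (h.pair f v x h').symm hS h.bdd h'.bdd

/-- The closure properties of `Pair` concern its right-hand slot. Hermitian symmetry of `S^{g,f}`
moves the vector under study into that slot, and all the lemmas below pass through it. -/
theorem of_symm (hS : IsSpectralMeasure S) (hy : BddMeas y)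
    (h : ∀ f v x, Rep S f v x → Pair S f v x g w y) : Strong S g w y :=
  ⟨hy, fun f v x h' => (h f v x h').symm hS h'.bdd hy⟩

theorem zero (hS : IsSpectralMeasure S) : Strong S g 0 fun _ => 0 :=
  of_symm hS (BddMeas.const 0) fun _ _ _ _ => Pair.zero

variable {w' : FockHalf k} {y' : ℝ≥0∞ → FockHalf k}

theorem add (hS : IsSpectralMeasure S) (h : Strong S g w y) (h' : Strong S g w' y') :
    Strong S g (w + w') fun s => y s + y' s :=
  of_symm hS (h.bdd.add h'.bdd) fun _ _ _ hr => (h.symm hS hr).add hr.bdd h.bdd h'.bdd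
    (h'.symm hS hr)

theorem smul (hS : IsSpectralMeasure S) (c : ℂ) (h : Strong S g w y) :
    Strong S g (c • w) fun s => c • y s :=
  of_symm hS (h.bdd.smul c) fun _ _ _ hr => (h.symm hS hr).smul hr.bdd h.bdd c

theorem sub (hS : IsSpectralMeasure S) (h : Strong S g w y) (h' : Strong S g w' y') :
    Strong S g (w - w') fun s => y s - y' s := by
  simpa only [neg_one_smul, ← sub_eq_add_neg] using h.add hS (h'.smul hS (-1))

theorem sum (hS : IsSpectralMeasure S) {ι : Type*} {t : Finset ι} {w : ι → FockHalf k}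
    {y : ι → ℝ≥0∞ → FockHalf k} (h : ∀ i ∈ t, Strong S g (w i) (y i)) :
    Strong S g (∑ i ∈ t, w i) fun s => ∑ i ∈ t, y i s := by
  classical
  induction t using Finset.induction_on with
  | empty => simpa using zero hS
  | insert a t ha ih =>
    simp only [Finset.sum_insert ha]
    exact (h a (Finset.mem_insert_self _ _)).add hS
      (ih fun i hi => h i (Finset.mem_insert_of_mem hi))

theorem apply (hS : IsSpectralMeasure S) {B : Set ℝ≥0∞} (hB : MeasurableSet B)
    (h : Strong S g w y) : Strong S g (S B w) (B.indicator y) :=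
  of_symm hS (h.bdd.indicator hB) fun _ _ _ hr => (h.symm hS hr).apply hS hB

theorem congr (hS : IsFiniteQuantumStopTime S) (hy' : BddMeas y')
    (hy : ∀ s, s ≠ 0 → s ≠ ⊤ → y s = y' s) (h : Strong S g w y) : Strong S g w y' :=
  of_symm hS.spectral hy' fun _ _ _ hr => (h.symm hS.spectral hr).congr hS hy

/-- This brings the terms of a Riemann sum, each built from a different function on the half-line,
over one common `g'`. -/
theorem localize (hS : IsFiniteQuantumStopTime S) {p : ℝ≥0∞} {g' : L2Half k}
    (hg : cut p g = cut p g') (hy : ∀ s, p < s → y s = 0) (h : Strong S g w y) :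
    Strong S g' w y :=
  of_symm hS.spectral h.bdd fun _ _ _ hr => (h.symm hS.spectral hr).local_right hS hg hy

theorem tendsto (hS : IsSpectralMeasure S) {w : ℕ → FockHalf k} {y : ℕ → ℝ≥0∞ → FockHalf k}
    {C : ℝ} (hC : ∀ n s, ‖y n s‖ ≤ C) (hw : Tendsto w atTop (𝓝 w'))
    (hy : ∀ s, Tendsto (fun n => y n s) atTop (𝓝 (y' s)))
    (h : ∀ n, Strong S g (w n) (y n)) : Strong S g w' y' :=
  of_symm hS (BddMeas.of_tendsto (fun n => (h n).bdd.1) hC hy) fun _ _ _ hr =>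
    Pair.tendsto hr.bdd (fun n => (h n).bdd) hC hw hy fun n => (h n).symm hS hr

theorem rep (hS : IsSpectralMeasure S) (h : Strong S g w y) : Rep S g w y :=
  ⟨h.bdd, fun f => h.symm hS (Rep.expVec hS f)⟩

end Strong

/-! ### Vectors glued at a deterministic time -/

open Classical in
/-- The function representing `ε(f|_{[0,p)}) ⊗ Γ_p y`. -/
def slide (f : L2Half k) (p : ℝ≥0∞) (y : FockHalf k) (s : ℝ≥0∞) : FockHalf k :=
  if s = ⊤ then 0 else glueTop (sh s f) (p - s) y

theorem norm_slide_le (f : L2Half k) (p : ℝ≥0∞) (y : FockHalf k) (s : ℝ≥0∞) :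
    ‖slide f p y s‖ ≤ ‖expVec f‖ * max 1 ‖y‖ := by
  rw [slide]
  split_ifs
  · rw [norm_zero]; positivity
  · refine (norm_glueTop_le _ _ _).trans ?_
    gcongr
    exact norm_expVec_sh_le s f

theorem slide_top_left (f : L2Half k) (y y' : FockHalf k) : slide f ⊤ y = slide f ⊤ y' := by
  ext1 s
  rw [slide, slide]
  split_ifs with hs
  · rfl
  · rw [ENNReal.top_sub hs, glueTop_top, glueTop_top]

/-- The glued vector is `ε(cat f p h)`, represented over `cat f p h` by its shifts. On `A ⊆ [0, p]`
those shifts are the values of `slide`, and `cat f p h` may be replaced by `f` since they agree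
before `p`. -/
theorem strong_slide_expVec (hS : IsFiniteQuantumStopTime S) (f : L2Half k) {p : ℝ≥0∞}
    (h : L2Half k) (hA : A ⊆ Iic p) (hAm : MeasurableSet A) :
    Strong S f (S A (glueTop f p (expVec h))) (A.indicator (slide f p (expVec h))) := by
  have e : ∀ s, s ≠ ⊤ → A.indicator (fun s => expVec (sh s (cat f p h))) s =
      A.indicator (slide f p (expVec h)) s := by
    intro s hs
    by_cases hsA : s ∈ A
    · rw [indicator_of_mem hsA, indicator_of_mem hsA, slide, if_neg hs, glueTop_expVec,
        sh_cat_of_le hs (hA hsA)]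
    · rw [indicator_of_notMem hsA, indicator_of_notMem hsA]
  have h1 := (Strong.expVec (S := S) (cat f p h)).apply hS.spectral hAm
  rw [glueTop_expVec]
  refine ((h1.localize hS (cut_cat p f h) fun s hs =>
    indicator_of_notMem (fun h => (hA h).not_gt hs) _).congr hS ?_ fun s _ hs => e s hs)
  -- Measurability of `slide` on `A` is inherited from the shifts once the point `∞` is removed.
  have h2 : A.indicator (slide f p (expVec h)) =
      (A ∩ {⊤}ᶜ).indicator (fun s => expVec (sh s (cat f p h))) := by
    ext1 s
    by_cases hs : s = ⊤
    · rw [indicator_of_notMem (s := A ∩ {⊤}ᶜ) (fun h => h.2 hs), hs]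
      by_cases h : ⊤ ∈ A
      · rw [indicator_of_mem h, slide, if_pos rfl]
      · rw [indicator_of_notMem h]
    · rw [← e s hs]
      by_cases h : s ∈ A
      · rw [indicator_of_mem h, indicator_of_mem (show s ∈ A ∩ {⊤}ᶜ from ⟨h, hs⟩)]
      · rw [indicator_of_notMem h, indicator_of_notMem (fun h' => h h'.1)]
  rw [h2]
  exact (bddMeas_expVec_sh _).indicator (hAm.inter (measurableSet_singleton _).compl)

theorem slide_coe (f : L2Half k) (p : ℝ≥0) (y : FockHalf k) (s : ℝ≥0∞) :
    slide f p y s = (if s = ⊤ then (0 : FockHalf k →L[ℂ] FockHalf k) else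
      glue (sh s f) ((p : ℝ≥0∞) - s).toNNReal) y := by
  rw [slide]
  split_ifs with h
  · rfl
  · rw [glueTop, if_neg (ne_top_of_le_ne_top ENNReal.coe_ne_top tsub_le_self)]

theorem strong_slide (hS : IsFiniteQuantumStopTime S) (f : L2Half k) {p : ℝ≥0∞}
    (y : FockHalf k) (hA : A ⊆ Iic p) (hAm : MeasurableSet A) :
    Strong S f (S A (glueTop f p y)) (A.indicator (slide f p y)) := by
  induction p with
  | top =>
    -- At `∞` gluing ignores `y` and is not linear in it, so `y` is simply replaced by an
    -- exponential vector.
    rw [glueTop_top, ← glueTop_top f (expVec 0), slide_top_left f y (expVec 0)]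
    exact strong_slide_expVec hS f 0 hA hAm
  | coe p =>
    have e : ∀ (y : FockHalf k) (s : ℝ≥0∞), A.indicator (slide f p y) s =
        (A.indicator (fun s => if s = ⊤ then (0 : FockHalf k →L[ℂ] FockHalf k) else
          glue (sh s f) ((p : ℝ≥0∞) - s).toNNReal) s) y := by
      intro y s
      by_cases h : s ∈ A
      · rw [indicator_of_mem h, indicator_of_mem h, slide_coe]
      · rw [indicator_of_notMem h, indicator_of_notMem h]; rfl
    simp only [glueTop_coe]
    refine total_expVec.induction (P := fun y => Strong S f (S A (glue f p y))
      (A.indicator (slide f p y))) (fun h => ?_) ?_ ?_ ?_ ?_ y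
    · have := strong_slide_expVec hS f h hA hAm
      rwa [glueTop_coe] at this
    · have h0 : A.indicator (slide f p (0 : FockHalf k)) = fun _ => 0 := by
        ext1 s; rw [e, map_zero]
      rw [h0, map_zero, map_zero]
      exact Strong.zero hS.spectral
    · intro y z hy hz
      have h0 : A.indicator (slide f p (y + z)) =
          fun s => A.indicator (slide f p y) s + A.indicator (slide f p z) s := by
        ext1 s; simp only [e, map_add]
      rw [h0, map_add, map_add]
      exact hy.add hS.spectral hz
    · intro c y hy
      have h0 : A.indicator (slide f p (c • y)) = fun s => c • A.indicator (slide f p y) s := by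
        ext1 s; simp only [e, map_smul]
      rw [h0, map_smul, map_smul]
      exact hy.smul hS.spectral c
    · intro y z hy hz
      obtain ⟨C, hC⟩ := (hz.norm.bddAbove_range)
      have hC' : ∀ n, ‖y n‖ ≤ C := fun n => hC ⟨n, rfl⟩
      refine Strong.tendsto hS.spectral (C := ‖expVec f‖ * max 1 C) (fun n s => ?_)
        (((S A).continuous.comp (glue f p).continuous).continuousAt.tendsto.comp hz)
        (fun s => ?_) hy
      · refine (norm_indicator_le_norm_self _ _).trans ((norm_slide_le _ _ _ _).trans ?_)
        gcongr
        exact hC' n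
      · simp only [e]
        exact ((ContinuousLinearMap.continuous _).tendsto z).comp hz

end Rep

/-! ### Partitions -/

section Partitions

variable {t : ℝ≥0∞}

open Classical in
instance (t : ℝ≥0∞) : IsDirectedOrder (Partition t) :=
  ⟨fun P Q => ⟨⟨P.1 ∪ Q.1, Finset.mem_union_left _ P.2.1, Finset.mem_union_left _ P.2.2.1,
    fun p hp => (Finset.mem_union.1 hp).elim (P.2.2.2 p) (Q.2.2.2 p)⟩,
    Finset.subset_union_left, Finset.subset_union_right⟩⟩

open Classical in
/-- An increasing sequence of partitions of `[0, t]` whose union is dense. -/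
def grid (t : ℝ≥0∞) (n : ℕ) : Partition t :=
  ⟨{0, t} ∪ (Finset.range n).image fun i => min t (TopologicalSpace.denseSeq ℝ≥0∞ i), by simp,
    by simp, fun p hp => by
      simp only [Finset.mem_union, Finset.mem_insert, Finset.mem_singleton, Finset.mem_image] at hp
      rcases hp with (rfl | rfl) | ⟨i, _, rfl⟩
      · exact zero_le
      · exact le_rfl
      · exact min_le_left _ _⟩

instance (t : ℝ≥0∞) : Nonempty (Partition t) := ⟨grid t 0⟩

theorem grid_mono : Monotone (grid t) := fun _ _ h =>
  Finset.union_subset_union_right (Finset.image_subset_image (Finset.range_mono h))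

theorem exists_mem_of_grid_le {P : ℕ → Partition t} (hP : ∀ n, grid t n ≤ P n) {s u : ℝ≥0∞}
    (hs : s < t) (hu : s < u) : ∀ᶠ n in atTop, ∃ q ∈ (P n).1, s ≤ q ∧ q < u := by
  obtain ⟨x, ⟨i, rfl⟩, h1, h2⟩ :=
    (TopologicalSpace.denseRange_denseSeq ℝ≥0∞).exists_between (lt_min hs hu)
  filter_upwards [eventually_gt_atTop i] with n hn
  refine ⟨TopologicalSpace.denseSeq ℝ≥0∞ i, hP n (Finset.mem_union_right _
    (Finset.mem_image.2 ⟨i, Finset.mem_range.2 hn, ?_⟩)), h1.le, h2.trans_le (min_le_right _ _)⟩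
  exact min_eq_right (h2.le.trans (min_le_left _ _))

/-- Partitions form a net, whereas dominated convergence is applied to sequences. It is enough to
compare sequences of partitions that refine one fixed sequence with dense union. -/
theorem exists_tendsto_partition {E : Type*} [NormedAddCommGroup E] [CompleteSpace E]
    {Φ : Partition t → E}
    (h : ∀ P Q : ℕ → Partition t, (∀ n, grid t n ≤ P n) → (∀ n, grid t n ≤ Q n) →
      Tendsto (fun n => Φ (P n) - Φ (Q n)) atTop (𝓝 0)) : ∃ v, Tendsto Φ atTop (𝓝 v) := by
  have h1 : CauchySeq fun n => Φ (grid t n) := by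
    rw [Metric.cauchySeq_iff']
    by_contra! hc
    obtain ⟨ε, hε, hc⟩ := hc
    choose m hm hd using hc
    -- The indices that witness failure of the Cauchy property form a competing sequence of
    -- refinements.
    have h2 := h (fun N => grid t (m N)) (grid t) (fun N => grid_mono (hm N)) fun _ => le_rfl
    obtain ⟨N, hN⟩ := (Metric.tendsto_atTop.1 h2) ε hε
    have := hN N le_rfl
    rw [dist_zero_right, ← dist_eq_norm] at this
    exact (hd N).not_gt this
  obtain ⟨v, hv⟩ := cauchySeq_tendsto_of_complete h1
  refine ⟨v, ?_⟩
  rw [Metric.tendsto_nhds]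
  intro ε hε
  rw [eventually_atTop]
  by_contra! hc
  choose P hP hd using fun n => hc (grid t n)
  have h2 := (h P (grid t) hP fun _ => le_rfl).add hv
  simp only [sub_add_cancel, zero_add] at h2
  obtain ⟨N, hN⟩ := (Metric.tendsto_atTop.1 h2) ε hε
  exact (hd N).not_gt (hN N le_rfl)

theorem exists_seq_partition {E : Type*} [NormedAddCommGroup E] {Φ : Partition t → E} {v : E}
    (h : Tendsto Φ atTop (𝓝 v)) :
    ∃ P : ℕ → Partition t, (∀ n, grid t n ≤ P n) ∧ Tendsto (fun n => Φ (P n)) atTop (𝓝 v) := by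
  have h1 : ∀ n : ℕ, ∃ P : Partition t, grid t n ≤ P ∧ dist (Φ P) v < 1 / ((n : ℝ) + 1) := by
    intro n
    obtain ⟨Q, hQ⟩ := eventually_atTop.1 (Metric.tendsto_nhds.1 h (1 / ((n : ℝ) + 1)) (by positivity))
    obtain ⟨R, hR, hR'⟩ := exists_ge_ge (grid t n) Q
    exact ⟨R, hR, hQ R hR'⟩
  choose P hP hd using h1
  refine ⟨P, hP, tendsto_iff_dist_tendsto_zero.2 ?_⟩
  exact squeeze_zero (fun _ => dist_nonneg) (fun n => (hd n).le) tendsto_one_div_add_atTop_nhds_zero_nat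

open Classical in
/-- The point of the partition before `p`. -/
def pred (P : Finset ℝ≥0∞) (p : ℝ≥0∞) : ℝ≥0∞ := (P.filter (· < p)).sup id

theorem exists_next {P : Partition t} {s : ℝ≥0∞} (hs : s ≤ t) :
    ∃ p ∈ P.1, s ≤ p ∧ pred P.1 p ≤ s ∧ (∀ q ∈ P.1, s ≤ q → p ≤ q) ∧ (0 < s → pred P.1 p < s) := by
  classical
  have hne : (P.1.filter (s ≤ ·)).Nonempty := ⟨t, Finset.mem_filter.2 ⟨P.2.2.1, hs⟩⟩
  have hm := Finset.min'_mem _ hne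
  rw [Finset.mem_filter] at hm
  have hmin : ∀ q ∈ P.1, s ≤ q → (P.1.filter (s ≤ ·)).min' hne ≤ q := fun q hq hsq =>
    Finset.min'_le _ _ (Finset.mem_filter.2 ⟨hq, hsq⟩)
  have hlt : ∀ q ∈ P.1.filter (· < (P.1.filter (s ≤ ·)).min' hne), q < s := by
    intro q hq
    rw [Finset.mem_filter] at hq
    by_contra! h
    exact (hmin q hq.1 h).not_gt hq.2
  refine ⟨_, hm.1, hm.2, ?_, hmin, fun h0 => ?_⟩
  · refine Finset.sup_le fun q hq => (hlt q ?_).le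
    convert hq
  -- The supremum of no points is `0`, so strictness needs `0 < s`.
  · refine (Finset.sup_lt_iff h0).2 fun q hq => hlt q ?_
    convert hq

theorem pred_unique {P : Finset ℝ≥0∞} {s p q : ℝ≥0∞} (hp : p ∈ P) (hq : q ∈ P)
    (h1 : s ∈ Ioc (pred P p) p) (h2 : s ∈ Ioc (pred P q) q) : p = q := by
  classical
  have key : ∀ {p q : ℝ≥0∞}, p ∈ P → s ∈ Ioc (pred P p) p → s ∈ Ioc (pred P q) q → ¬ p < q := by
    intro p q hp h1 h2 h
    have : p ≤ pred P q := Finset.le_sup (f := id) (Finset.mem_filter.2 ⟨hp, h⟩)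
    exact (h1.2.trans this).not_gt h2.1
  exact le_antisymm (not_lt.1 (key hq h2 h1)) (not_lt.1 (key hp h1 h2))

end Partitions

/-! ### Riemann sums -/

section Riemann

variable {k : Type u} [NormedAddCommGroup k] [InnerProductSpace ℂ k]
  {S : Set ℝ≥0∞ → (FockHalf k →L[ℂ] FockHalf k)} {t : ℝ≥0∞}

variable (S) in
open Classical in
/-- The Riemann sum for `∫ S(ds) ε(f|_{[0,s)}) ⊗ Γ_s y(s)`. -/
def rsum (f : L2Half k) (y : ℝ≥0∞ → FockHalf k) (P : Finset ℝ≥0∞) : FockHalf k :=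
  ∑ p ∈ P with 0 < p, S (Ioc (pred P p) p) (glueTop f p (y p))

open Classical in
/-- The function which represents a Riemann sum. -/
def step (f : L2Half k) (y : ℝ≥0∞ → FockHalf k) (P : Finset ℝ≥0∞) (s : ℝ≥0∞) : FockHalf k :=
  ∑ p ∈ P with 0 < p, (Ioc (pred P p) p).indicator (slide f p (y p)) s

theorem strong_rsum (hS : IsFiniteQuantumStopTime S) (f : L2Half k) (y : ℝ≥0∞ → FockHalf k)
    (P : Finset ℝ≥0∞) : Strong S f (rsum S f y P) (step f y P) :=
  Strong.sum hS.spectral fun p _ => strong_slide hS f (y p) Ioc_subset_Iic_self measurableSet_Ioc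

theorem step_eq (f : L2Half k) (y : ℝ≥0∞ → FockHalf k) {P : Finset ℝ≥0∞} {p s : ℝ≥0∞}
    (hp : p ∈ P) (hs : s ∈ Ioc (pred P p) p) : step f y P s = slide f p (y p) s := by
  classical
  rw [step, Finset.sum_eq_single p]
  · exact indicator_of_mem hs _
  · intro q hq hqp
    rw [Finset.mem_filter] at hq
    exact indicator_of_notMem (fun h => hqp (pred_unique hq.1 hp h hs)) _
  · intro h
    exact absurd (Finset.mem_filter.2 ⟨hp, (zero_le.trans_lt hs.1).trans_le hs.2⟩) h

theorem step_eq_zero (f : L2Half k) (y : ℝ≥0∞ → FockHalf k) {P : Finset ℝ≥0∞} {s : ℝ≥0∞}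
    (hP : ∀ p ∈ P, p ≤ t) (hs : s ∉ Ioc 0 t) : step f y P s = 0 := by
  classical
  rw [step]
  refine Finset.sum_eq_zero fun p hp => indicator_of_notMem (fun h => hs ?_) _
  rw [Finset.mem_filter] at hp
  exact ⟨zero_le.trans_lt h.1, h.2.trans (hP p hp.1)⟩

theorem step_top (f : L2Half k) (y : ℝ≥0∞ → FockHalf k) (P : Finset ℝ≥0∞) :
    step f y P ⊤ = 0 := by
  classical
  rw [step]
  refine Finset.sum_eq_zero fun p _ => ?_
  by_cases h : ⊤ ∈ Ioc (pred P p) p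
  · rw [indicator_of_mem h, slide, if_pos rfl]
  · exact indicator_of_notMem h _

theorem norm_step_le (f : L2Half k) {y : ℝ≥0∞ → FockHalf k} {C : ℝ} (P : Partition t)
    (hC : ∀ p ≤ t, ‖y p‖ ≤ C) (s : ℝ≥0∞) : ‖step f y P.1 s‖ ≤ ‖expVec f‖ * max 1 C := by
  by_cases hs : s ∈ Ioc 0 t
  · obtain ⟨p, hp, hsp, -, -, h⟩ := exists_next (P := P) hs.2
    rw [step_eq f y hp ⟨h hs.1, hsp⟩]
    refine (norm_slide_le _ _ _ _).trans ?_
    gcongr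
    exact hC p (P.2.2.2 p hp)
  · rw [step_eq_zero f y P.2.2.2 hs, norm_zero]; positivity

/-- At a finite `s` in `(0, t]` the step function equals `glueTop (sh s f) (p - s) (y p)` with `p`
the next partition point. These points tend to `s`, so continuity of `y` and `tendsto_glueTop`
apply. -/
theorem tendsto_step (f : L2Half k) {y : ℝ≥0∞ → FockHalf k}
    (hy : ContinuousOn y {s | s ≤ t ∧ s ≠ ⊤}) {P : ℕ → Partition t} (hP : ∀ n, grid t n ≤ P n)
    (s : ℝ≥0∞) : Tendsto (fun n => step f y (P n).1 s) atTop
      (𝓝 ((Ioc 0 t ∩ {⊤}ᶜ).indicator y s)) := by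
  by_cases hs : s ∈ Ioc 0 t ∩ {⊤}ᶜ
  · rw [indicator_of_mem hs]
    have h1 : ∀ n, ∃ p ∈ (P n).1, s ≤ p ∧ (∀ q ∈ (P n).1, s ≤ q → p ≤ q) ∧
        step f y (P n).1 s = slide f p (y p) s := by
      intro n
      obtain ⟨p, hp, hsp, -, hmin, h⟩ := exists_next (P := P n) hs.1.2
      exact ⟨p, hp, hsp, hmin, step_eq f y hp ⟨h hs.1.1, hsp⟩⟩
    choose p hp hsp hmin hstep using h1
    have h2 : Tendsto p atTop (𝓝 s) := by
      rcases hs.1.2.eq_or_lt with hst | hst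
      · have : p = fun _ => s := by
          ext1 n
          exact le_antisymm (((P n).2.2.2 _ (hp n)).trans hst.ge) (hsp n)
        rw [this]; exact tendsto_const_nhds
      · refine tendsto_order.2 ⟨fun a ha => .of_forall fun n => ha.trans_le (hsp n), fun u hu => ?_⟩
        filter_upwards [exists_mem_of_grid_le hP hst hu] with n ⟨q, hq, hsq, hqu⟩
        exact (hmin n q hq hsq).trans_lt hqu
    have hfin : ∀ᶠ n in atTop, p n ≠ ⊤ := by
      filter_upwards [h2.eventually (gt_mem_nhds (lt_top_iff_ne_top.2 hs.2))] with n hn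
      exact hn.ne
    have h3 : Tendsto (fun n => y (p n)) atTop (𝓝 (y s)) :=
      ((hy s ⟨hs.1.2, hs.2⟩).tendsto).comp (tendsto_nhdsWithin_iff.2 ⟨h2, by
        filter_upwards [hfin] with n hn
        exact ⟨(P n).2.2.2 _ (hp n), hn⟩⟩)
    have h4 : Tendsto (fun n => p n - s) atTop (𝓝 0) := by
      have := ENNReal.Tendsto.sub h2 (tendsto_const_nhds (x := s)) (Or.inl hs.2)
      rwa [tsub_self] at this
    refine (tendsto_glueTop (sh s f) h4 h3).congr fun n => ?_
    rw [hstep, slide, if_neg (show s ≠ ⊤ from hs.2)]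
  · rw [indicator_of_notMem hs]
    refine tendsto_const_nhds.congr fun n => ?_
    by_cases hs' : s ∈ Ioc 0 t
    · have : s = ⊤ := by
        by_contra h
        exact hs ⟨hs', h⟩
      rw [this, step_top]
    · rw [step_eq_zero f y (P n).2.2.2 hs']

theorem Strong.inner_self (hS : IsSpectralMeasure S) {f : L2Half k} {v : FockHalf k}
    {x : ℝ≥0∞ → FockHalf k} (h : Strong S f v x) :
    ⟪v, v⟫_ℂ = cint (stopMeasure S f f) univ fun s => ⟪x s, x s⟫_ℂ := by
  have := h.pair f v x (h.rep hS) univ MeasurableSet.univ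
  rwa [hS.univ] at this

/-- The squared norm of `v n` is the integral of `⟪x n s, x n s⟫` against `S^{f,f}`, to which
dominated convergence applies. -/
theorem Strong.tendsto_zero (hS : IsSpectralMeasure S) {f : L2Half k} {v : ℕ → FockHalf k}
    {x : ℕ → ℝ≥0∞ → FockHalf k} {C : ℝ} (h : ∀ n, Strong S f (v n) (x n))
    (hC : ∀ n s, ‖x n s‖ ≤ C) (hx : ∀ s, Tendsto (fun n => x n s) atTop (𝓝 0)) :
    Tendsto v atTop (𝓝 0) := by
  have h1 := cint_tendsto' (m := stopMeasure S f f) (A := univ) MeasurableSet.univ (C := C * C)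
    (fun n => ((h n).bdd.inner (h n).bdd).1) (fun n s => ?_)
    (fun s => ((hx s).inner (𝕜 := ℂ) (hx s)))
  · have h2 : Tendsto (fun n => ⟪v n, v n⟫_ℂ) atTop (𝓝 0) := by
      simp only [inner_zero_left] at h1
      rw [cint_const, zero_mul] at h1
      exact h1.congr fun n => ((h n).inner_self hS).symm
    rw [tendsto_zero_iff_norm_tendsto_zero]
    have h3 : Tendsto (fun n => Real.sqrt (RCLike.re ⟪v n, v n⟫_ℂ)) atTop (𝓝 0) := by
      have := (Real.continuous_sqrt.tendsto _).comp ((Complex.continuous_re.tendsto _).comp h2)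
      rw [Complex.zero_re, Real.sqrt_zero] at this
      exact this
    exact h3.congr fun n => (@norm_eq_sqrt_re_inner ℂ (FockHalf k) _ _ _ (v n)).symm
  · have h0 : 0 ≤ C := (norm_nonneg _).trans (hC n s)
    exact (norm_inner_le_norm (𝕜 := ℂ) (E := FockHalf k) _ _).trans
      (mul_le_mul (hC n s) (hC n s) (norm_nonneg _) h0)

theorem strong_of_tendsto (hS : IsFiniteQuantumStopTime S) (f : L2Half k)
    {y : ℝ≥0∞ → FockHalf k} (hy : ContinuousOn y {s | s ≤ t ∧ s ≠ ⊤}) {C : ℝ}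
    (hC : ∀ p ≤ t, ‖y p‖ ≤ C) {v : FockHalf k}
    (hv : Tendsto (fun P : Partition t => rsum S f y P.1) atTop (𝓝 v)) :
    Strong S f v ((Ioc 0 t ∩ {⊤}ᶜ).indicator y) := by
  obtain ⟨P, hP, hv'⟩ := exists_seq_partition hv
  exact Strong.tendsto hS.spectral (fun n s => norm_step_le f (P n) hC s) hv'
    (tendsto_step f hy hP) fun n => strong_rsum hS f y _

/-- The difference of two Riemann sums is represented by the difference of their step functions, and
both of these have the same pointwise limit. -/
theorem exists_tendsto_rsum (hS : IsFiniteQuantumStopTime S) (f : L2Half k)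
    {y : ℝ≥0∞ → FockHalf k} (hy : ContinuousOn y {s | s ≤ t ∧ s ≠ ⊤}) {C : ℝ}
    (hC : ∀ p ≤ t, ‖y p‖ ≤ C) :
    ∃ v, Tendsto (fun P : Partition t => rsum S f y P.1) atTop (𝓝 v) := by
  refine exists_tendsto_partition fun P Q hP hQ => ?_
  refine Strong.tendsto_zero hS.spectral (fun n => (strong_rsum hS f y _).sub hS.spectral
    (strong_rsum hS f y _)) (C := ‖expVec f‖ * max 1 C + ‖expVec f‖ * max 1 C) (fun n s => ?_)
    fun s => ?_
  · exact (norm_sub_le _ _).trans (add_le_add (norm_step_le f _ hC s) (norm_step_le f _ hC s))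
  · have := (tendsto_step f hy hP s).sub (tendsto_step f hy hQ s)
    rwa [sub_self] at this

theorem riemannSum_eq_rsum {f : L2Half k} {F : ℝ≥0 → FockHalf k} {y : ℝ≥0∞ → FockHalf k}
    (h : ∀ p : ℝ≥0, 0 < p → (p : ℝ≥0∞) ≤ t → F p = Gam k p (y p)) (P : Partition t) :
    riemannSum S f F P.1 = rsum S f y P.1 := by
  classical
  rw [riemannSum, rsum]
  refine Finset.sum_congr rfl fun p hp => ?_
  rw [Finset.mem_filter] at hp
  rw [stopTerm_eq_glueTop (y := y p) fun hpt => ?_]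
  · rfl
  · have := h p.toNNReal (ENNReal.toNNReal_pos hp.2.ne' hpt)
      (by rw [ENNReal.coe_toNNReal hpt]; exact P.2.2.2 p hp.1)
    rwa [ENNReal.coe_toNNReal hpt] at this

theorem hasRiemannStopIntegral_iff {f : L2Half k} {F : ℝ≥0 → FockHalf k} {y : ℝ≥0∞ → FockHalf k}
    (h : ∀ p : ℝ≥0, 0 < p → (p : ℝ≥0∞) ≤ t → F p = Gam k p (y p)) (v : FockHalf k) :
    HasRiemannStopIntegral S t f F v ↔
      Tendsto (fun P : Partition t => rsum S f y P.1) atTop (𝓝 v) := by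
  rw [HasRiemannStopIntegral]
  simp_rw [riemannSum_eq_rsum h]

open Classical in
/-- The function `s ↦ Γ_s^* F(s)` on `[0, ∞]`, with value `0` at infinity. -/
def pullback (F : ℝ≥0 → FockHalf k) (s : ℝ≥0∞) : FockHalf k :=
  if s = ⊤ then 0 else ContinuousLinearMap.adjoint (Gam k s.toNNReal) (F s.toNNReal)

theorem pullback_coe (F : ℝ≥0 → FockHalf k) (s : ℝ≥0) :
    pullback F s = ContinuousLinearMap.adjoint (Gam k s) (F s) := by
  rw [pullback, if_neg ENNReal.coe_ne_top, ENNReal.toNNReal_coe]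

theorem FutureAdapted.eq_Gam {F : ℝ≥0 → FockHalf k} (hF : FutureAdapted t F) {p : ℝ≥0}
    (h0 : 0 < p) (hp : (p : ℝ≥0∞) ≤ t) : F p = Gam k p (pullback F p) := by
  rw [pullback_coe]
  exact (exists_futurePart_iff p (F p)).1 (hF p h0 hp)

theorem tendsto_adjoint_Gam {ι : Type*} {l : Filter ι} {s : ι → ℝ≥0} {s₀ : ℝ≥0}
    {x : ι → FockHalf k} {x₀ : FockHalf k} (hs : Tendsto s l (𝓝 s₀)) (hx : Tendsto x l (𝓝 x₀)) :
    Tendsto (fun i => ContinuousLinearMap.adjoint (Gam k (s i)) (x i)) l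
      (𝓝 (ContinuousLinearMap.adjoint (Gam k s₀) x₀)) := by
  have h1 := ((continuous_adjoint_Gam x₀).tendsto s₀).comp hs
  have h2 : Tendsto (fun i => ContinuousLinearMap.adjoint (Gam k (s i)) (x i - x₀)) l (𝓝 0) := by
    refine squeeze_zero_norm (fun i => norm_adjoint_Gam_le _ _) ?_
    have := (hx.sub (tendsto_const_nhds (x := x₀))).norm
    rwa [sub_self, norm_zero] at this
  have h3 := h2.add h1
  rw [zero_add] at h3
  refine h3.congr fun i => ?_
  rw [map_sub, Function.comp_apply, sub_add_cancel]

theorem continuousOn_pullback {F : ℝ≥0 → FockHalf k}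
    (hF : ContinuousOn F {s : ℝ≥0 | (s : ℝ≥0∞) ≤ t}) :
    ContinuousOn (pullback F) {s | s ≤ t ∧ s ≠ ⊤} := by
  have h1 : ContinuousOn (fun s : ℝ≥0∞ => ContinuousLinearMap.adjoint (Gam k s.toNNReal)
      (F s.toNNReal)) {s | s ≤ t ∧ s ≠ ⊤} := by
    intro s hs
    have h2 : ContinuousWithinAt ENNReal.toNNReal {s | s ≤ t ∧ s ≠ ⊤} s :=
      (ENNReal.continuousOn_toNNReal s hs.2).mono fun s hs => hs.2
    refine tendsto_adjoint_Gam h2 ?_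
    refine ((hF s.toNNReal ?_).tendsto).comp (tendsto_nhdsWithin_iff.2 ⟨h2, ?_⟩)
    · change (s.toNNReal : ℝ≥0∞) ≤ t
      rw [ENNReal.coe_toNNReal hs.2]; exact hs.1
    · filter_upwards [self_mem_nhdsWithin] with r hr
      rw [ENNReal.coe_toNNReal hr.2]; exact hr.1
  exact h1.congr fun s hs => if_neg hs.2

theorem norm_pullback_le {F : ℝ≥0 → FockHalf k} {C : ℝ}
    (hC : ∀ s : ℝ≥0, (s : ℝ≥0∞) ≤ t → ‖F s‖ ≤ C) {s : ℝ≥0∞} (hs : s ≤ t) :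
    ‖pullback F s‖ ≤ C := by
  induction s with
  | top =>
    rw [pullback, if_pos rfl, norm_zero]
    exact (norm_nonneg _).trans (hC 0 (zero_le.trans hs))
  | coe s => rw [pullback_coe]; exact (norm_adjoint_Gam_le _ _).trans (hC s hs)

theorem strong_of_hasRiemannStopIntegral (hS : IsFiniteQuantumStopTime S) {g : L2Half k}
    {G : ℝ≥0 → FockHalf k} {w : FockHalf k} (hc : ContinuousOn G {s : ℝ≥0 | (s : ℝ≥0∞) ≤ t})
    (hb : BoundedUpTo t G) (hf : FutureAdapted t G) (hw : HasRiemannStopIntegral S t g G w) :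
    Strong S g w ((Ioc 0 t ∩ {⊤}ᶜ).indicator (pullback G)) := by
  obtain ⟨C, hC⟩ := hb
  exact strong_of_tendsto hS g (continuousOn_pullback hc) (fun p hp => norm_pullback_le hC hp)
    ((hasRiemannStopIntegral_iff (fun p h0 hp => hf.eq_Gam h0 hp) w).1 hw)

end Riemann

/-! ### Stop-time integrals of bounded measurable functions -/

section StopInt

variable {k : Type u} [NormedAddCommGroup k] [InnerProductSpace ℂ k]
  {S : Set ℝ≥0∞ → (FockHalf k →L[ℂ] FockHalf k)} {A : Set ℝ≥0∞} {t : ℝ≥0∞}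
  {f g : L2Half k}

theorem exists_tendsto_of_strong (hS : IsSpectralMeasure S) {v : ℕ → FockHalf k}
    {x : ℕ → ℝ≥0∞ → FockHalf k} {x' : ℝ≥0∞ → FockHalf k} {C : ℝ}
    (h : ∀ n, Strong S f (v n) (x n)) (hC : ∀ n s, ‖x n s‖ ≤ C)
    (hx : ∀ s, Tendsto (fun n => x n s) atTop (𝓝 (x' s))) :
    ∃ v', Tendsto v atTop (𝓝 v') ∧ Strong S f v' x' := by
  have h1 : CauchySeq v := by
    rw [Metric.cauchySeq_iff']
    by_contra! hc
    obtain ⟨ε, hε, hc⟩ := hc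
    choose m hm hd using hc
    have hm' : Tendsto m atTop atTop := tendsto_atTop_mono hm tendsto_id
    have h2 := Strong.tendsto_zero hS (fun N => (h (m N)).sub hS (h N)) (C := C + C)
      (fun N s => (norm_sub_le _ _).trans (add_le_add (hC _ _) (hC _ _))) (fun s => by
        have := ((hx s).comp hm').sub (hx s)
        rwa [sub_self] at this)
    obtain ⟨N, hN⟩ := (Metric.tendsto_atTop.1 h2) ε hε
    have := hN N le_rfl
    rw [dist_zero_right, ← dist_eq_norm] at this
    exact (hd N).not_gt this
  obtain ⟨v', hv⟩ := cauchySeq_tendsto_of_complete h1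
  exact ⟨v', hv, Strong.tendsto hS hC hv hx h⟩

theorem exists_strong_const (hS : IsFiniteQuantumStopTime S) (f : L2Half k) (y : FockHalf k)
    (t : ℝ≥0∞) : ∃ v, Tendsto (fun P : Partition t => rsum S f (fun _ => y) P.1) atTop (𝓝 v) ∧
      Strong S f v ((Iic t).indicator fun _ => y) := by
  obtain ⟨v, hv⟩ := exists_tendsto_rsum (t := t) hS f (y := fun _ => y) continuousOn_const
    (fun _ _ => le_rfl)
  refine ⟨v, hv, (strong_of_tendsto hS f continuousOn_const (fun _ _ => le_rfl) hv).congr hS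
    ((BddMeas.const y).indicator measurableSet_Iic) fun s h0 ht => ?_⟩
  by_cases hs : s ≤ t
  · rw [indicator_of_mem (show s ∈ Ioc 0 t ∩ {⊤}ᶜ from ⟨⟨pos_iff_ne_zero.2 h0, hs⟩, ht⟩),
      indicator_of_mem (show s ∈ Iic t from hs)]
  · rw [indicator_of_notMem (fun h => hs h.1.2), indicator_of_notMem (show s ∉ Iic t from hs)]

/-- Constants are integrated by Riemann sums, `S(A)` produces indicators, and bounded pointwise
limits of integrands give norm limits of vectors. -/
theorem exists_strong (hS : IsFiniteQuantumStopTime S) {x : ℝ≥0∞ → FockHalf k} (hx : BddMeas x) :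
    ∃ v, Strong S f v x := by
  refine BddMeas.induction (P := fun x => ∃ v, Strong S f v x) (fun c A hA => ?_) ?_ ?_ hx
  · obtain ⟨v, -, hv⟩ := exists_strong_const hS f c ⊤
    rw [Iic_top, indicator_univ] at hv
    exact ⟨_, hv.apply hS.spectral hA⟩
  · rintro φ ψ - - ⟨v, hv⟩ ⟨w, hw⟩
    exact ⟨_, hv.add hS.spectral hw⟩
  · intro φ ψ C _ hC hlim h
    choose v hv using h
    obtain ⟨v', -, hv'⟩ := exists_tendsto_of_strong hS.spectral hv hC hlim
    exact ⟨v', hv'⟩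

variable (S) in
open Classical in
/-- The stop-time integral `∫ S(ds) ε(f|_{[0,s)}) ⊗ Γ_s x(s)` of a bounded measurable function. -/
def sint (f : L2Half k) (x : ℝ≥0∞ → FockHalf k) : FockHalf k :=
  if h : ∃ v, Strong S f v x then h.choose else 0

theorem strong_sint (hS : IsFiniteQuantumStopTime S) (f : L2Half k) {x : ℝ≥0∞ → FockHalf k}
    (hx : BddMeas x) : Strong S f (sint S f x) x := by
  have h := exists_strong (f := f) hS hx
  rw [sint, dif_pos h]
  exact h.choose_spec

/-- An integral can thus be recognised by testing against exponential vectors only. -/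
theorem Rep.eq_sint (hS : IsFiniteQuantumStopTime S) {v : FockHalf k} {x : ℝ≥0∞ → FockHalf k}
    (h : Rep S f v x) : v = sint S f x :=
  h.unique hS.spectral ((strong_sint hS f h.bdd).rep hS.spectral)

theorem Strong.eq_sint (hS : IsFiniteQuantumStopTime S) {v : FockHalf k} {x : ℝ≥0∞ → FockHalf k}
    (h : Strong S f v x) : v = sint S f x := (h.rep hS.spectral).eq_sint hS

theorem expVec_eq_sint (hS : IsFiniteQuantumStopTime S) (f : L2Half k) :
    expVec f = sint S f fun s => expVec (sh s f) := (Strong.expVec f).eq_sint hS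

theorem inner_apply_sint (hS : IsFiniteQuantumStopTime S) (g f : L2Half k)
    {y x : ℝ≥0∞ → FockHalf k} (hy : BddMeas y) (hx : BddMeas x) (hA : MeasurableSet A) :
    ⟪S A (sint S g y), sint S f x⟫_ℂ = cint (stopMeasure S g f) A fun s => ⟪y s, x s⟫_ℂ :=
  (strong_sint hS g hy).pair f _ x ((strong_sint hS f hx).rep hS.spectral) A hA

theorem inner_sint (hS : IsFiniteQuantumStopTime S) (g f : L2Half k)
    {y x : ℝ≥0∞ → FockHalf k} (hy : BddMeas y) (hx : BddMeas x) :
    ⟪sint S g y, sint S f x⟫_ℂ = cint (stopMeasure S g f) univ fun s => ⟪y s, x s⟫_ℂ := by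
  rw [← inner_apply_sint hS g f hy hx MeasurableSet.univ, hS.spectral.univ]
  rfl

theorem apply_sint (hS : IsFiniteQuantumStopTime S) (f : L2Half k) {x : ℝ≥0∞ → FockHalf k}
    (hx : BddMeas x) (hA : MeasurableSet A) : S A (sint S f x) = sint S f (A.indicator x) :=
  ((strong_sint hS f hx).apply hS.spectral hA).eq_sint hS

theorem sint_congr (hS : IsFiniteQuantumStopTime S) (f : L2Half k) {x x' : ℝ≥0∞ → FockHalf k}
    (hx : BddMeas x) (hx' : BddMeas x') (h : ∀ s, s ≠ 0 → s ≠ ⊤ → x s = x' s) :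
    sint S f x = sint S f x' :=
  ((strong_sint hS f hx).congr hS hx' h).eq_sint hS

theorem sint_zero (hS : IsFiniteQuantumStopTime S) (f : L2Half k) : sint S f (fun _ => 0) = 0 :=
  ((Strong.zero hS.spectral).eq_sint hS).symm

theorem sint_add (hS : IsFiniteQuantumStopTime S) (f : L2Half k) {x x' : ℝ≥0∞ → FockHalf k}
    (hx : BddMeas x) (hx' : BddMeas x') :
    sint S f (fun s => x s + x' s) = sint S f x + sint S f x' :=
  (((strong_sint hS f hx).add hS.spectral (strong_sint hS f hx')).eq_sint hS).symm

theorem sint_smul (hS : IsFiniteQuantumStopTime S) (f : L2Half k) {x : ℝ≥0∞ → FockHalf k}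
    (hx : BddMeas x) (c : ℂ) : sint S f (fun s => c • x s) = c • sint S f x :=
  (((strong_sint hS f hx).smul hS.spectral c).eq_sint hS).symm

theorem sint_sub (hS : IsFiniteQuantumStopTime S) (f : L2Half k) {x x' : ℝ≥0∞ → FockHalf k}
    (hx : BddMeas x) (hx' : BddMeas x') :
    sint S f (fun s => x s - x' s) = sint S f x - sint S f x' :=
  (((strong_sint hS f hx).sub hS.spectral (strong_sint hS f hx')).eq_sint hS).symm

theorem tendsto_sint (hS : IsFiniteQuantumStopTime S) (f : L2Half k)
    {x : ℕ → ℝ≥0∞ → FockHalf k} {x' : ℝ≥0∞ → FockHalf k} {C : ℝ} (hx : ∀ n, BddMeas (x n))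
    (hC : ∀ n s, ‖x n s‖ ≤ C) (h : ∀ s, Tendsto (fun n => x n s) atTop (𝓝 (x' s))) :
    Tendsto (fun n => sint S f (x n)) atTop (𝓝 (sint S f x')) := by
  obtain ⟨v', h1, h2⟩ := exists_tendsto_of_strong hS.spectral
    (fun n => strong_sint hS f (hx n)) hC h
  rwa [h2.eq_sint hS] at h1

/-- Integrals of simple functions are combinations of the vectors `S(A) sint S f c`. Applied to
`ε(f)`, itself an integral, this makes those vectors total. -/
theorem sint_mem_closure (hS : IsFiniteQuantumStopTime S) (f : L2Half k)
    {x : ℝ≥0∞ → FockHalf k} (hx : BddMeas x) :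
    sint S f x ∈ closure (Submodule.span ℂ (range fun p : {A : Set ℝ≥0∞ // MeasurableSet A} ×
      L2Half k × FockHalf k => S p.1 (sint S p.2.1 fun _ => p.2.2)) : Set (FockHalf k)) := by
  set V := Submodule.span ℂ (range fun p : {A : Set ℝ≥0∞ // MeasurableSet A} ×
      L2Half k × FockHalf k => S p.1 (sint S p.2.1 fun _ => p.2.2)) with hV
  change sint S f x ∈ (V.topologicalClosure : Set (FockHalf k))
  refine BddMeas.induction (P := fun x => sint S f x ∈ V.topologicalClosure)
    (fun c A hA => ?_) ?_ ?_ hx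
  · rw [← apply_sint hS f (BddMeas.const c) hA]
    exact V.le_topologicalClosure (Submodule.subset_span ⟨(⟨A, hA⟩, f, c), rfl⟩)
  · intro φ ψ hφ hψ h h'
    rw [sint_add hS f hφ hψ]
    exact Submodule.add_mem _ h h'
  · intro φ ψ C hφ hC hlim h
    exact V.isClosed_topologicalClosure.mem_of_tendsto (tendsto_sint hS f hφ hC hlim)
      (Eventually.of_forall h)

variable (S) in
theorem total_apply_sint (hS : IsFiniteQuantumStopTime S) :
    Total fun p : {A : Set ℝ≥0∞ // MeasurableSet A} × L2Half k × FockHalf k =>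
      S p.1 (sint S p.2.1 fun _ => p.2.2) :=
  total_expVec.of_closure fun f => by
    rw [expVec_eq_sint hS f]
    exact sint_mem_closure hS f (bddMeas_expVec_sh f)

theorem total_sint (hS : IsFiniteQuantumStopTime S) :
    Total fun p : L2Half k × {x : ℝ≥0∞ → FockHalf k // BddMeas x} => sint S p.1 p.2.1 := by
  refine total_expVec.of_closure fun f => subset_closure (Submodule.subset_span ?_)
  exact ⟨(f, ⟨_, bddMeas_expVec_sh f⟩), (expVec_eq_sint hS f).symm⟩

theorem inner_apply_sint_const (hS : IsFiniteQuantumStopTime S) (g f : L2Half k)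
    (y x : FockHalf k) (hA : MeasurableSet A) :
    ⟪S A (sint S g fun _ => y), sint S f fun _ => x⟫_ℂ = stopMeasure S g f A * ⟪y, x⟫_ℂ := by
  rw [inner_apply_sint hS g f (BddMeas.const y) (BddMeas.const x) hA, cint_const, mul_comm]

theorem tendsto_rsum_const (hS : IsFiniteQuantumStopTime S) (f : L2Half k) (y : FockHalf k)
    (t : ℝ≥0∞) : Tendsto (fun P : Partition t => rsum S f (fun _ => y) P.1) atTop
      (𝓝 (S (Iic t) (sint S f fun _ => y))) := by
  obtain ⟨v, hv, h⟩ := exists_strong_const hS f y t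
  rwa [apply_sint hS f (BddMeas.const y) measurableSet_Iic, ← h.eq_sint hS]

theorem hasRiemannStopIntegral_Gam_iff (hS : IsFiniteQuantumStopTime S) (f : L2Half k)
    (y v : FockHalf k) (t : ℝ≥0∞) :
    HasRiemannStopIntegral S t f (fun s => Gam k s y) v ↔ v = S (Iic t) (sint S f fun _ => y) := by
  rw [hasRiemannStopIntegral_iff (y := fun _ => y) (fun _ _ _ => rfl)]
  exact ⟨fun h => tendsto_nhds_unique h (tendsto_rsum_const hS f y t),
    fun h => h ▸ tendsto_rsum_const hS f y t⟩

end StopInt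

/-! ### Time projections and stopped shifts -/

section TimeProj

variable {k : Type u} [NormedAddCommGroup k] [InnerProductSpace ℂ k]
  {S : Set ℝ≥0∞ → (FockHalf k →L[ℂ] FockHalf k)} {A B : Set ℝ≥0∞} {t : ℝ≥0∞}

theorem inner_apply_sint_one_expVec (hS : IsFiniteQuantumStopTime S) (g f : L2Half k)
    (hA : MeasurableSet A) :
    ⟪S A (sint S g fun _ => expVec 0), expVec f⟫_ℂ = stopMeasure S g f A := by
  have h := (strong_sint hS g (BddMeas.const (expVec 0))).pair f _ _ (Rep.expVec hS.spectral f) A hA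
  simp only [inner_expVec, inner_zero_left, Complex.exp_zero] at h
  rw [h, cint_const, one_mul]

theorem inner_apply_sint_one (hS : IsFiniteQuantumStopTime S) (g f : L2Half k)
    (hA : MeasurableSet A) :
    ⟪S A (sint S g fun _ => expVec 0), sint S f fun _ => expVec 0⟫_ℂ = stopMeasure S g f A := by
  rw [inner_apply_sint_const hS g f _ _ hA, inner_expVec, inner_zero_left, Complex.exp_zero,
    mul_one]

/-- Each image vector has the same inner product, `S^{g,f}([0, t])`, with another image vector as
with the exponential vector behind it. For combinations `z ↦ w` this says `⟪w, w⟫ = ⟪w, z⟫`, hence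
`‖w‖ ≤ ‖z‖`. -/
theorem exists_timeProjUpTo (hS : IsFiniteQuantumStopTime S) (t : ℝ≥0∞) :
    ∃ E : FockHalf k →L[ℂ] FockHalf k, ∀ f : L2Half k,
      HasRiemannStopIntegral S t f (fun _ => expVec 0) (E (expVec f)) := by
  have key : ∀ c : L2Half k →₀ ℂ,
      ‖Finsupp.linearCombination ℂ (fun f : L2Half k => S (Iic t) (sint S f fun _ => expVec 0)) c‖ ≤
        1 * ‖Finsupp.linearCombination ℂ (fun f : L2Half k => (expVec f : FockHalf k)) c‖ := by
    intro c
    set z := Finsupp.linearCombination ℂ (fun f : L2Half k => (expVec f : FockHalf k)) c with hz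
    set w := Finsupp.linearCombination ℂ
      (fun f : L2Half k => S (Iic t) (sint S f fun _ => expVec 0)) c with hw
    have h1 : ⟪w, w⟫_ℂ = ⟪w, z⟫_ℂ := by
      rw [hw, hz, inner_linearCombination, inner_linearCombination]
      refine Finset.sum_congr rfl fun g _ => Finset.sum_congr rfl fun f _ => ?_
      rw [inner_apply_sint_one_expVec hS g f measurableSet_Iic,
        hS.spectral.inner_apply_apply measurableSet_Iic, ← hS.spectral.inner_left measurableSet_Iic,
        inner_apply_sint_one hS g f measurableSet_Iic]
    have h2 : ‖w‖ * ‖w‖ ≤ ‖w‖ * ‖z‖ := by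
      rw [← @inner_self_eq_norm_mul_norm ℂ (FockHalf k) _ _ _ w]
      refine (congrArg RCLike.re h1).trans_le ?_
      exact re_inner_le_norm (𝕜 := ℂ) (E := FockHalf k) w z
    rw [one_mul]
    by_contra h'
    push Not at h'
    nlinarith [norm_nonneg z]
  obtain ⟨E, hE, -⟩ := exists_clm_of_bound (E := FockHalf k) total_expVec _ 1 key
  refine ⟨E, fun f => ?_⟩
  have h := (hasRiemannStopIntegral_Gam_iff hS f (expVec 0) (E (expVec f)) t).2 (hE f)
  simpa only [Gam_expVec, ← fw_coe, map_zero] using h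

theorem timeProjUpTo_expVec (hS : IsFiniteQuantumStopTime S) (t : ℝ≥0∞) (f : L2Half k) :
    timeProjUpTo S t (expVec f) = S (Iic t) (sint S f fun _ => expVec 0) := by
  have h := exists_timeProjUpTo hS t
  rw [timeProjUpTo, dif_pos h]
  refine (hasRiemannStopIntegral_Gam_iff hS f (expVec 0) _ t).1 ?_
  have h1 := h.choose_spec f
  simpa only [Gam_expVec, ← fw_coe, map_zero] using h1

theorem timeProj_expVec (hS : IsFiniteQuantumStopTime S) (f : L2Half k) :
    timeProj S (expVec f) = sint S f fun _ => expVec 0 := by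
  rw [timeProj, timeProjUpTo_expVec hS, Iic_top, hS.spectral.univ]
  rfl

/-- Both orders of the product have matrix elements `S^{g,f}(A)` between exponential vectors: `E_S`
is self-adjoint and `S^{g,f}` is Hermitian in `(g, f)`. -/
theorem apply_timeProj (hS : IsFiniteQuantumStopTime S) (hA : MeasurableSet A) (x : FockHalf k) :
    S A (timeProj S x) = timeProj S (S A x) := by
  have hc : ∀ x y : FockHalf k, starRingEnd ℂ ⟪x, y⟫_ℂ = ⟪y, x⟫_ℂ :=
    fun x y => inner_conj_symm (𝕜 := ℂ) (E := FockHalf k) y x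
  have hsym : ∀ x y, ⟪timeProj S x, y⟫_ℂ = ⟪x, timeProj S y⟫_ℂ := by
    have h1 : ∀ g f : L2Half k, ⟪timeProj S (expVec g), expVec f⟫_ℂ =
        ⟪expVec g, timeProj S (expVec f)⟫_ℂ := by
      intro g f
      have h := fun g f => inner_apply_sint_one_expVec hS g f (A := univ) MeasurableSet.univ
      simp only [hS.spectral.univ, one_apply_eq_self] at h
      rw [timeProj_expVec hS, timeProj_expVec hS, h, ← hc, h,
        ← stopMeasure_conj hS.spectral _ _ MeasurableSet.univ]
    have h2 : ContinuousLinearMap.adjoint (timeProj S) = timeProj S := by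
      refine clm_eq_of_total total_expVec fun f => eq_of_total_inner total_expVec fun g => ?_
      rw [ContinuousLinearMap.adjoint_inner_right, h1]
    intro x y
    rw [← ContinuousLinearMap.adjoint_inner_right, h2]
  have h : (S A).comp (timeProj S) = (timeProj S).comp (S A) := by
    refine clm_eq_of_total total_expVec fun f => eq_of_total_inner total_expVec fun g => ?_
    rw [ContinuousLinearMap.comp_apply, ContinuousLinearMap.comp_apply, ← hsym,
      ← hS.spectral.inner_left hA, ← hS.spectral.inner_left hA, timeProj_expVec hS,
      timeProj_expVec hS, inner_apply_sint_one_expVec hS g f hA, hS.spectral.inner_left hA, ← hc,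
      inner_apply_sint_one_expVec hS f g hA, ← stopMeasure_conj hS.spectral _ _ hA]
  exact congrArg (fun K : FockHalf k →L[ℂ] FockHalf k => K x) h

theorem stopMeasure_zero_univ (hS : IsSpectralMeasure S) :
    stopMeasure S (0 : L2Half k) 0 univ = 1 := by
  rw [stopMeasure_apply]
  simp only [map_zero, inner_zero_left, neg_zero, Complex.exp_zero]
  rw [cint_const, coeffMeasure_apply hS _ _ MeasurableSet.univ, hS.univ,
    one_mul, one_apply_eq_self, inner_expVec, inner_zero_left, Complex.exp_zero]

theorem inner_sint_zero_const (hS : IsFiniteQuantumStopTime S) (x y : FockHalf k) :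
    ⟪sint S 0 fun _ => x, sint S 0 fun _ => y⟫_ℂ = ⟪x, y⟫_ℂ := by
  have := inner_apply_sint_const hS 0 0 x y MeasurableSet.univ
  rwa [hS.spectral.univ, stopMeasure_zero_univ hS.spectral, one_mul] at this

theorem exists_stopShift (hS : IsFiniteQuantumStopTime S) :
    ∃ B : FockHalf k →L[ℂ] FockHalf k, ∀ x : FockHalf k,
      HasRiemannStopIntegral S ⊤ 0 (fun s => Gam k s x) (B x) := by
  obtain ⟨U, hU⟩ := exists_isometry_of_gram (E := FockHalf k) (F := FockHalf k)
    -- The whole space serves as the total family; `S^{0,0}` has mass `1`, so inner products are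
    -- preserved.
    (a := fun x : FockHalf k => x) (b := fun x => sint S 0 fun _ => x)
    (total_expVec.of_closure fun f => subset_closure (Submodule.subset_span ⟨_, rfl⟩))
    (inner_sint_zero_const hS)
  refine ⟨U.toContinuousLinearMap, fun x => (hasRiemannStopIntegral_Gam_iff hS 0 x _ ⊤).2 ?_⟩
  rw [Iic_top, hS.spectral.univ]
  exact hU x

theorem stopShift_apply (hS : IsFiniteQuantumStopTime S) (x : FockHalf k) :
    stopShift S x = sint S 0 fun _ => x := by
  have h := exists_stopShift hS
  rw [stopShift, dif_pos h]
  have := (hasRiemannStopIntegral_Gam_iff hS 0 x _ ⊤).1 (h.choose_spec x)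
  rwa [Iic_top, hS.spectral.univ] at this

theorem inner_stopShift (hS : IsFiniteQuantumStopTime S) (x y : FockHalf k) :
    ⟪stopShift S x, stopShift S y⟫_ℂ = ⟪x, y⟫_ℂ := by
  rw [stopShift_apply hS, stopShift_apply hS, inner_sint_zero_const hS]

end TimeProj

/-! ### The strong Markov isomorphism -/

section Tensor

variable {ι κ E P Q H : Type*} [NormedAddCommGroup E] [InnerProductSpace ℂ E]
  [NormedAddCommGroup P] [InnerProductSpace ℂ P] [NormedAddCommGroup Q] [InnerProductSpace ℂ Q]
  [NormedAddCommGroup H] [InnerProductSpace ℂ H]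

theorem exists_tensor_unitary [CompleteSpace H] {e : κ → E} (he : Total e) {K : E →L[ℂ] P}
    {L : E →L[ℂ] Q} (hK : Function.Surjective K) (hL : Function.Surjective L) {z x : ι → E}
    (hzx : ∀ i j, ∃ n, z n = e i ∧ x n = e j) {c : ι → H} (hc : Total c)
    (h : ∀ m n, ⟪c m, c n⟫_ℂ = ⟪K (z m), K (z n)⟫_ℂ * ⟪L (x m), L (x n)⟫_ℂ) :
    ∃ j : HilbertTensor P Q ≃ₗᵢ[ℂ] H, ∀ n, j (elem (K (z n)) (L (x n))) = c n := by
  refine exists_unitary_of_gram ?_ hc fun m n => by rw [h, inner_elem]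
  refine (total_elem (he.image K hK.denseRange) (he.image L hL.denseRange)).of_closure
    fun p => subset_closure (Submodule.subset_span ?_)
  obtain ⟨n, h1, h2⟩ := hzx p.1 p.2
  exact ⟨n, by simp only [h1, h2]⟩

/-- Properties of a map from a tensor product which is chosen as a unitary with property `p`. -/
theorem tensor_unitary_choice {e : κ → E} (he : Total e) {K : E →L[ℂ] P} {L : E →L[ℂ] Q}
    (hK : Function.Surjective K) (hL : Function.Surjective L) {z x : ι → E} {c : ι → H}
    {p : (HilbertTensor P Q ≃ₗᵢ[ℂ] H) → Prop} (h : ∃ j, p j)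
    (hp : ∀ j, p j → ∀ n, j (elem (K (z n)) (L (x n))) = c n) {J : HilbertTensor P Q →L[ℂ] H}
    (hJ : J = (h.choose.toContinuousLinearEquiv : HilbertTensor P Q →L[ℂ] H)) :
    (∀ a a' b b', ⟪J (elem a b), J (elem a' b')⟫_ℂ = ⟪a, a'⟫_ℂ * ⟪b, b'⟫_ℂ) ∧
    (Total fun p : κ × κ => J (elem (K (e p.1)) (L (e p.2)))) ∧
    (∀ b, ∃ Φ : E →L[ℂ] H, ∀ z, Φ z = J (elem (K z) b)) ∧
    ∀ n, J (elem (K (z n)) (L (x n))) = c n := by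
  have hJ' : ∀ w, J w = h.choose w := fun w => by rw [hJ]; rfl
  refine ⟨fun a a' b b' => ?_, ?_, fun b => ?_, fun n => ?_⟩
  · rw [hJ', hJ', LinearIsometryEquiv.inner_map_map, inner_elem]
  · refine (total_elem (he.image K hK.denseRange) (he.image L hL.denseRange)).image J ?_
    rw [show (J : HilbertTensor P Q → H) = h.choose from funext hJ']
    exact h.choose.surjective.denseRange
  · exact ⟨J.comp (((elemL P Q).flip b).comp K), fun _ => rfl⟩
  · rw [hJ', hp _ h.choose_spec]

end Tensor

/-! ### Pre-stop and post-stop factors -/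

section StrongMarkov

variable {k : Type u} [NormedAddCommGroup k] [InnerProductSpace ℂ k]
  {S : Set ℝ≥0∞ → (FockHalf k →L[ℂ] FockHalf k)} {A : Set ℝ≥0∞}

variable (S) in
/-- `x ↦ E_S x` as a bounded operator onto the pre-`S` space. -/
def toPreL : FockHalf k →L[ℂ] preSpace S :=
  (timeProj S).codRestrict (preSpace S) fun x => ⟨x, rfl⟩

variable (S) in
/-- `x ↦ Γ_S x` as a bounded operator onto the post-`S` space. -/
def toPostL : FockHalf k →L[ℂ] postSpace S :=
  (stopShift S).codRestrict (postSpace S) fun x => ⟨x, rfl⟩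

theorem toPreL_surjective : Function.Surjective (toPreL S) := by
  rintro ⟨_, x, rfl⟩
  exact ⟨x, rfl⟩

theorem toPostL_surjective : Function.Surjective (toPostL S) := by
  rintro ⟨_, x, rfl⟩
  exact ⟨x, rfl⟩

theorem inner_toPost (hS : IsFiniteQuantumStopTime S) (x y : FockHalf k) :
    ⟪toPostL S x, toPostL S y⟫_ℂ = ⟪x, y⟫_ℂ := inner_stopShift hS x y

theorem inner_toPre (z w : FockHalf k) :
    ⟪toPreL S z, toPreL S w⟫_ℂ = ⟪timeProj S z, timeProj S w⟫_ℂ := rfl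

/-- Both Gram matrices have entries `S^{g,f}(A ∩ B) ⟪y, x⟫`. Indexing by Borel sets `A` covers the
vectors `E_{S,t} ε(f) = E_S S([0, t]) ε(f)` of the defining property. -/
theorem exists_jIso (hS : IsFiniteQuantumStopTime S) :
    ∃ j : HilbertTensor (preSpace S) (postSpace S) ≃ₗᵢ[ℂ] FockHalf k,
      ∀ n : {A : Set ℝ≥0∞ // MeasurableSet A} × L2Half k × FockHalf k,
        j (elem (toPreL S (S n.1 (expVec n.2.1))) (toPostL S n.2.2)) =
          S n.1 (sint S n.2.1 fun _ => n.2.2) := by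
  refine exists_tensor_unitary total_expVec toPreL_surjective toPostL_surjective
    (z := fun n : {A : Set ℝ≥0∞ // MeasurableSet A} × L2Half k × FockHalf k =>
      S n.1 (expVec n.2.1)) (x := fun n => n.2.2) (fun g f => ?_) (total_apply_sint S hS) ?_
  · refine ⟨(⟨univ, MeasurableSet.univ⟩, g, expVec f), ?_, rfl⟩
    simp only [hS.spectral.univ, one_apply_eq_self]
  · rintro ⟨⟨A, hA⟩, g, y⟩ ⟨⟨B, hB⟩, f, x⟩
    simp only
    rw [inner_toPost hS, inner_toPre, ← apply_timeProj hS hA, ← apply_timeProj hS hB,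
      timeProj_expVec hS, timeProj_expVec hS, ← hS.spectral.inner_left hB,
      ← hS.spectral.inner_left hB, hS.spectral.inter hB hA, hS.spectral.inter hB hA,
      inner_apply_sint_one hS _ _ (hB.inter hA), inner_apply_sint_const hS _ _ _ _ (hB.inter hA)]

theorem HasRiemannStopIntegral.eq_sint (hS : IsFiniteQuantumStopTime S) {f : L2Half k}
    {x v : FockHalf k} (h : HasRiemannStopIntegral S ⊤ f (fun s => Gam k s x) v) :
    v = sint S f fun _ => x := by
  have h1 := (hasRiemannStopIntegral_Gam_iff hS f x v ⊤).1 h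
  rwa [Iic_top, hS.spectral.univ] at h1

theorem eq_toPreL (hS : IsFiniteQuantumStopTime S) {t : ℝ≥0∞} {f : L2Half k} {a : preSpace S}
    (ha : (a : FockHalf k) = timeProjUpTo S t (expVec f)) :
    a = toPreL S (S (Iic t) (expVec f)) := by
  refine Subtype.ext ?_
  rw [ha, timeProjUpTo_expVec hS, ← timeProj_expVec hS, apply_timeProj hS measurableSet_Iic]
  rfl

theorem exists_jIso_hasRiemannStopIntegral (hS : IsFiniteQuantumStopTime S) :
    ∃ j : HilbertTensor (preSpace S) (postSpace S) ≃ₗᵢ[ℂ] FockHalf k,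
      ∀ (t : ℝ≥0∞) (f : L2Half k) (x : FockHalf k) (a : preSpace S), 0 < t →
        (a : FockHalf k) = timeProjUpTo S t (expVec f) →
        HasRiemannStopIntegral S t f (fun s => Gam k s x) (j (elem a (toPost S x))) :=
  (exists_jIso hS).imp fun j hj t f x _ _ ha => (hasRiemannStopIntegral_Gam_iff hS f x _ t).2
    ((congrArg (fun a => j (elem a (toPost S x))) (eq_toPreL hS ha)).trans
      (hj (⟨Iic t, measurableSet_Iic⟩, f, x)))

/-- These hold for whichever unitary is chosen; the defining property is needed only at `t = ∞`. -/
theorem jIso_facts (hS : IsFiniteQuantumStopTime S) :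
    (∀ (a a' : preSpace S) (b b' : postSpace S),
      ⟪jIso S (elem a b), jIso S (elem a' b')⟫_ℂ = ⟪a, a'⟫_ℂ * ⟪b, b'⟫_ℂ) ∧
    (Total fun p : L2Half k × L2Half k =>
      jIso S (elem (toPreL S (expVec p.1)) (toPostL S (expVec p.2)))) ∧
    (∀ b : postSpace S, ∃ Φ : FockHalf k →L[ℂ] FockHalf k,
      ∀ z, Φ z = jIso S (elem (toPreL S z) b)) ∧
    ∀ n : L2Half k × FockHalf k, jIso S (elem (toPreL S (expVec n.1)) (toPostL S n.2)) =
      sint S n.1 fun _ => n.2 :=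
  tensor_unitary_choice (z := fun n : L2Half k × FockHalf k => expVec n.1)
    (x := fun n : L2Half k × FockHalf k => n.2) total_expVec toPreL_surjective toPostL_surjective
    (exists_jIso_hasRiemannStopIntegral hS)
    (fun _ hj n => HasRiemannStopIntegral.eq_sint hS
      (hj ⊤ n.1 n.2 (toPreL S (expVec n.1)) ENNReal.zero_lt_top rfl))
    (dif_pos (exists_jIso_hasRiemannStopIntegral hS))

variable (S) in
/-- The vector `j_S(E_S z ⊗ Γ_S x)`. -/
def stopElem (z x : FockHalf k) : FockHalf k := jIso S (elem (toPre S z) (toPost S x))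

theorem inner_stopElem (hS : IsFiniteQuantumStopTime S) (z w x y : FockHalf k) :
    ⟪stopElem S z x, stopElem S w y⟫_ℂ = ⟪timeProj S z, timeProj S w⟫_ℂ * ⟪x, y⟫_ℂ :=
  ((jIso_facts hS).1 _ _ _ _).trans (congrArg (_ * ·) (inner_stopShift hS x y))

theorem total_stopElem (hS : IsFiniteQuantumStopTime S) :
    Total fun p : L2Half k × L2Half k => stopElem S (expVec p.1) (expVec p.2) := (jIso_facts hS).2.1

theorem exists_clm_stopElem (hS : IsFiniteQuantumStopTime S) (x : FockHalf k) :
    ∃ Φ : FockHalf k →L[ℂ] FockHalf k, ∀ z, Φ z = stopElem S z x :=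
  (jIso_facts hS).2.2.1 _

theorem stopElem_expVec (hS : IsFiniteQuantumStopTime S) (f : L2Half k) (x : FockHalf k) :
    stopElem S (expVec f) x = sint S f fun _ => x :=
  (jIso_facts hS).2.2.2 (f, x)

theorem apply_stopElem (hS : IsFiniteQuantumStopTime S) (hA : MeasurableSet A) (z x : FockHalf k) :
    S A (stopElem S z x) = stopElem S (S A z) x := by
  obtain ⟨Φ, hΦ⟩ := exists_clm_stopElem hS x
  have h : (S A).comp Φ = Φ.comp (S A) := by
    refine clm_eq_of_total total_expVec fun f => eq_of_total_inner (total_stopElem hS) fun p => ?_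
    rw [ContinuousLinearMap.comp_apply, ContinuousLinearMap.comp_apply, hΦ, hΦ, inner_stopElem hS,
      ← hS.spectral.inner_left hA, stopElem_expVec hS,
      stopElem_expVec hS, inner_apply_sint_const hS _ _ _ _ hA, ← apply_timeProj hS hA,
      ← hS.spectral.inner_left hA, timeProj_expVec hS, timeProj_expVec hS,
      inner_apply_sint_one hS _ _ hA]
  rw [← hΦ, ← hΦ]
  exact congrArg (fun K : FockHalf k →L[ℂ] FockHalf k => K z) h

theorem exists_clm_sint_const (hS : IsFiniteQuantumStopTime S) (x : FockHalf k) :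
    ∃ Φ : FockHalf k →L[ℂ] FockHalf k, ∀ f : L2Half k, Φ (expVec f) = sint S f fun _ => x := by
  obtain ⟨Φ, hΦ⟩ := exists_clm_stopElem hS x
  exact ⟨Φ, fun f => by rw [hΦ, stopElem_expVec hS]⟩

end StrongMarkov

/-! ### Additivity and variation of spectral measures -/

section SpectralAdditivity

variable {X E ι : Type*} [MeasurableSpace X] [NormedAddCommGroup E] [InnerProductSpace ℂ E]
  [CompleteSpace E] {R : Set X → (E →L[ℂ] E)}

theorem inner_left_of_proj {K : E →L[ℂ] E} (hK : IsStarProjection K) (x y : E) :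
    ⟪K x, y⟫_ℂ = ⟪x, K y⟫_ℂ :=
  (ContinuousLinearMap.isSelfAdjoint_iff_isSymmetric.1 hK.isSelfAdjoint) x y

theorem inner_apply_apply_of_proj {K : E →L[ℂ] E} (hK : IsStarProjection K) (x y : E) :
    ⟪K x, K y⟫_ℂ = ⟪x, K y⟫_ℂ := by
  rw [inner_left_of_proj hK]
  exact congrArg (fun K : E →L[ℂ] E => ⟪x, K y⟫_ℂ) hK.isIdempotentElem

theorem norm_apply_le_of_proj {K : E →L[ℂ] E} (hK : IsStarProjection K) (x : E) :
    ‖K x‖ ≤ ‖x‖ := by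
  have h : ‖K x‖ * ‖K x‖ ≤ ‖x‖ * ‖K x‖ := by
    rw [← @inner_self_eq_norm_mul_norm ℂ, inner_apply_apply_of_proj hK]
    exact re_inner_le_norm _ _
  by_contra h'
  push Not at h'
  nlinarith [norm_nonneg x]

theorem apply_empty_of_union (hu : ∀ A B, MeasurableSet A → MeasurableSet B → Disjoint A B →
    R (A ∪ B) = R A + R B) : R ∅ = 0 := by
  have := hu ∅ ∅ MeasurableSet.empty MeasurableSet.empty (disjoint_empty _)
  rwa [union_self, left_eq_add] at this

theorem apply_biUnion_of_union (hu : ∀ A B, MeasurableSet A → MeasurableSet B → Disjoint A B →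
    R (A ∪ B) = R A + R B) {A : ι → Set X} (s : Finset ι) (hA : ∀ i ∈ s, MeasurableSet (A i))
    (hd : (s : Set ι).PairwiseDisjoint A) : R (⋃ i ∈ s, A i) = ∑ i ∈ s, R (A i) := by
  classical
  induction s using Finset.induction_on with
  | empty => simpa using apply_empty_of_union hu
  | insert a s ha ih =>
    rw [Finset.set_biUnion_insert, Finset.sum_insert ha, hu _ _
      (hA a (Finset.mem_insert_self _ _))
      (s.measurableSet_biUnion fun i hi => hA i (Finset.mem_insert_of_mem hi)),
      ih (fun i hi => hA i (Finset.mem_insert_of_mem hi))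
        (hd.subset (by simp))]
    rw [disjoint_iUnion₂_right]
    intro i hi
    exact hd (by simp) (by simp [hi]) (fun h => ha (h ▸ hi))

theorem sum_norm_sq_le (hp : ∀ A, MeasurableSet A → IsStarProjection (R A))
    (hu : ∀ A B, MeasurableSet A → MeasurableSet B → Disjoint A B → R (A ∪ B) = R A + R B)
    {A : ι → Set X} (s : Finset ι) (hA : ∀ i ∈ s, MeasurableSet (A i))
    (hd : (s : Set ι).PairwiseDisjoint A) (x : E) : ∑ i ∈ s, ‖R (A i) x‖ ^ 2 ≤ ‖x‖ ^ 2 := by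
  have h1 : ∑ i ∈ s, ‖R (A i) x‖ ^ 2 = RCLike.re ⟪x, R (⋃ i ∈ s, A i) x⟫_ℂ := by
    rw [apply_biUnion_of_union hu s hA hd, _root_.sum_apply, inner_sum, map_sum]
    refine Finset.sum_congr rfl fun i hi => ?_
    rw [← inner_apply_apply_of_proj (hp _ (hA i hi)), ← @inner_self_eq_norm_sq ℂ]
  rw [h1, sq]
  refine (re_inner_le_norm _ _).trans ?_
  gcongr
  exact norm_apply_le_of_proj (hp _ (s.measurableSet_biUnion hA)) x

/-- Cauchy–Schwarz applied to two Bessel inequalities. It bounds the variation of coefficient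
measures by `‖x‖ ‖y‖`. -/
theorem sum_norm_inner_le (hp : ∀ A, MeasurableSet A → IsStarProjection (R A))
    (hu : ∀ A B, MeasurableSet A → MeasurableSet B → Disjoint A B → R (A ∪ B) = R A + R B)
    {A : ι → Set X} (s : Finset ι) (hA : ∀ i ∈ s, MeasurableSet (A i))
    (hd : (s : Set ι).PairwiseDisjoint A) (x y : E) :
    ∑ i ∈ s, ‖⟪x, R (A i) y⟫_ℂ‖ ≤ ‖x‖ * ‖y‖ := by
  have h1 : ∑ i ∈ s, ‖⟪x, R (A i) y⟫_ℂ‖ ≤ ∑ i ∈ s, ‖R (A i) x‖ * ‖R (A i) y‖ := by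
    refine Finset.sum_le_sum fun i hi => ?_
    rw [← inner_apply_apply_of_proj (hp _ (hA i hi))]
    exact norm_inner_le_norm _ _
  refine h1.trans ((Real.sum_mul_le_sqrt_mul_sqrt _ _ _).trans ?_)
  gcongr
  · exact Real.sqrt_le_iff.2 ⟨norm_nonneg _, sum_norm_sq_le hp hu s hA hd x⟩
  · exact Real.sqrt_le_iff.2 ⟨norm_nonneg _, sum_norm_sq_le hp hu s hA hd y⟩

/-- A strongly σ-additive family of projections is a spectral measure. -/
theorem IsSpectralMeasure.of_tendsto (hp : ∀ A, MeasurableSet A → IsStarProjection (R A))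
    (h1 : R Set.univ = 1)
    (hu : ∀ A B, MeasurableSet A → MeasurableSet B → Disjoint A B → R (A ∪ B) = R A + R B)
    (ht : ∀ A : ℕ → Set X, (∀ n, MeasurableSet (A n)) → Pairwise (Function.onFun Disjoint A) →
      ∀ y, Tendsto (fun n => ∑ i ∈ Finset.range n, R (A i) y) atTop (𝓝 (R (⋃ n, A n) y))) :
    IsSpectralMeasure R := by
  classical
  refine ⟨hp, fun x y => ?_, h1⟩
  refine ⟨⟨fun A => if MeasurableSet A then ⟪x, R A y⟫_ℂ else 0, ?_, fun A hA => if_neg hA,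
    fun A hA hd => ?_⟩, fun A hA => if_pos hA⟩
  · simp [apply_empty_of_union hu]
  · simp only [hA, MeasurableSet.iUnion hA, if_true]
    have hs : Summable fun n => ⟪x, R (A n) y⟫_ℂ := by
      refine Summable.of_norm (summable_of_sum_le (fun _ => norm_nonneg _) fun s =>
        sum_norm_inner_le hp hu s (fun i _ => hA i) (fun i _ j _ hij => hd hij) x y)
    refine hs.hasSum_iff_tendsto_nat.2 ?_
    have := (tendsto_const_nhds (x := x)).inner (𝕜 := ℂ) (ht A hA hd y)
    simpa only [inner_sum] using this

theorem IsSpectralMeasure.union' (hR : IsSpectralMeasure R) : ∀ A B, MeasurableSet A →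
    MeasurableSet B → Disjoint A B → R (A ∪ B) = R A + R B := fun _ _ => hR.union

/-- Weak σ-additivity is strong: the error is a projection applied to `x`, so its squared norm is an
inner product that tends to zero. -/
theorem IsSpectralMeasure.tendsto_sum (hR : IsSpectralMeasure R) {A : ℕ → Set X}
    (hA : ∀ n, MeasurableSet (A n)) (hd : Pairwise (Function.onFun Disjoint A)) (x : E) :
    Tendsto (fun n => ∑ i ∈ Finset.range n, R (A i) x) atTop (𝓝 (R (⋃ n, A n) x)) := by
  have hB : ∀ n, MeasurableSet (⋃ i ∈ Finset.range n, A i) := fun n =>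
    (Finset.range n).measurableSet_biUnion fun i _ => hA i
  have e : ∀ n, ∑ i ∈ Finset.range n, R (A i) x = R (⋃ i ∈ Finset.range n, A i) x := by
    intro n
    rw [apply_biUnion_of_union hR.union' _ (fun i _ => hA i) fun i _ j _ hij => hd hij,
      _root_.sum_apply]
  have hA' : MeasurableSet (⋃ n, A n) := MeasurableSet.iUnion hA
  rw [tendsto_iff_norm_sub_tendsto_zero]
  have e2 : ∀ n, ‖∑ i ∈ Finset.range n, R (A i) x - R (⋃ n, A n) x‖ =
      Real.sqrt (RCLike.re (⟪x, R (⋃ n, A n) x⟫_ℂ - ∑ i ∈ Finset.range n, ⟪x, R (A i) x⟫_ℂ)) := by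
    intro n
    have hsub : (⋃ i ∈ Finset.range n, A i) ⊆ ⋃ n, A n := iUnion₂_subset fun i _ =>
      subset_iUnion A i
    have h1 : R (⋃ n, A n) = R (⋃ i ∈ Finset.range n, A i) +
        R ((⋃ n, A n) \ ⋃ i ∈ Finset.range n, A i) := by
      rw [← hR.union (hB n) (hA'.diff (hB n)) disjoint_sdiff_right, union_sdiff_cancel hsub]
    rw [← inner_sum, e, norm_sub_rev, h1, add_apply, add_sub_cancel_left, inner_add_right,
      add_sub_cancel_left, ← hR.inner_apply_apply (hA'.diff (hB n))]
    exact @norm_eq_sqrt_re_inner ℂ _ _ _ _ _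
  simp_rw [e2]
  have h3 := ((hR.tendsto_iUnion hA hd x x).tendsto_sum_nat).const_sub ⟪x, R (⋃ n, A n) x⟫_ℂ
  rw [sub_self] at h3
  have h4 := (Real.continuous_sqrt.tendsto _).comp ((Complex.continuous_re.tendsto _).comp h3)
  rw [Complex.zero_re, Real.sqrt_zero] at h4
  exact h4

theorem norm_cint_le (hR : IsSpectralMeasure R) {x y : E} {m : ComplexMeasure X}
    (hm : ∀ A, MeasurableSet A → m A = ⟪x, R A y⟫_ℂ) {φ : X → ℂ} {C : ℝ} (h0 : 0 ≤ C)
    (hC : ∀ s, ‖φ s‖ ≤ C) (A : Set X) :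
    ‖cint m A φ‖ ≤ C * (‖x‖ * ‖y‖) := by
  have h1 : m.variation univ ≤ ENNReal.ofReal (‖x‖ * ‖y‖) := by
    by_contra! h
    obtain ⟨P, -, hPd, hPm, hP⟩ := VectorMeasure.exists_lt_sum_of_lt_variation m MeasurableSet.univ h
    refine hP.not_ge ?_
    have h2 := sum_norm_inner_le hR.proj hR.union' (A := id) P hPm hPd x y
    calc ∑ p ∈ P, ‖m p‖ₑ = ∑ p ∈ P, ENNReal.ofReal ‖⟪x, R p y⟫_ℂ‖ :=
          Finset.sum_congr rfl fun p hp => by rw [hm p (hPm p hp), ofReal_norm]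
      _ = ENNReal.ofReal (∑ p ∈ P, ‖⟪x, R p y⟫_ℂ‖) :=
          (ENNReal.ofReal_sum_of_nonneg fun _ _ => norm_nonneg _).symm
      _ ≤ _ := ENNReal.ofReal_le_ofReal h2
  have h2 := VectorMeasure.norm_integral_le_of_norm_le_const (μ := m.restrict A)
    (B := ContinuousLinearMap.mul ℝ ℂ) (f := φ) (C := C) (Eventually.of_forall hC)
  have h3 : (m.restrict A).variation.real univ ≤ ‖x‖ * ‖y‖ := by
    refine ENNReal.toReal_le_of_le_ofReal (by positivity) (le_trans ?_ h1)
    refine (VectorMeasure.variation_restrict_le univ).trans ?_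
    rw [Measure.restrict_apply MeasurableSet.univ]
    exact measure_mono (subset_univ _)
  have h4 : ‖ContinuousLinearMap.mul ℝ ℂ‖ ≤ 1 := ContinuousLinearMap.opNorm_mul_le ℝ ℂ
  calc ‖cint m A φ‖ ≤ C * ‖ContinuousLinearMap.mul ℝ ℂ‖ * (m.restrict A).variation.real univ := h2
    _ ≤ C * 1 * (‖x‖ * ‖y‖) := by gcongr
    _ = _ := by rw [mul_one]

end SpectralAdditivity

/-! ### The spectral measure `S ⊗ T` -/

section StopTensor

variable {k : Type u} [NormedAddCommGroup k] [InnerProductSpace ℂ k]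
  {S T : Set ℝ≥0∞ → (FockHalf k →L[ℂ] FockHalf k)} {f g : L2Half k}
  {x y : ℝ≥0∞ → FockHalf k} {M : Set (ℝ≥0∞ × ℝ≥0∞)}

theorem bddMeas_section (hT : IsSpectralMeasure T) (hM : MeasurableSet M) (hx : BddMeas x) :
    BddMeas fun s => T (Prod.mk s ⁻¹' M) (x s) := by
  have hC : ∀ M : Set (ℝ≥0∞ × ℝ≥0∞), MeasurableSet M → ∀ s, ‖T (Prod.mk s ⁻¹' M) (x s)‖ ≤ ‖x s‖ :=
    fun M hM s => hT.norm_apply_le (measurable_prodMk_left hM) _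
  refine ⟨?_, hx.2.imp fun C h s => (hC M hM s).trans (h s)⟩
  induction M, hM using MeasurableSpace.induction_on_inter generateFrom_prod.symm
    isPiSystem_prod with
  | empty =>
    simp only [preimage_empty, hT.empty]
    exact stronglyMeasurable_const
  | basic M hM =>
    obtain ⟨A, hA, B, hB, rfl⟩ := hM
    have : (fun s => T (Prod.mk s ⁻¹' A ×ˢ B) (x s)) = A.indicator fun s => T B (x s) := by
      classical
      ext1 s
      by_cases hs : s ∈ A
      · rw [mk_preimage_prod_right hs, indicator_of_mem hs]
      · rw [mk_preimage_prod_right_eq_empty hs, indicator_of_notMem hs, hT.empty]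
        rfl
    rw [this]
    exact ((T B).continuous.comp_stronglyMeasurable hx.1).indicator hA
  | compl M hM ih =>
    have : (fun s => T (Prod.mk s ⁻¹' Mᶜ) (x s)) =
        fun s => x s - T (Prod.mk s ⁻¹' M) (x s) := by
      ext1 s
      rw [preimage_compl, hT.compl (measurable_prodMk_left hM), sub_apply, one_apply_eq_self]
    rw [this]
    exact hx.1.sub ih
  | iUnion M hd hM ih =>
    refine stronglyMeasurable_of_tendsto atTop
      (f := fun n s => ∑ i ∈ Finset.range n, T (Prod.mk s ⁻¹' M i) (x s)) (fun n => ?_)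
      (tendsto_pi_nhds.2 fun s => ?_)
    · exact Finset.stronglyMeasurable_fun_sum _ fun i _ => ih i
    · rw [preimage_iUnion]
      exact hT.tendsto_sum (fun n => measurable_prodMk_left (hM n))
        (fun i j hij => (hd hij).preimage _) _

/-- The fibrewise reflection `x(s) - 2 T(M_s) x(s)` preserves the pointwise inner products and hence
the Gram matrix, so it defines an isometry `U`. The projection is then `(1 - U) / 2`. -/
theorem exists_sectionProj (hS : IsFiniteQuantumStopTime S) (hT : IsSpectralMeasure T)
    (hM : MeasurableSet M) :
    ∃ P : FockHalf k →L[ℂ] FockHalf k, ∀ (f : L2Half k) (x : ℝ≥0∞ → FockHalf k), BddMeas x →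
      P (sint S f x) = sint S f fun s => T (Prod.mk s ⁻¹' M) (x s) := by
  have hb : ∀ x : {x : ℝ≥0∞ → FockHalf k // BddMeas x},
      BddMeas fun s => x.1 s - (2 : ℂ) • T (Prod.mk s ⁻¹' M) (x.1 s) :=
    fun x => x.2.sub ((bddMeas_section hT hM x.2).smul 2)
  obtain ⟨U, hU⟩ := exists_isometry_of_gram (E := FockHalf k) (F := FockHalf k) (total_sint hS)
    (b := fun p : L2Half k × {x : ℝ≥0∞ → FockHalf k // BddMeas x} =>
      sint S p.1 fun s => p.2.1 s - (2 : ℂ) • T (Prod.mk s ⁻¹' M) (p.2.1 s)) (fun p q => by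
      rw [inner_sint hS _ _ (hb _) (hb _), inner_sint hS _ _ p.2.2 q.2.2]
      refine cint_congr_fun fun s _ => ?_
      have hm : MeasurableSet (Prod.mk s ⁻¹' M) := measurable_prodMk_left hM
      have h1 := hT.inner_left hm (p.2.1 s) (q.2.1 s)
      have h2 := hT.inner_apply_apply hm (p.2.1 s) (q.2.1 s)
      rw [inner_sub_left, inner_sub_right, inner_sub_right, two_smul, two_smul, inner_add_left,
        inner_add_left, inner_add_right, inner_add_right, h1, h2]
      ring)
  refine ⟨(2 : ℂ)⁻¹ • (1 - U.toContinuousLinearMap), fun f x hx => ?_⟩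
  have h1 : U (sint S f x) = sint S f x - (2 : ℂ) • sint S f fun s => T (Prod.mk s ⁻¹' M) (x s) := by
    rw [← sint_smul hS f (bddMeas_section hT hM hx),
      ← sint_sub hS f hx ((bddMeas_section hT hM hx).smul 2)]
    exact hU (f, ⟨x, hx⟩)
  change (2 : ℂ)⁻¹ • (sint S f x - U (sint S f x)) = _
  rw [h1, sub_sub_cancel, smul_smul, inv_mul_cancel₀ two_ne_zero, one_smul]

variable (S T) in
open Classical in
/-- The operator `∫ S(ds) ε(f|_{[0,s)}) ⊗ Γ_s x(s) ↦ ∫ S(ds) ε(f|_{[0,s)}) ⊗ Γ_s T(M_s) x(s)`, where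
`M_s` is the section of `M` at `s`. -/
def sectionProj (M : Set (ℝ≥0∞ × ℝ≥0∞)) : FockHalf k →L[ℂ] FockHalf k :=
  if h : ∃ P : FockHalf k →L[ℂ] FockHalf k, ∀ (f : L2Half k) (x : ℝ≥0∞ → FockHalf k), BddMeas x →
      P (sint S f x) = sint S f fun s => T (Prod.mk s ⁻¹' M) (x s) then h.choose else 0

theorem sectionProj_sint (hS : IsFiniteQuantumStopTime S) (hT : IsSpectralMeasure T)
    (hM : MeasurableSet M) (f : L2Half k) (hx : BddMeas x) :
    sectionProj S T M (sint S f x) = sint S f fun s => T (Prod.mk s ⁻¹' M) (x s) := by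
  have h := exists_sectionProj hS hT hM
  rw [sectionProj, dif_pos h]
  exact h.choose_spec f x hx

theorem isStarProjection_sectionProj (hS : IsFiniteQuantumStopTime S) (hT : IsSpectralMeasure T)
    (hM : MeasurableSet M) : IsStarProjection (sectionProj S T M) := by
  refine ⟨?_, ?_⟩
  · refine clm_eq_of_total (total_sint hS) fun p => ?_
    change sectionProj S T M (sectionProj S T M (sint S p.1 p.2.1)) = _
    rw [sectionProj_sint hS hT hM _ p.2.2,
      sectionProj_sint hS hT hM _ (bddMeas_section hT hM p.2.2)]
    congr 1
    ext1 s
    exact hT.apply_apply (measurable_prodMk_left hM) _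
  · refine ContinuousLinearMap.isSelfAdjoint_iff'.2 ?_
    refine clm_eq_of_total (total_sint hS) fun p => eq_of_total_inner (total_sint hS) fun q => ?_
    rw [ContinuousLinearMap.adjoint_inner_right, sectionProj_sint hS hT hM _ p.2.2,
      sectionProj_sint hS hT hM _ q.2.2, inner_sint hS _ _ (bddMeas_section hT hM q.2.2) p.2.2,
      inner_sint hS _ _ q.2.2 (bddMeas_section hT hM p.2.2)]
    exact cint_congr_fun fun s _ => hT.inner_left (measurable_prodMk_left hM) _ _

theorem isSpectralMeasure_sectionProj (hS : IsFiniteQuantumStopTime S)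
    (hT : IsSpectralMeasure T) : IsSpectralMeasure (sectionProj S T) := by
  have hp : ∀ M, MeasurableSet M → IsStarProjection (sectionProj S T M) :=
    fun M hM => isStarProjection_sectionProj hS hT hM
  have hu : ∀ A B, MeasurableSet A → MeasurableSet B → Disjoint A B →
      sectionProj S T (A ∪ B) = sectionProj S T A + sectionProj S T B := by
    intro A B hA hB hd
    refine clm_eq_of_total (total_sint hS) fun p => ?_
    rw [add_apply, sectionProj_sint hS hT (hA.union hB) _ p.2.2, sectionProj_sint hS hT hA _ p.2.2,
      sectionProj_sint hS hT hB _ p.2.2,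
      ← sint_add hS _ (bddMeas_section hT hA p.2.2) (bddMeas_section hT hB p.2.2)]
    congr 1
    ext1 s
    rw [preimage_union, hT.union (measurable_prodMk_left hA) (measurable_prodMk_left hB)
      (hd.preimage _), add_apply]
  refine IsSpectralMeasure.of_tendsto hp ?_ hu fun A hA hd y => ?_
  · refine clm_eq_of_total (total_sint hS) fun p => ?_
    rw [sectionProj_sint hS hT MeasurableSet.univ _ p.2.2]
    simp only [preimage_univ, hT.univ, one_apply_eq_self]
  · have e : ∀ n y, ∑ i ∈ Finset.range n, sectionProj S T (A i) y =
        (∑ i ∈ Finset.range n, sectionProj S T (A i)) y := fun n y => by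
      rw [_root_.sum_apply]
    simp only [e]
    -- Partial sums are projections, of norm at most `1`, so it suffices to treat integrals, where
    -- `T` is σ-additive fibre by fibre.
    refine (total_sint hS).tendsto (C := 1) (fun n y => ?_) (fun p => ?_) y
    · rw [← apply_biUnion_of_union hu _ (fun i _ => hA i) fun i _ j _ hij => hd hij, one_mul]
      exact norm_apply_le_of_proj (hp _ ((Finset.range n).measurableSet_biUnion fun i _ => hA i)) y
    · simp only [← apply_biUnion_of_union hu (Finset.range _) (fun i _ => hA i)
        fun i _ j _ hij => hd hij]
      rw [sectionProj_sint hS hT (MeasurableSet.iUnion hA) _ p.2.2]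
      have hB : ∀ n, MeasurableSet (⋃ i ∈ Finset.range n, A i) := fun n =>
        (Finset.range n).measurableSet_biUnion fun i _ => hA i
      simp only [sectionProj_sint hS hT (hB _) _ p.2.2]
      obtain ⟨C, hC⟩ := p.2.2.2
      refine tendsto_sint hS _ (fun n => bddMeas_section hT (hB n) p.2.2) (C := C)
        (fun n s => (hT.norm_apply_le (measurable_prodMk_left (hB n)) _).trans (hC s)) fun s => ?_
      have h1 := hT.tendsto_sum (A := fun i => Prod.mk s ⁻¹' A i)
        (fun n => measurable_prodMk_left (hA n)) (fun i j hij => (hd hij).preimage _) (p.2.1 s)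
      rw [preimage_iUnion]
      refine h1.congr fun n => ?_
      rw [preimage_iUnion₂, apply_biUnion_of_union hT.union' _
        (fun i _ => measurable_prodMk_left (hA i))
        (fun i _ j _ hij => (hd hij).preimage _), _root_.sum_apply]

theorem sectionProj_prod (hS : IsFiniteQuantumStopTime S) (hT : IsSpectralMeasure T)
    {A B : Set ℝ≥0∞} (hA : MeasurableSet A) (hB : MeasurableSet B) (z x : FockHalf k) :
    sectionProj S T (A ×ˢ B) (stopElem S z x) = stopElem S (S A z) (T B x) := by
  obtain ⟨Φ, hΦ⟩ := exists_clm_stopElem hS x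
  obtain ⟨Ψ, hΨ⟩ := exists_clm_stopElem hS (T B x)
  have h : (sectionProj S T (A ×ˢ B)).comp Φ = Ψ.comp (S A) := by
    refine clm_eq_of_total total_expVec fun f => ?_
    rw [ContinuousLinearMap.comp_apply, ContinuousLinearMap.comp_apply, hΦ, hΨ,
      ← apply_stopElem hS hA, stopElem_expVec hS, stopElem_expVec hS,
      sectionProj_sint hS hT (hA.prod hB) f (BddMeas.const x),
      apply_sint hS f (BddMeas.const _) hA]
    congr 1
    ext1 s
    by_cases hs : s ∈ A
    · rw [mk_preimage_prod_right hs, indicator_of_mem hs]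
    · rw [mk_preimage_prod_right_eq_empty hs, indicator_of_notMem hs, hT.empty]
      rfl
  rw [← hΦ, ← hΨ]
  exact congrArg (fun K : FockHalf k →L[ℂ] FockHalf k => K z) h

theorem adjoint_stopShift (hS : IsFiniteQuantumStopTime S) (x : FockHalf k) :
    ContinuousLinearMap.adjoint (stopShift S) (stopShift S x) = x := by
  refine eq_of_total_inner total_expVec fun f => ?_
  rw [ContinuousLinearMap.adjoint_inner_right, inner_stopShift hS]

theorem isStopTensor_sectionProj (hS : IsFiniteQuantumStopTime S) (hT : IsSpectralMeasure T) :
    IsStopTensor S T (sectionProj S T) := by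
  refine ⟨isSpectralMeasure_sectionProj hS hT, fun A B hA hB a a' b ha' => ?_⟩
  have h1 : ∃ z, toPreL S z = a := toPreL_surjective a
  have h2 : ∃ x, toPostL S x = b := toPostL_surjective b
  refine h1.elim fun z hz => h2.elim fun x hx => ?_
  have h3 : a' = toPre S (S A z) := by
    refine Subtype.ext ?_
    rw [ha', ← hz]
    exact apply_timeProj hS hA z
  have h4 : ContinuousLinearMap.adjoint (stopShift S) (b : FockHalf k) = x := by
    rw [← hx]; exact adjoint_stopShift hS x
  rw [h3, h4, ← hz, ← hx]
  exact sectionProj_prod hS hT hA hB z x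

theorem IsStopTensor.apply_prod (hS : IsFiniteQuantumStopTime S)
    {R : Set (ℝ≥0∞ × ℝ≥0∞) → (FockHalf k →L[ℂ] FockHalf k)} (hR : IsStopTensor S T R)
    {A B : Set ℝ≥0∞} (hA : MeasurableSet A) (hB : MeasurableSet B) (z x : FockHalf k) :
    R (A ×ˢ B) (stopElem S z x) = stopElem S (S A z) (T B x) := by
  have h := hR.2 A B hA hB (toPre S z) (toPre S (S A z)) (toPost S x)
    (apply_timeProj hS hA z).symm
  have h4 : ContinuousLinearMap.adjoint (stopShift S) (toPost S x : FockHalf k) = x :=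
    adjoint_stopShift hS x
  rw [h4] at h
  exact h

/-- A spectral measure on the product is determined by its values on rectangles, a generating
π-system. -/
theorem stopTensor_eq (hS : IsFiniteQuantumStopTime S) (hT : IsSpectralMeasure T)
    (hM : MeasurableSet M) : stopTensor S T M = sectionProj S T M := by
  have h : ∃ R, IsStopTensor S T R := ⟨_, isStopTensor_sectionProj hS hT⟩
  rw [stopTensor, dif_pos h]
  have hR := h.choose_spec
  set R := h.choose
  have hP := isSpectralMeasure_sectionProj hS hT
  have hprod : ∀ A B, MeasurableSet A → MeasurableSet B → R (A ×ˢ B) = sectionProj S T (A ×ˢ B) :=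
    fun A B hA hB => clm_eq_of_total (total_stopElem hS) fun p => by
      rw [hR.apply_prod hS hA hB, sectionProj_prod hS hT hA hB]
  refine ContinuousLinearMap.ext fun y => ext_inner_left ℂ fun x => ?_
  obtain ⟨μ, hμ⟩ := hR.1.measure x y
  obtain ⟨ν, hν⟩ := hP.measure x y
  have h1 : μ = ν := by
    refine VectorMeasure.ext_of_generateFrom _ ?_ generateFrom_prod.symm isPiSystem_prod ?_
    · rintro _ ⟨A, hA : MeasurableSet A, B, hB : MeasurableSet B, rfl⟩
      rw [hμ _ (hA.prod hB), hν _ (hA.prod hB), hprod A B hA hB]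
    · rw [hμ _ MeasurableSet.univ, hν _ MeasurableSet.univ, hR.1.univ, hP.univ]
  have h2 := hμ M hM
  rw [h1, hν M hM] at h2
  exact h2.symm

theorem measurableSet_sum_mem {C : Set ℝ≥0∞} (hC : MeasurableSet C) :
    MeasurableSet {p : ℝ≥0∞ × ℝ≥0∞ | p.1 + p.2 ∈ C} :=
  (measurable_fst.add measurable_snd) hC

theorem measurableSet_add_mem {C : Set ℝ≥0∞} (hC : MeasurableSet C) (s : ℝ≥0∞) :
    MeasurableSet {t : ℝ≥0∞ | s + t ∈ C} := (measurable_const.add measurable_id) hC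

theorem conv_sint (hS : IsFiniteQuantumStopTime S) (hT : IsSpectralMeasure T) {C : Set ℝ≥0∞}
    (hC : MeasurableSet C) (f : L2Half k) (hx : BddMeas x) :
    conv S T C (sint S f x) = sint S f fun s => T {t | s + t ∈ C} (x s) := by
  rw [conv, stopTensor_eq hS hT (measurableSet_sum_mem hC),
    sectionProj_sint hS hT (measurableSet_sum_mem hC) f hx]
  rfl

theorem bddMeas_apply_add_mem (hT : IsSpectralMeasure T) {C : Set ℝ≥0∞} (hC : MeasurableSet C)
    (hx : BddMeas x) : BddMeas fun s => T {t | s + t ∈ C} (x s) :=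
  bddMeas_section hT (measurableSet_sum_mem hC) hx

theorem isSpectralMeasure_conv (hS : IsFiniteQuantumStopTime S) (hT : IsSpectralMeasure T) :
    IsSpectralMeasure (conv S T) := by
  have hP := isSpectralMeasure_sectionProj hS hT
  have e : ∀ C, MeasurableSet C →
      conv S T C = sectionProj S T {p : ℝ≥0∞ × ℝ≥0∞ | p.1 + p.2 ∈ C} :=
    fun C hC => stopTensor_eq hS hT (measurableSet_sum_mem hC)
  refine ⟨fun A hA => ?_, fun x y => ?_, ?_⟩
  · rw [e A hA]
    exact hP.proj _ (measurableSet_sum_mem hA)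
  · obtain ⟨μ, hμ⟩ := hP.measure x y
    refine ⟨μ.map fun p => p.1 + p.2, fun A hA => ?_⟩
    have hm : Measurable fun p : ℝ≥0∞ × ℝ≥0∞ => p.1 + p.2 := measurable_fst.add measurable_snd
    rw [VectorMeasure.map_apply _ hm hA, e A hA]
    exact hμ _ (measurableSet_sum_mem hA)
  · rw [e _ MeasurableSet.univ]
    exact hP.univ

end StopTensor

theorem apply_elem_eq_of_total {ι κ E F G : Type*} [NormedAddCommGroup E] [InnerProductSpace ℂ E]
    [NormedAddCommGroup F] [InnerProductSpace ℂ F] [NormedAddCommGroup G] [InnerProductSpace ℂ G]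
    {a : ι → E} {b : κ → F} (ha : Total a) (hb : Total b) {R : G →L[ℂ] G}
    {K : HilbertTensor E F →L[ℂ] G} {Y : E →L[ℂ] E}
    (h : ∀ i j, R (K (elem (a i) (b j))) = K (elem (Y (a i)) (b j))) (x : E) (y : F) :
    R (K (elem x y)) = K (elem (Y x) y) := by
  have h1 : ∀ i, (R.comp K).comp (elemL E F (a i)) = K.comp (elemL E F (Y (a i))) :=
    fun i => clm_eq_of_total hb fun j => h i j
  have h2 : (R.comp K).comp ((elemL E F).flip y) = (K.comp ((elemL E F).flip y)).comp Y :=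
    clm_eq_of_total ha fun i => congrArg (fun K : F →L[ℂ] G => K y) (h1 i)
  exact congrArg (fun K : E →L[ℂ] G => K x) h2

/-! ### The convolution is a finite quantum stop time -/

section Convolution

variable {k : Type u} [NormedAddCommGroup k] [InnerProductSpace ℂ k]
  {S T : Set ℝ≥0∞ → (FockHalf k →L[ℂ] FockHalf k)} {f g : L2Half k}
  {x y : ℝ≥0∞ → FockHalf k} {A : Set ℝ≥0∞}

/-- A self-adjoint operator acts only on the Fock space over `[0, t)` if its matrix elements
between exponential vectors, up to the obvious factor, depend only on the restrictions to
`[0, t)`. -/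
theorem exists_adapted_of_inner {R : FockHalf k →L[ℂ] FockHalf k} {t : ℝ≥0}
    (hR : ∀ x y, ⟪R x, y⟫_ℂ = ⟪x, R y⟫_ℂ)
    (h : ∀ g f f' : L2Half k, cut t f = cut t f' →
      Complex.exp (-⟪sh t g, sh t f⟫_ℂ) * ⟪expVec g, R (expVec f)⟫_ℂ =
        Complex.exp (-⟪sh t g, sh t f'⟫_ℂ) * ⟪expVec g, R (expVec f')⟫_ℂ) :
    ∃ Y : FockBefore k t →L[ℂ] FockBefore k t,
      ∀ x y, R (split k t (elem x y)) = split k t (elem (Y x) y) := by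
  let W : FockBefore k t →L[ℂ] FockHalf k :=
    -- `W` appends the vacuum after time `t`, and the required operator is the compression of `R` by
    -- `W`.
    (split k t).comp ((elemL (FockBefore k t) (FockAfter k t)).flip (expVec 0))
  have hW : ∀ f : L2Half k, W (expVec (before t f)) = expVec (cut t f) := by
    intro f
    have h1 : before t (cut t f) = before t f := before_eq (cut_cut _ _)
    have h2 : after t (cut t f) = 0 := by
      rw [← after_zero t]
      exact after_eq (by rw [sh_cut, map_zero])
    rw [← split_elem t (cut t f), h1, h2]
    rfl
  let Y : FockBefore k t →L[ℂ] FockBefore k t := (ContinuousLinearMap.adjoint W).comp (R.comp W)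
  -- Locality is assumed in the right argument only; self-adjointness of `R` transfers it to the
  -- left one.
  have key : ∀ g f : L2Half k, ⟪expVec g, R (expVec f)⟫_ℂ =
      Complex.exp ⟪sh t g, sh t f⟫_ℂ * ⟪expVec (cut t g), R (expVec (cut t f))⟫_ℂ := by
    intro g f
    have h1 := h g f (cut t f) (cut_cut _ _).symm
    have h2 := h (cut t f) g (cut t g) (cut_cut _ _).symm
    rw [sh_cut, inner_zero_right, neg_zero, Complex.exp_zero, one_mul] at h1
    rw [sh_cut, inner_zero_left, inner_zero_left, neg_zero, Complex.exp_zero, one_mul,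
      one_mul] at h2
    have h3 : ⟪expVec g, R (expVec (cut t f))⟫_ℂ = ⟪expVec (cut t g), R (expVec (cut t f))⟫_ℂ := by
      rw [← hR, ← hR, ← inner_conj_symm (𝕜 := ℂ) (E := FockHalf k),
        ← inner_conj_symm (𝕜 := ℂ) (E := FockHalf k) (R (expVec (cut t g))), h2]
    rw [← h3, ← h1, ← mul_assoc, ← Complex.exp_add, add_neg_cancel, Complex.exp_zero, one_mul]
  have h0 : ∀ f : L2Half k, R (split k t (elem (expVec (before t f)) (expVec (after t f)))) =
      split k t (elem (Y (expVec (before t f))) (expVec (after t f))) := by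
    intro f
    refine eq_of_total_inner total_expVec fun g => ?_
    have h1 : ⟪expVec (before t g), Y (expVec (before t f))⟫_ℂ =
        ⟪expVec (cut t g), R (expVec (cut t f))⟫_ℂ := by
      change ⟪expVec (before t g), ContinuousLinearMap.adjoint W (R (W (expVec (before t f))))⟫_ℂ = _
      rw [ContinuousLinearMap.adjoint_inner_right, hW, hW]
    rw [split_elem, key, ← h1]
    conv_rhs => rw [← split_elem t g]
    rw [inner_split, inner_elem, inner_expVec (after t g), inner_after, mul_comm]
  refine ⟨Y, apply_elem_eq_of_total total_expVec total_expVec fun a b => ?_⟩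
  obtain ⟨f, rfl, rfl⟩ := exists_before_after t a b
  exact h0 f

theorem setOf_add_le_eq {s p : ℝ≥0∞} (hs : s ≠ ⊤) (hsp : s ≤ p) :
    {t : ℝ≥0∞ | s + t ∈ Iic p} = Iic (p - s) := by
  ext t
  rw [mem_ofPred_eq, mem_Iic, mem_Iic]
  exact (ENNReal.cancel_of_ne hs).le_tsub_iff_left hsp |>.symm

theorem setOf_add_le_eq_empty {s p : ℝ≥0∞} (hsp : p < s) :
    {t : ℝ≥0∞ | s + t ∈ Iic p} = ∅ :=
  eq_empty_of_forall_notMem fun _ ht => (hsp.trans_le (le_self_add.trans ht)).false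

theorem inner_conv_expVec (hS : IsFiniteQuantumStopTime S) (hT : IsSpectralMeasure T)
    (hA : MeasurableSet A) (g f : L2Half k) :
    ⟪expVec g, conv S T A (expVec f)⟫_ℂ = cint (stopMeasure S g f) univ
      fun s => ⟪expVec (sh s g), T {t | s + t ∈ A} (expVec (sh s f))⟫_ℂ := by
  rw [expVec_eq_sint hS f, conv_sint hS hT hA f (bddMeas_expVec_sh f), expVec_eq_sint hS g]
  exact inner_sint hS g f (bddMeas_expVec_sh g) (bddMeas_apply_add_mem hT hA (bddMeas_expVec_sh f))

theorem inner_conv_Iic (hS : IsFiniteQuantumStopTime S) (hT : IsSpectralMeasure T)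
    (p : ℝ≥0) (g f : L2Half k) :
    ⟪expVec g, conv S T (Iic p) (expVec f)⟫_ℂ = cint (stopMeasure S g f) (Iic p)
      fun s => ⟪expVec (sh s g), T (Iic (p - s)) (expVec (sh s f))⟫_ℂ := by
  rw [inner_conv_expVec hS hT measurableSet_Iic, ← univ_inter (Iic (p : ℝ≥0∞)),
    ← cint_indicator MeasurableSet.univ measurableSet_Iic, univ_inter]
  refine cint_congr_fun fun s _ => ?_
  by_cases hs : s ≤ p
  · rw [indicator_of_mem (mem_Iic.2 hs),
      setOf_add_le_eq (ne_top_of_le_ne_top ENNReal.coe_ne_top hs) hs]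
  · rw [indicator_of_notMem (by simpa using hs), setOf_add_le_eq_empty (not_le.1 hs), hT.empty]
    exact inner_zero_right _

/-- On `[0, p]` the set `[0, p - s]` is a section of a measurable set; beyond `p` truncated
subtraction breaks this, hence the indicator. -/
theorem bddMeas_inner_apply_Iic_sub (hT : IsSpectralMeasure T) (p : ℝ≥0) (g f : L2Half k) :
    BddMeas ((Iic (p : ℝ≥0∞)).indicator
      fun s => ⟪expVec (sh s g), T (Iic (p - s)) (expVec (sh s f))⟫_ℂ) := by
  have h := ((bddMeas_expVec_sh g).inner (bddMeas_apply_add_mem hT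
    (measurableSet_Iic (a := (p : ℝ≥0∞))) (bddMeas_expVec_sh f))).indicator
    (measurableSet_Iic (a := (p : ℝ≥0∞)))
  convert h using 1
  refine indicator_congr fun s (hs : s ≤ p) => ?_
  rw [setOf_add_le_eq (ne_top_of_le_ne_top ENNReal.coe_ne_top hs) hs]

/-- On `[0, p]` the measure `S^{g,f}` is local. In the integrand `T` is adapted at time `p - s`
relative to the shifted functions, and its exponential factor there is exactly the one at `p`,
because `(p - s) + s = p`. -/
theorem conv_adapted_inner (hS : IsFiniteQuantumStopTime S) (hT : IsFiniteQuantumStopTime T)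
    (p : ℝ≥0) (g : L2Half k) {f f' : L2Half k} (h : cut p f = cut p f') :
    Complex.exp (-⟪sh p g, sh p f⟫_ℂ) * ⟪expVec g, conv S T (Iic p) (expVec f)⟫_ℂ =
      Complex.exp (-⟪sh p g, sh p f'⟫_ℂ) * ⟪expVec g, conv S T (Iic p) (expVec f')⟫_ℂ := by
  have hm : MeasurableSet (Iic (p : ℝ≥0∞)) := measurableSet_Iic
  have e : ∀ f : L2Half k,
      Complex.exp (-⟪sh p g, sh p f⟫_ℂ) * ⟪expVec g, conv S T (Iic p) (expVec f)⟫_ℂ =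
      cint (stopMeasure S g f) (Iic p) fun s => Complex.exp (-⟪sh p g, sh p f⟫_ℂ) *
        ⟪expVec (sh s g), T (Iic (p - s)) (expVec (sh s f))⟫_ℂ := by
    intro f
    have h1 := bddMeas_inner_apply_Iic_sub hT.spectral p g f
    rw [inner_conv_Iic hS hT.spectral]
    have h2 : cint (stopMeasure S g f) (Iic p)
        (fun s => ⟪expVec (sh s g), T (Iic (p - s)) (expVec (sh s f))⟫_ℂ) =
        cint (stopMeasure S g f) (Iic p) ((Iic (p : ℝ≥0∞)).indicator
          fun s => ⟪expVec (sh s g), T (Iic (p - s)) (expVec (sh s f))⟫_ℂ) :=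
      cint_congr_fun fun s hs => by rw [indicator_of_mem hs]
    rw [h2, ← cint_const_mul hm _ h1]
    refine cint_congr_fun fun s hs => ?_
    rw [indicator_of_mem hs]
  rw [e f, e f', cint_measure_congr hm fun B hB hBm => stopMeasure_local hS g h hB hBm]
  refine cint_congr_fun fun s (hs : s ≤ p) => ?_
  have hs' : s ≠ ⊤ := ne_top_of_le_ne_top ENNReal.coe_ne_top hs
  have h1 := adapted_inner hT (sh s g) (q := p - s) (f := sh s f) (f' := sh s f') (by
    rw [← sh_cut_of_le hs' hs, ← sh_cut_of_le hs' hs, h])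
  simpa only [sh_sh, tsub_add_cancel_of_le hs] using h1

theorem conv_eq_zero (hS : IsFiniteQuantumStopTime S) (hT : IsSpectralMeasure T)
    (hA : MeasurableSet A) (h : ∀ s, s ≠ 0 → s ≠ ⊤ → T {t | s + t ∈ A} = 0) :
    conv S T A = 0 := by
  refine clm_eq_of_total (total_sint hS) fun q => ?_
  rw [conv_sint hS hT hA _ q.2.2, zero_apply, ← sint_zero hS q.1]
  refine sint_congr hS _ (bddMeas_apply_add_mem hT hA q.2.2) (BddMeas.const 0) fun s h0 ht => ?_
  rw [h s h0 ht]
  rfl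

theorem isFiniteQuantumStopTime_conv (hS : IsFiniteQuantumStopTime S)
    (hT : IsFiniteQuantumStopTime T) : IsFiniteQuantumStopTime (conv S T) := by
  have h0 : conv S T {0} = 0 := by
    refine conv_eq_zero hS hT.spectral (measurableSet_singleton 0) fun s hs _ => ?_
    have : {t : ℝ≥0∞ | s + t ∈ ({0} : Set ℝ≥0∞)} = ∅ := by
      ext t
      simp [hs]
    rw [this, hT.spectral.empty]
  have hc := isSpectralMeasure_conv hS hT.spectral
  refine ⟨⟨hc, ⟨0, by rw [h0]; exact (zero_smul ℂ (1 : FockHalf k →L[ℂ] FockHalf k)).symm⟩, fun t _ => ?_⟩, h0, ?_⟩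
  · exact exists_adapted_of_inner (fun x y => hc.inner_left measurableSet_Iic x y)
      fun g f f' h => conv_adapted_inner hS hT t g h
  · refine conv_eq_zero hS hT.spectral (measurableSet_singleton ⊤) fun s _ hs => ?_
    have : {t : ℝ≥0∞ | s + t ∈ ({⊤} : Set ℝ≥0∞)} = {⊤} := by
      ext t
      simp [hs]
    rw [this, hT.top]

end Convolution

/-! ### Disintegration of the convolution -/

section Disintegration

theorem BddMeas.comp_measurable {X Y E : Type*} [MeasurableSpace X] [MeasurableSpace Y]
    [NormedAddCommGroup E] [InnerProductSpace ℂ E] {φ : X → E} (h : BddMeas φ) {h' : Y → X}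
    (hh : Measurable h') : BddMeas fun s => φ (h' s) :=
  ⟨h.1.comp_measurable hh, h.2.imp fun _ hC _ => hC _⟩

variable {k : Type u} [NormedAddCommGroup k] [InnerProductSpace ℂ k]
  {S T : Set ℝ≥0∞ → (FockHalf k →L[ℂ] FockHalf k)} {f g : L2Half k}
  {x y : ℝ≥0∞ → FockHalf k} {A : Set ℝ≥0∞} {φ : ℝ≥0∞ → ℂ}

theorem BddMeas.add_left (h : BddMeas φ) (s : ℝ≥0∞) : BddMeas fun t => φ (s + t) :=
  h.comp_measurable (measurable_const.add measurable_id)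

/-- Measurability of the inner integral in `s` is carried along in the same induction as the
identity. The bound of `norm_cint_le`, uniform in `s`, supplies the domination in the limit step. -/
theorem cint_coeffMeasure_conv (hS : IsFiniteQuantumStopTime S) (hT : IsSpectralMeasure T)
    (hA : MeasurableSet A) (g f : L2Half k) (hy : BddMeas y) (hx : BddMeas x) (hφ : BddMeas φ) :
    (BddMeas fun s => cint (coeffMeasure T (y s) (x s)) {t | s + t ∈ A} fun t => φ (s + t)) ∧
      cint (coeffMeasure (conv S T) (sint S g y) (sint S f x)) A φ =
        cint (stopMeasure S g f) univ fun s =>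
          cint (coeffMeasure T (y s) (x s)) {t | s + t ∈ A} fun t => φ (s + t) := by
  have hc := isSpectralMeasure_conv hS hT
  have hAs : ∀ s : ℝ≥0∞, MeasurableSet {t | s + t ∈ A} := measurableSet_add_mem hA
  refine BddMeas.induction (P := fun φ => (BddMeas fun s =>
      cint (coeffMeasure T (y s) (x s)) {t | s + t ∈ A} fun t => φ (s + t)) ∧
      cint (coeffMeasure (conv S T) (sint S g y) (sint S f x)) A φ =
        cint (stopMeasure S g f) univ fun s =>
          cint (coeffMeasure T (y s) (x s)) {t | s + t ∈ A} fun t => φ (s + t)) ?_ ?_ ?_ hφ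
  · intro c B hB
    have e : (fun s => cint (coeffMeasure T (y s) (x s)) {t | s + t ∈ A}
        fun t => B.indicator (fun _ => c) (s + t)) =
        fun s => c * ⟪y s, T {t | s + t ∈ A ∩ B} (x s)⟫_ℂ := by
      ext1 s
      have e1 : (fun t => B.indicator (fun _ => c) (s + t)) =
          {t | s + t ∈ B}.indicator fun _ => c := by
        classical
        ext1 t
        simp only [indicator_apply, mem_ofPred_eq]
      rw [e1, cint_indicator (hAs s) (measurableSet_add_mem hB s), cint_const,
        coeffMeasure_apply hT _ _ ((hAs s).inter (measurableSet_add_mem hB s))]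
      rfl
    have hb := hy.inner (bddMeas_apply_add_mem hT (hA.inter hB) hx)
    rw [e]
    refine ⟨hb.smul c, ?_⟩
    rw [cint_indicator hA hB, cint_const, coeffMeasure_apply hc _ _ (hA.inter hB),
      conv_sint hS hT (hA.inter hB) f hx,
      inner_sint hS _ _ hy (bddMeas_apply_add_mem hT (hA.inter hB) hx),
      cint_const_mul MeasurableSet.univ c hb]
  · intro φ ψ hφ hψ h1 h2
    have e : (fun s => cint (coeffMeasure T (y s) (x s)) {t | s + t ∈ A}
        fun t => φ (s + t) + ψ (s + t)) = fun s =>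
        cint (coeffMeasure T (y s) (x s)) {t | s + t ∈ A} (fun t => φ (s + t)) +
        cint (coeffMeasure T (y s) (x s)) {t | s + t ∈ A} (fun t => ψ (s + t)) := by
      ext1 s
      exact cint_add (hφ.add_left s) (hψ.add_left s)
    rw [e]
    refine ⟨h1.1.add h2.1, ?_⟩
    rw [cint_add hφ hψ, cint_add h1.1 h2.1, h1.2, h2.2]
  · intro φ ψ C hφ hC hl h
    obtain ⟨D, hD⟩ := hy.2
    obtain ⟨D', hD'⟩ := hx.2
    have hC0 : 0 ≤ C := (norm_nonneg _).trans (hC 0 0)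
    have hb : ∀ n s, ‖cint (coeffMeasure T (y s) (x s)) {t | s + t ∈ A}
        fun t => φ n (s + t)‖ ≤ C * (D * D') := fun n s => by
      have hD0 : 0 ≤ D := (norm_nonneg _).trans (hD 0)
      refine (norm_cint_le hT (fun B hB => coeffMeasure_apply hT _ _ hB) hC0
        (fun t => hC n (s + t)) _).trans ?_
      gcongr
      exacts [hD s, hD' s]
    have ht : ∀ s, Tendsto (fun n => cint (coeffMeasure T (y s) (x s)) {t | s + t ∈ A}
        fun t => φ n (s + t)) atTop (𝓝 (cint (coeffMeasure T (y s) (x s)) {t | s + t ∈ A}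
        fun t => ψ (s + t))) := fun s =>
      cint_tendsto' (hAs s) (fun n => ((hφ n).add_left s).1) (fun n t => hC n (s + t))
        fun t => hl (s + t)
    refine ⟨BddMeas.of_tendsto (fun n => (h n).1.1) hb ht, ?_⟩
    refine tendsto_nhds_unique (cint_tendsto' hA (fun n => (hφ n).1) hC hl) ?_
    simp only [(h _).2]
    exact cint_tendsto' MeasurableSet.univ (fun n => (h n).1.1) hb ht

/-- The densities match: that of `(S ⋆ T)^{g,f}` at `s + t` is that of `T^{g_s,f_s}` at `t`, since
shifts compose. -/
theorem cint_stopMeasure_conv (hS : IsFiniteQuantumStopTime S) (hT : IsSpectralMeasure T)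
    (hA : MeasurableSet A) (g f : L2Half k) (hφ : BddMeas φ) :
    cint (stopMeasure (conv S T) g f) A φ = cint (stopMeasure S g f) univ fun s =>
      cint (stopMeasure T (sh s g) (sh s f)) {t | s + t ∈ A} fun t => φ (s + t) := by
  have h := (cint_coeffMeasure_conv hS hT hA g f (bddMeas_expVec_sh g) (bddMeas_expVec_sh f)
    ((bddMeas_density g f).mul hφ)).2
  rw [stopMeasure_eq, cint_withDensity hA (bddMeas_density g f) hφ]
  rw [← expVec_eq_sint hS, ← expVec_eq_sint hS] at h
  rw [h]
  refine cint_congr_fun fun s _ => ?_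
  rw [stopMeasure_eq T, cint_withDensity (measurableSet_add_mem hA s) (bddMeas_density _ _)
    (hφ.add_left s)]
  simp only [sh_sh, add_comm]

theorem bddMeas_sint_sh (hT : IsFiniteQuantumStopTime T) (f : L2Half k) (y : FockHalf k) :
    BddMeas fun s => sint T (sh s f) fun _ => y := by
  obtain ⟨Φ, hΦ⟩ := exists_clm_sint_const hT y
  simp only [← hΦ]
  exact (bddMeas_expVec_sh f).clm Φ

/-- By `Rep.eq_sint` it is enough to pair the iterated integral with `(S ⋆ T)(A) ε(g)`. Fibrewise
this is a pairing for `T`, and the disintegration reassembles the fibres. -/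
theorem sint_conv_const (hS : IsFiniteQuantumStopTime S) (hT : IsFiniteQuantumStopTime T)
    (f : L2Half k) (y : FockHalf k) : sint (conv S T) f (fun _ => y) =
      sint S f fun s => sint T (sh s f) fun _ => y := by
  refine ((Rep.eq_sint (isFiniteQuantumStopTime_conv hS hT) ⟨BddMeas.const y, fun g A hA => ?_⟩)).symm
  rw [cint_stopMeasure_conv hS hT.spectral hA g f ((bddMeas_expVec_sh g).inner (BddMeas.const y)),
    expVec_eq_sint hS g, conv_sint hS hT.spectral hA g (bddMeas_expVec_sh g),
    inner_sint hS _ _ (bddMeas_apply_add_mem hT.spectral hA (bddMeas_expVec_sh g))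
      (bddMeas_sint_sh hT f y)]
  refine cint_congr_fun fun s _ => ?_
  have h := inner_apply_sint hT (sh s g) (sh s f) (bddMeas_expVec_sh (sh s g)) (BddMeas.const y)
    (measurableSet_add_mem hA s)
  rw [← expVec_eq_sint hT] at h
  rw [h]
  simp only [sh_sh, add_comm]

end Disintegration

/-! ### Existence of stop-time integrals of measurable functions -/

section MeasurableIntegrals

variable {k : Type u} [NormedAddCommGroup k] [InnerProductSpace ℂ k]
  {S T : Set ℝ≥0∞ → (FockHalf k →L[ℂ] FockHalf k)} {f g : L2Half k}
  {x y : ℝ≥0∞ → FockHalf k} {t : ℝ≥0∞}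

theorem continuous_Gam_uncurry : Continuous fun p : ℝ≥0 × FockHalf k => Gam k p.1 p.2 := by
  refine continuous_iff_continuousAt.2 fun p => ?_
  have h1 := ((continuous_Gam p.2).tendsto p.1).comp (continuous_fst.tendsto p)
  have h2 : Tendsto (fun q : ℝ≥0 × FockHalf k => Gam k q.1 (q.2 - p.2)) (𝓝 p) (𝓝 0) := by
    refine squeeze_zero_norm (fun q => (norm_Gam _ _).le) ?_
    have := ((continuous_snd.tendsto p).sub (tendsto_const_nhds (x := p.2))).norm
    rwa [sub_self, norm_zero] at this
  have h3 := h2.add h1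
  rw [zero_add] at h3
  refine h3.congr fun q => ?_
  rw [map_sub, Function.comp_apply, sub_add_cancel]

theorem stronglyMeasurable_Gam (hx : StronglyMeasurable x) :
    StronglyMeasurable fun s : ℝ≥0 => Gam k s (x s) := by
  have h : StronglyMeasurable fun s : ℝ≥0 => x s :=
    hx.comp_measurable measurable_coe_nnreal_ennreal
  have h' : StronglyMeasurable fun s : ℝ≥0 => ((s, x s) : ℝ≥0 × FockHalf k) :=
    (stronglyMeasurable_id (α := ℝ≥0)).prodMk h
  exact Continuous.comp_stronglyMeasurable (f := fun s : ℝ≥0 => ((s, x s) : ℝ≥0 × FockHalf k))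
    (g := fun p : ℝ≥0 × FockHalf k => Gam k p.1 p.2) continuous_Gam_uncurry h'

/-- This returns from representing functions to stop-time integrals. The integral over `[0, r]` is
`S([0, r])` applied to the full one, and `⟪Γ_s x, Γ_s y⟫ = ⟪x, y⟫` converts the pairings. -/
theorem isStopIntegral_of_eq_Gam (hS : IsFiniteQuantumStopTime S) (f : L2Half k) (hx : BddMeas x)
    {F : ℝ≥0 → FockHalf k} (hF : ∀ s : ℝ≥0, (s : ℝ≥0∞) ≤ t → F s = Gam k s (x s)) :
    IsStopIntegral S t f F (S (Iic t) (sint S f x)) := by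
  refine ⟨?_, ?_, fun s _ hs => ⟨postIso s (x s), (hF s hs).trans (Gam_eq_split _ _)⟩,
    fun r => S (Iic r) (sint S f x), rfl, ?_, ?_⟩
  · have h := (stronglyMeasurable_Gam hx.1).comp_measurable
      (measurable_subtype_coe (p := fun s : ℝ≥0 => (s : ℝ≥0∞) ≤ t))
    have e : (fun s : {s : ℝ≥0 // (s : ℝ≥0∞) ≤ t} => F s) =
        (fun s : ℝ≥0 => Gam k s (x s)) ∘ Subtype.val := funext fun s => hF s s.2
    rw [e]
    exact h
  · obtain ⟨C, hC⟩ := hx.2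
    exact ⟨C, fun s hs => by rw [hF s hs, norm_Gam]; exact hC _⟩
  · intro r hr g G w hc hb hf hw
    have h1 := strong_of_hasRiemannStopIntegral hS hc hb hf hw
    have h2 := h1.symm hS.spectral ((strong_sint hS f hx).rep hS.spectral) (Iic r)
      measurableSet_Iic
    refine h2.trans (cint_congr measurableSet_zero_top
      (fun B hB hBm => stopMeasure_null hS f g hB hBm) fun s hsr hs => ?_)
    simp only [mem_insert_iff, mem_singleton_iff, not_or] at hs
    have hs' : s ∈ Ioc 0 r ∩ {⊤}ᶜ := ⟨⟨pos_iff_ne_zero.2 hs.1, hsr⟩, hs.2⟩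
    rw [indicator_of_mem hs']
    rw [extTop, if_neg hs.2, extTop, if_neg hs.2]
    have hs2 := hs.2
    lift s to ℝ≥0 using hs2
    rw [ENNReal.toNNReal_coe, hF s (le_trans hsr hr),
      hf.eq_Gam (ENNReal.coe_pos.1 (pos_iff_ne_zero.2 hs.1)) hsr, inner_Gam]
  · intro q r _ _
    rw [hS.spectral.inter measurableSet_Iic measurableSet_Iic, Iic_inter_Iic]

theorem isStopIntegral_top_of_eq_Gam (hS : IsFiniteQuantumStopTime S) (f : L2Half k)
    (hx : BddMeas x) {F : ℝ≥0 → FockHalf k} (hF : ∀ s : ℝ≥0, F s = Gam k s (x s)) :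
    IsStopIntegral S ⊤ f F (sint S f x) := by
  have h := isStopIntegral_of_eq_Gam hS f hx (t := ⊤) fun s _ => hF s
  rw [Iic_top, hS.spectral.univ] at h
  exact h

end MeasurableIntegrals

end StopTime

end
-- The theorem
open StopTime in
theorem mainTheorem5 {k : Type*} [NormedAddCommGroup k] [InnerProductSpace ℂ k] [CompleteSpace k]
    (S T : Set ℝ≥0∞ → (FockHalf k →L[ℂ] FockHalf k))
    (hS : IsFiniteQuantumStopTime S) (hT : IsFiniteQuantumStopTime T) :
    (∀ (u : ℝ≥0∞) (f : L2Half k),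
      IsStopIntegral S u f
        (fun s => Gam k s (T (Iic (u - s)) (ContinuousLinearMap.adjoint (Gam k s) (expVec f))))
        (conv S T (Iic u) (expVec f))) ∧
    IsFiniteQuantumStopTime (conv S T) ∧
    (∀ f : L2Half k,
      IsStopIntegral S ⊤ f
        (fun s => Gam k s (timeProj T (ContinuousLinearMap.adjoint (Gam k s) (expVec f))))
        (timeProj (conv S T) (expVec f))) ∧
    (∀ (f : L2Half k) (y : FockHalf k),
      ∃ I : ℝ≥0 → FockHalf k,
        (∀ s, IsStopIntegral T ⊤ (shiftAdj s f) (fun t => Gam k t y) (I s)) ∧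
        IsStopIntegral S ⊤ f (fun s => Gam k s (I s))
          (jIso (conv S T) (elem (toPre (conv S T) (expVec f)) (toPost (conv S T) y)))) := by
  have hST := isFiniteQuantumStopTime_conv hS hT
  refine ⟨fun u f => ?_, hST, fun f => ?_, fun f y => ?_⟩
  · have hb := bddMeas_apply_add_mem hT.spectral (measurableSet_Iic (a := u)) (bddMeas_expVec_sh f)
    -- Applying `S([0, u])` costs nothing: for `s > u` no `t` satisfies `s + t ≤ u`, so the
    -- integrand already vanishes.
    have h1 : conv S T (Iic u) (expVec f) =
        S (Iic u) (sint S f fun s => T {t | s + t ∈ Iic u} (expVec (sh s f))) := by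
      conv_lhs => rw [expVec_eq_sint hS f]
      rw [conv_sint hS hT.spectral measurableSet_Iic f (bddMeas_expVec_sh f),
        apply_sint hS f hb measurableSet_Iic]
      congr 1
      ext1 s
      by_cases hs : s ≤ u
      · rw [indicator_of_mem (mem_Iic.2 hs)]
      · rw [indicator_of_notMem (by simpa using hs), setOf_add_le_eq_empty (not_le.1 hs),
          hT.spectral.empty]
        rfl
    rw [h1]
    refine isStopIntegral_of_eq_Gam hS f hb fun s hs => ?_
    rw [adjoint_Gam_expVec, setOf_add_le_eq ENNReal.coe_ne_top hs, sh_coe]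
  · rw [timeProj_expVec hST, sint_conv_const hS hT]
    refine isStopIntegral_top_of_eq_Gam hS f (bddMeas_sint_sh hT f (expVec 0)) fun s => ?_
    rw [adjoint_Gam_expVec, timeProj_expVec hT, sh_coe]
  -- The inner integral is the `T`-integral of the constant `y` over `f(· + s)`, which
  -- `sint_conv_const` produces.
  · refine ⟨fun s => sint T (shiftAdj s f) fun _ => y, fun s =>
      isStopIntegral_top_of_eq_Gam hT _ (BddMeas.const y) fun _ => rfl, ?_⟩
    have h1 : jIso (conv S T) (elem (toPre (conv S T) (expVec f)) (toPost (conv S T) y)) =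
        sint S f fun s => sint T (sh s f) fun _ => y :=
      (stopElem_expVec hST f y).trans (sint_conv_const hS hT f y)
    rw [h1]
    refine isStopIntegral_top_of_eq_Gam hS f (bddMeas_sint_sh hT f y) fun s => ?_
    rw [sh_coe]
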